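/- Let $A$ be a commutative ring, $n,d\in\mathbb N$, and let $\mathcal K=\bigsqcup_{j=1}^d\mathcal K_j$ be a finite set partitioned into $d$ (possibly empty) parts. Let $Q=(Q_{k,k'})_{k,k'\in\mathcal K}$ be a matrix of polynomials in $A[u,v]$ with $Q_{k,k'}(u,v)=Q_{k',k}(v,u)$ and $Q_{k,k}=0$ for all $k,k'\in\mathcal K$, and assume that $Q_{k,k'}=1$ whenever $k$ and $k'$ lie in different parts. Let $Q^j$ be the restriction of $Q$ to $\mathcal K_j$. The symmetric group $\mathfrak S_n$, with simple transpositions $s_a=(a,a+1)$ and the corresponding length function, acts on $n$-tuples by $(w\cdot x)_a=x_{w^{-1}(a)}$. The quiver Hecke algebra $\mathrm H_n(Q)$ is the unital associative $A$-algebra with generators $e(\mathbf k)$ ($\mathbf k\in\mathcal K^n$), $y_1,\dots,y_n$, $\psi_1,\dots,\psi_{n-1}$ and relations: $\sum_{\mathbf k}e(\mathbf k)=1$; $e(\mathbf k)e(\mathbf k')=\delta_{\mathbf k,\mathbf k'}e(\mathbf k)$; $y_ae(\mathbf k)=e(\mathbf k)y_a$; $\psi_ae(\mathbf k)=e(s_a\cdot\mathbf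 k)\psi_a$; $y_ay_b=y_by_a$; $\psi_ay_b=y_b\psi_a$ if $b\neq a,a+1$; $\psi_a\psi_b=\psi_b\psi_a$ if $|a-b|>1$; $\psi_ay_{a+1}e(\mathbf k)=(y_a\psi_a+\delta_{k_a,k_{a+1}})e(\mathbf k)$; $y_{a+1}\psi_ae(\mathbf k)=(\psi_ay_a+\delta_{k_a,k_{a+1}})e(\mathbf k)$; $\psi_a^2e(\mathbf k)=Q_{k_a,k_{a+1}}(y_a,y_{a+1})e(\mathbf k)$; and $$(\psi_{a+1}\psi_a\psi_{a+1}-\psi_a\psi_{a+1}\psi_a)e(\mathbf k)=\begin{cases}\dfrac{Q_{k_a,k_{a+1}}(y_a,y_{a+1})-Q_{k_a,k_{a+1}}(y_{a+2},y_{a+1})}{y_a-y_{a+2}}\,e(\mathbf k)&\text{if }k_a=k_{a+2},\\0&\text{otherwise,}\end{cases}$$ where the fraction denotes the polynomial obtained by formal division. For a $d$-composition $\lambda=(\lambda_1,\dots,\lambda_d)$ of $n$ (parts $\lambda_j\ge 0$, written $\lambda\models_d n$), let $m_\lambda=\frac{n!}{\lambda_1!\cdots\lambda_d!}$, let $\mathrm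 H_\lambda(Q)=\mathrm H_{\lambda_1}(Q^1)\otimes_A\cdots\otimes_A\mathrm H_{\lambda_d}(Q^d)$, let $J^\lambda$ be the set of $\mathfrak t\in\{1,\dots,d\}^n$ in which each $j$ occurs exactly $\lambda_j$ times, and let $\mathfrak t^\lambda=(1,\dots,1,\dots,d,\dots,d)\in J^\lambda$. The Young subgroup $\mathfrak S_\lambda=\mathfrak S_{\lambda_1}\times\cdots\times\mathfrak S_{\lambda_d}\subseteq\mathfrak S_n$ is the stabiliser of $\mathfrak t^\lambda$, and for $\mathfrak t\in J^\lambda$ the elements $w$ with $w\cdot\mathfrak t=\mathfrak t^\lambda$ form a right coset $\mathfrak S_\lambda w$; let $\pi_{\mathfrak t}$ denote an element of minimal length of it. Put $e(\mathfrak t)=\sum e(\mathbf k)$, the sum over all $\mathbf k\in\mathcal K^n$ with $k_a\in\mathcal K_{\mathfrak t_a}$ for all $a$. For a reduced expression $w=s_{a_1}\cdots s_{a_r}$ put $\psi_w=\psi_{a_1}\cdots\psi_{a_r}$. **Theorem.** There is an isomorphism of $A$-algebras $$\mathrm H_n(Q)\;\simeq\;\bigoplus_{\lambda\models_d n}\mathrm{Mat}_{m_\lambda}\bigl(\mathrm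 H_\lambda(Q)\bigr).$$ More precisely, $\#J^\lambda=m_\lambda$ for every $\lambda\models_d n$; the minimal length element $\pi_{\mathfrak t}$ is unique for every $\mathfrak t\in J^\lambda$; and there are * for every $\lambda\models_d n$, an injective multiplicative $A$-linear map $\iota_\lambda:\mathrm H_\lambda(Q)\to\mathrm H_n(Q)$ with image $e(\mathfrak t^\lambda)\mathrm H_n(Q)e(\mathfrak t^\lambda)$, with $\iota_\lambda(1)=e(\mathfrak t^\lambda)$, sending $e(\mathbf k^1)\otimes\cdots\otimes e(\mathbf k^d)$ to $e(\mathbf k^1,\dots,\mathbf k^d)$, and sending the generators $y_b$ and $\psi_b$ of the $j$-th factor to $y_{\lambda_1+\cdots+\lambda_{j-1}+b}\,e(\mathfrak t^\lambda)$ and $\psi_{\lambda_1+\cdots+\lambda_{j-1}+b}\,e(\mathfrak t^\lambda)$ respectively; * an $A$-algebra isomorphism $\Psi:\mathrm H_n(Q)\to\bigoplus_{\lambda\models_d n}\mathrm{Mat}_{J^\lambda}(\mathrm H_\lambda(Q))$, where $\mathrm{Mat}_{J^\lambda}$ denotes square matrices with rows and columns indexed by $J^\lambda$, such that for all $\lambda\models_d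 n$, all $\mathfrak t',\mathfrak t\in J^\lambda$ and every choice of reduced expressions of $\pi_{\mathfrak t'}$, $\pi_{\mathfrak t'}^{-1}$, $\pi_{\mathfrak t}$, $\pi_{\mathfrak t}^{-1}$, $$\Psi^{-1}(x\,E_{\mathfrak t',\mathfrak t})=\psi_{\pi_{\mathfrak t'}^{-1}}\,\iota_\lambda(x)\,\psi_{\pi_{\mathfrak t}}\quad(x\in\mathrm H_\lambda(Q)),\qquad \iota_\lambda\bigl(\Psi(h)^{\lambda}_{\mathfrak t',\mathfrak t}\bigr)=\psi_{\pi_{\mathfrak t'}}\,e(\mathfrak t')\,h\,e(\mathfrak t)\,\psi_{\pi_{\mathfrak t}^{-1}}\quad(h\in\mathrm H_n(Q)),$$ where $E_{\mathfrak t',\mathfrak t}$ is the elementary matrix in the $\lambda$-summand and $\Psi(h)^{\lambda}_{\mathfrak t',\mathfrak t}$ is the $(\mathfrak t',\mathfrak t)$ entry of the $\lambda$-component of $\Psi(h)$. -/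

import Mathlib

namespace QuiverHecke

open scoped Nat TensorProduct

/-! ### The symmetric group and its simple transpositions

Positions are `0, …, n - 1` instead of `1, …, n`. -/

/-- The position `a`, for an index `a` of a simple transposition. -/
def lo {n : ℕ} (a : Fin (n - 1)) : Fin n := ⟨a, by omega⟩

/-- The position `a + 1`, as an element of `Fin n`. -/
def hi {n : ℕ} (a : Fin (n - 1)) : Fin n := ⟨a + 1, by omega⟩

/-- The simple transposition `s_a = (a, a + 1)`. -/
def s {n : ℕ} (a : Fin (n - 1)) : Equiv.Perm (Fin n) := Equiv.swap (lo a) (hi a)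

/-- The left action on tuples: `(w · x)_a = x_{w⁻¹ a}`. -/
def act {n : ℕ} {X : Type*} (w : Equiv.Perm (Fin n)) (x : Fin n → X) : Fin n → X :=
  fun a => x (w⁻¹ a)

/-- The product `s_{a_1} ⋯ s_{a_r}` attached to a word `a_1 … a_r`. -/
def wordProd {n : ℕ} (ws : List (Fin (n - 1))) : Equiv.Perm (Fin n) := (ws.map s).prod

/-- The simple transpositions generate, so that the length below is an honest minimum. -/
theorem exists_word {n : ℕ} (w : Equiv.Perm (Fin n)) : ∃ ws, wordProd ws = w := by
  cases n with
  | zero => exact ⟨[], Subsingleton.elim _ _⟩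
  | succ m =>
    have h : w ∈ Submonoid.closure
        (Set.range fun i : Fin m => Equiv.swap i.castSucc i.succ) := by
      rw [Equiv.Perm.mclosure_swap_castSucc_succ]; trivial
    induction h using Submonoid.closure_induction with
    | mem x hx =>
      obtain ⟨i, rfl⟩ := hx
      exact ⟨[i], by simp [wordProd, s]; rfl⟩
    | one => exact ⟨[], rfl⟩
    | mul x y _ _ hx hy =>
      obtain ⟨u, rfl⟩ := hx
      obtain ⟨v, rfl⟩ := hy
      exact ⟨u ++ v, by simp [wordProd]⟩

/-- The length of a permutation with respect to the simple transpositions. -/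
noncomputable def len {n : ℕ} (w : Equiv.Perm (Fin n)) : ℕ :=
  sInf {r | ∃ ws : List (Fin (n - 1)), ws.length = r ∧ wordProd ws = w}

/-- `ws` is a reduced expression of `w`. -/
def IsReducedExpr {n : ℕ} (ws : List (Fin (n - 1))) (w : Equiv.Perm (Fin n)) : Prop :=
  wordProd ws = w ∧ ws.length = len w

/-! ### Quiver Hecke algebras -/

section Algebra

variable {K : Type*} {A : Type*} [CommRing A]

/-- The conditions on the matrix `Q = (Q_{k,k'})` of polynomials in `A[u, v]`, where `u` is the
variable `0` and `v` the variable `1`. -/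
structure IsRouquierMatrix (Q : K → K → MvPolynomial (Fin 2) A) : Prop where
  symm : ∀ k k', Q k k' = MvPolynomial.rename (Equiv.swap (0 : Fin 2) 1) (Q k' k)
  diag : ∀ k, Q k k = 0

/-- The value `P(x, y) = ∑ c_{i,l} x^i y^l` of `P = ∑ c_{i,l} u^i v^l` in an associative algebra
(only used for elements which commute in the quiver Hecke algebra). -/
noncomputable def evalAt {R : Type*} [Ring R] [Algebra A R] (P : MvPolynomial (Fin 2) A)
    (x y : R) : R :=
  ∑ m ∈ P.support, P.coeff m • (x ^ m 0 * y ^ m 1)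

/-- The divided difference `(P(x, y) - P(z, y)) / (x - z)`, that is
`∑ c_{i,l} (x^(i-1) + x^(i-2) z + ⋯ + z^(i-1)) y^l` for `P = ∑ c_{i,l} u^i v^l`. -/
noncomputable def divDiff {R : Type*} [Ring R] [Algebra A R] (P : MvPolynomial (Fin 2) A)
    (x y z : R) : R :=
  ∑ m ∈ P.support, P.coeff m • ((∑ i ∈ Finset.range (m 0), x ^ i * z ^ (m 0 - 1 - i)) * y ^ m 1)

theorem evalAt_eq_aeval {R : Type*} [CommRing R] [Algebra A R] (P : MvPolynomial (Fin 2) A)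
    (x y : R) : evalAt P x y = MvPolynomial.aeval ![x, y] P := by
  rw [MvPolynomial.aeval_eq_eval₂Hom, MvPolynomial.coe_eval₂Hom, MvPolynomial.eval₂_eq']
  simp [evalAt, Algebra.smul_def]

theorem divDiff_mul {R : Type*} [CommRing R] [Algebra A R] (P : MvPolynomial (Fin 2) A)
    (x y z : R) : divDiff P x y z * (x - z) = evalAt P x y - evalAt P z y := by
  rw [divDiff, evalAt, evalAt, Finset.sum_mul, ← Finset.sum_sub_distrib]
  refine Finset.sum_congr rfl fun m _ => ?_
  rw [← smul_sub, smul_mul_assoc, ← sub_mul, ← Commute.geom_sum₂_mul (Commute.all x z)]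
  congr 1
  ring

/-- The generators `e(k)`, `y_a`, `ψ_a` of `H_n(Q)`. -/
inductive Gen (K : Type*) (n : ℕ) : Type _
  | e : (Fin n → K) → Gen K n
  | y : Fin n → Gen K n
  | psi : Fin (n - 1) → Gen K n

variable (A) in
/-- The idempotent generators in the free algebra. -/
abbrev fe {n : ℕ} (k : Fin n → K) : FreeAlgebra A (Gen K n) := FreeAlgebra.ι A (Gen.e k)

variable (A K) in
/-- The polynomial generators in the free algebra. -/
abbrev fy {n : ℕ} (a : Fin n) : FreeAlgebra A (Gen K n) := FreeAlgebra.ι A (Gen.y a)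

variable (A K) in
/-- The braid-like generators in the free algebra. -/
abbrev fpsi {n : ℕ} (a : Fin (n - 1)) : FreeAlgebra A (Gen K n) := FreeAlgebra.ι A (Gen.psi a)

/-- The defining relations of the quiver Hecke algebra `H_n(Q)`. In the two braid relations,
`b = a + 1`. -/
inductive Rel [Fintype K] (Q : K → K → MvPolynomial (Fin 2) A) (n : ℕ) :
    FreeAlgebra A (Gen K n) → FreeAlgebra A (Gen K n) → Prop
  | sum_e : Rel Q n (∑ k : Fin n → K, fe A k) 1
  | e_mul_self (k : Fin n → K) : Rel Q n (fe A k * fe A k) (fe A k)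
  | e_mul_ne (k k' : Fin n → K) (h : k ≠ k') : Rel Q n (fe A k * fe A k') 0
  | y_e (a : Fin n) (k : Fin n → K) : Rel Q n (fy K A a * fe A k) (fe A k * fy K A a)
  | psi_e (a : Fin (n - 1)) (k : Fin n → K) :
      Rel Q n (fpsi K A a * fe A k) (fe A (act (s a) k) * fpsi K A a)
  | y_y (a b : Fin n) : Rel Q n (fy K A a * fy K A b) (fy K A b * fy K A a)
  | psi_y (a : Fin (n - 1)) (b : Fin n) (h : b ≠ lo a) (h' : b ≠ hi a) :
      Rel Q n (fpsi K A a * fy K A b) (fy K A b * fpsi K A a)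
  | psi_psi (a b : Fin (n - 1)) (h : a.val + 1 < b.val ∨ b.val + 1 < a.val) :
      Rel Q n (fpsi K A a * fpsi K A b) (fpsi K A b * fpsi K A a)
  | psi_y_hi_eq (a : Fin (n - 1)) (k : Fin n → K) (h : k (lo a) = k (hi a)) :
      Rel Q n (fpsi K A a * fy K A (hi a) * fe A k) ((fy K A (lo a) * fpsi K A a + 1) * fe A k)
  | psi_y_hi_ne (a : Fin (n - 1)) (k : Fin n → K) (h : k (lo a) ≠ k (hi a)) :
      Rel Q n (fpsi K A a * fy K A (hi a) * fe A k) (fy K A (lo a) * fpsi K A a * fe A k)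
  | y_hi_psi_eq (a : Fin (n - 1)) (k : Fin n → K) (h : k (lo a) = k (hi a)) :
      Rel Q n (fy K A (hi a) * fpsi K A a * fe A k) ((fpsi K A a * fy K A (lo a) + 1) * fe A k)
  | y_hi_psi_ne (a : Fin (n - 1)) (k : Fin n → K) (h : k (lo a) ≠ k (hi a)) :
      Rel Q n (fy K A (hi a) * fpsi K A a * fe A k) (fpsi K A a * fy K A (lo a) * fe A k)
  | psi_sq (a : Fin (n - 1)) (k : Fin n → K) :
      Rel Q n (fpsi K A a * fpsi K A a * fe A k)
        (evalAt (Q (k (lo a)) (k (hi a))) (fy K A (lo a)) (fy K A (hi a)) * fe A k)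
  | braid_eq (a b : Fin (n - 1)) (hab : b.val = a.val + 1) (k : Fin n → K)
      (h : k (lo a) = k (hi b)) :
      Rel Q n (fpsi K A b * fpsi K A a * fpsi K A b * fe A k)
        (fpsi K A a * fpsi K A b * fpsi K A a * fe A k +
          divDiff (Q (k (lo a)) (k (hi a))) (fy K A (lo a)) (fy K A (hi a)) (fy K A (hi b)) *
            fe A k)
  | braid_ne (a b : Fin (n - 1)) (hab : b.val = a.val + 1) (k : Fin n → K)
      (h : k (lo a) ≠ k (hi b)) :
      Rel Q n (fpsi K A b * fpsi K A a * fpsi K A b * fe A k)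
        (fpsi K A a * fpsi K A b * fpsi K A a * fe A k)

/-- The quiver Hecke algebra `H_n(Q)`: the unital associative `A`-algebra given by the generators
`e(k)` (`k ∈ K^n`), `y_1, …, y_n`, `ψ_1, …, ψ_{n-1}` and the relations above. -/
def Hecke [Fintype K] (Q : K → K → MvPolynomial (Fin 2) A) (n : ℕ) : Type _ := RingQuot (Rel Q n)

noncomputable instance [Fintype K] (Q : K → K → MvPolynomial (Fin 2) A) (n : ℕ) :
    Ring (Hecke Q n) := inferInstanceAs (Ring (RingQuot (Rel Q n)))

noncomputable instance [Fintype K] (Q : K → K → MvPolynomial (Fin 2) A) (n : ℕ) :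
    Algebra A (Hecke Q n) := inferInstanceAs (Algebra A (RingQuot (Rel Q n)))

variable [Fintype K] (Q : K → K → MvPolynomial (Fin 2) A)

/-- The canonical surjection from the free algebra onto `H_n(Q)`. -/
noncomputable def mk (n : ℕ) : FreeAlgebra A (Gen K n) →ₐ[A] Hecke Q n :=
  RingQuot.mkAlgHom A (Rel Q n)

/-- The generator `e(k)` of `H_n(Q)`. -/
noncomputable def e {n : ℕ} (k : Fin n → K) : Hecke Q n := mk Q n (fe A k)

/-- The generator `y_a` of `H_n(Q)`. -/
noncomputable def y {n : ℕ} (a : Fin n) : Hecke Q n := mk Q n (fy K A a)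

/-- The generator `ψ_a` of `H_n(Q)`. -/
noncomputable def psi {n : ℕ} (a : Fin (n - 1)) : Hecke Q n := mk Q n (fpsi K A a)

/-- The product `ψ_{a_1} ⋯ ψ_{a_r}`; this is `ψ_w` when `a_1 … a_r` is the chosen reduced
expression of `w`. -/
noncomputable def psiWord {n : ℕ} (ws : List (Fin (n - 1))) : Hecke Q n :=
  (ws.map (psi Q)).prod

end Algebra

/-! ### Compositions, labels and Young subgroups -/

/-- The `d`-compositions `l = (l_1, …, l_d)` of `n` (parts may be zero). -/
abbrev Comp (d n : ℕ) : Type := {l : Fin d → ℕ // ∑ j, l j = n}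

instance (d n : ℕ) : Finite (Comp d n) :=
  Finite.of_injective
    (fun l : Comp d n => fun j : Fin d => (⟨l.1 j, Nat.lt_succ_of_le
      ((Finset.single_le_sum (f := l.1) (fun _ _ => Nat.zero_le _) (Finset.mem_univ j)).trans_eq
        l.2)⟩ : Fin (n + 1)))
    (fun _ _ h => Subtype.ext (funext fun j => congrArg Fin.val (congrFun h j)))

/-- The integer `m_l = n! / (l_1! ⋯ l_d!)`. -/
def mult {d n : ℕ} (l : Comp d n) : ℕ := n ! / ∏ j, (l.1 j)!

/-- The set `J^l` of the tuples `t ∈ {1, …, d}^n` of shape `l`: each `j` occurs `l_j` times. -/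
abbrev Shape {d n : ℕ} (l : Comp d n) : Type :=
  {t : Fin n → Fin d // ∀ j, (Finset.univ.filter fun a => t a = j).card = l.1 j}

section Young

variable {d n : ℕ} (l : Comp d n)

/-- The positions `1, …, n` as a succession of blocks of sizes `l_1, …, l_d`: the pair `(j, b)` is
sent to `l_1 + ⋯ + l_{j-1} + b`. -/
def blk : (Σ j : Fin d, Fin (l.1 j)) ≃ Fin n := finSigmaFinEquiv.trans (finCongr l.2)

theorem blk_hi (j : Fin d) (b : Fin (l.1 j - 1)) :
    (blk l ⟨j, hi b⟩ : ℕ) = blk l ⟨j, lo b⟩ + 1 := by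
  simp [blk, finSigmaFinEquiv_apply, lo, hi, add_assoc]

/-- The index in `{1, …, n - 1}` of the `b`-th simple transposition of the `j`-th block. -/
def blkSimple (j : Fin d) (b : Fin (l.1 j - 1)) : Fin (n - 1) :=
  ⟨blk l ⟨j, lo b⟩, by have := blk_hi l j b; have := (blk l ⟨j, hi b⟩).2; omega⟩

/-- The tuple `t^l = (1, …, 1, …, d, …, d)`, where each `j` appears `l_j` times. -/
def tTriv : Fin n → Fin d := fun a => ((blk l).symm a).1

/-- The Young subgroup `S_l = S_{l_1} × ⋯ × S_{l_d}`: the permutations that preserve each block. -/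
def young : Subgroup (Equiv.Perm (Fin n)) where
  carrier := {w | ∀ a, tTriv l (w a) = tTriv l a}
  one_mem' := fun _ => rfl
  mul_mem' := fun {u v} hu hv a => (hu (v a)).trans (hv a)
  inv_mem' := fun {u} hu a => by simpa using (hu (u⁻¹ a)).symm

/-- `w` is an element of minimal length of its right coset `S_l w`, and this coset is the one
labelled by `t`, that is, `w · t = t^l`. -/
def IsMinCosetRep (t : Shape l) (w : Equiv.Perm (Fin n)) : Prop :=
  act w t.1 = tTriv l ∧ ∀ u ∈ young l, len w ≤ len (u * w)

theorem exists_minCosetRep (t : Shape l) : ∃ w, IsMinCosetRep l t w := by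
  have hc : ∀ j, Fintype.card {a // t.1 a = j} = l.1 j := fun j => by
    rw [Fintype.card_subtype]; exact t.2 j
  let w₀ : Equiv.Perm (Fin n) := (Equiv.sigmaFiberEquiv t.1).symm.trans
    ((Equiv.sigmaCongrRight fun j => Fintype.equivFinOfCardEq (hc j)).trans (blk l))
  have hw₀ : act w₀ t.1 = tTriv l := by
    funext a
    obtain ⟨b, rfl⟩ := w₀.surjective a
    have h1 : tTriv l (w₀ b) = t.1 b := by simp [tTriv, w₀, Equiv.sigmaFiberEquiv]
    simp [act, h1]
  classical
  obtain ⟨w, hw, hmin⟩ : ∃ w ∈ {w | act w t.1 = tTriv l},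
      ∀ v ∈ {w | act w t.1 = tTriv l}, len w ≤ len v :=
    Set.exists_min_image _ len (Set.toFinite _) ⟨w₀, hw₀⟩
  refine ⟨w, hw, fun u hu => hmin _ ?_⟩
  funext a
  have h2 := congrFun hw (u⁻¹ a)
  have h3 := (young l).inv_mem hu a
  simp only [act] at h2 ⊢
  rw [mul_inv_rev, Equiv.Perm.mul_apply, h2, h3]

/-- The minimal length representative `π_t` of the coset of `S_l` labelled by `t`. -/
noncomputable def minRep (t : Shape l) : Equiv.Perm (Fin n) := (exists_minCosetRep l t).choose

end Young

/-! ### The subquiver algebras -/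

section Parts

variable {K : Type*} [Fintype K] {A : Type*} [CommRing A] {d n : ℕ}
  (Q : K → K → MvPolynomial (Fin 2) A) (p : K → Fin d)

/-- The restriction `Q^j` of `Q` to the part `K_j = {k | p k = j}`. -/
def restrict (j : Fin d) : {k // p k = j} → {k // p k = j} → MvPolynomial (Fin 2) A :=
  fun k k' => Q k k'

/-- The algebra `H_l(Q) = H_{l_1}(Q^1) ⊗ ⋯ ⊗ H_{l_d}(Q^d)`. -/
abbrev HeckeTensor (l : Comp d n) : Type _ := ⨂[A] j : Fin d, Hecke (restrict Q p j) (l.1 j)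

/-- The element `e(t)`: the sum of the `e(k)` over the labellings `k ∈ K^n` of `t`, that is
`k_a ∈ K_{t_a}` for all `a`. -/
noncomputable def eLabel (t : Fin n → Fin d) : Hecke Q n :=
  ∑ k ∈ Finset.univ.filter (fun k : Fin n → K => ∀ a, p (k a) = t a), e Q k

/-- The concatenation of tuples `k^j ∈ K_j^{l_j}` into an element of `K^n`. -/
def concat (l : Comp d n) (k : ∀ j, Fin (l.1 j) → {x // p x = j}) : Fin n → K :=
  fun a => k ((blk l).symm a).1 ((blk l).symm a).2

/-- `i : H_l(Q) → H_n(Q)` is the embedding identifying `H_l(Q)` with `e(t^l) H_n(Q) e(t^l)`,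
with unit `e(t^l)`, which sends each generator of `H_l(Q)` to the generator of `H_n(Q)` with the
corresponding index, cut by `e(t^l)`. -/
structure IsBlockEmbedding (l : Comp d n) (i : HeckeTensor Q p l →ₙₐ[A] Hecke Q n) : Prop where
  injective : Function.Injective i
  range_eq : Set.range i = {x | ∃ h, x = eLabel Q p (tTriv l) * h * eLabel Q p (tTriv l)}
  map_one : i 1 = eLabel Q p (tTriv l)
  map_e : ∀ k : ∀ j, Fin (l.1 j) → {x // p x = j},
    i (PiTensorProduct.tprod A fun j => e (restrict Q p j) (k j)) = e Q (concat p l k)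
  map_y : ∀ (j : Fin d) (b : Fin (l.1 j)),
    i (PiTensorProduct.singleAlgHom j (y (restrict Q p j) b)) =
      y Q (blk l ⟨j, b⟩) * eLabel Q p (tTriv l)
  map_psi : ∀ (j : Fin d) (b : Fin (l.1 j - 1)),
    i (PiTensorProduct.singleAlgHom j (psi (restrict Q p j) b)) =
      psi Q (blkSimple l j b) * eLabel Q p (tTriv l)

end Parts

end QuiverHecke

set_option linter.unusedSectionVars false

namespace QuiverHecke

open scoped Nat TensorProduct

/-! ### Words and minimal coset representatives -/

section Combinatorics

variable {n : ℕ}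

/-! Fix a shape λ. The algebra H_n(Q) acts on matrices over H_λ(Q) with rows and columns indexed by
J^λ. The generators e(k) and y_a act diagonally, with indices transported by π_t in column t. The
generator ψ_a sends column t to row s_a·t. Its coefficient is 1 if the labels of t at a and a+1
differ; otherwise it is the block generator ψ_c with c = π_t(a), because π_t then sends a, a+1 to
consecutive places of one block. The relations hold (`isKLR_matrix`) because Q = 1 across different
parts: there ψ_a² = 1, and neither a Kronecker delta nor a divided difference survives. Where labels
agree, the relation is one of H_λ(Q). This defines the component `toMatrix` of Ψ.

Conversely, put g_t = ψ_{π_t⁻¹} e(t^λ) (`intertwiner`). It does not depend on the sorting word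
(`SortPath.psiWord_eq`), since every braid move needed takes place at differing outer labels, where
the braid relation has no correction term. Moving generators past g_t gives h g_t = ∑ g_{t'}
ι_λ(Ψ(h)_{t',t}) (`mul_intertwiner`). Since g_t has a right factor x with g_t x = e(t)
(`exists_intertwiner_inverse`), Ψ(h) = 0 forces h e(t) = 0 for all t, hence h = 0. Surjectivity
holds because ψ_{π_{t'}⁻¹} ι_λ(x) ψ_{π_t} maps to x E_{t',t} (`toMatrices_word`).

The map ι_λ comes from universal properties: the generators cut by e(t^λ) satisfy the relations of
H_λ(Q) inside the corner. It is injective because Ψ(ι_λ(x)) is x at the place (t^λ, t^λ)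
(`toMatrix_blockHom`), and its image is the whole corner because Ψ is injective. No basis theorem
for H_n(Q) enters. -/

theorem lo_ne_hi (a : Fin (n - 1)) : lo a ≠ hi a := by
  simp [lo, hi, Fin.ext_iff]

theorem lo_lt_hi (a : Fin (n - 1)) : lo a < hi a := by
  simp [lo, hi, Fin.lt_def]

theorem s_lo (a : Fin (n - 1)) : s a (lo a) = hi a := Equiv.swap_apply_left _ _

theorem s_hi (a : Fin (n - 1)) : s a (hi a) = lo a := Equiv.swap_apply_right _ _

theorem s_of_ne (a : Fin (n - 1)) {c : Fin n} (h : c ≠ lo a) (h' : c ≠ hi a) : s a c = c :=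
  Equiv.swap_apply_of_ne_of_ne h h'

@[simp] theorem s_inv (a : Fin (n - 1)) : (s a)⁻¹ = s a := Equiv.swap_inv _ _

@[simp] theorem s_mul_s (a : Fin (n - 1)) : s a * s a = 1 := Equiv.swap_mul_self _ _

@[simp] theorem s_s (a : Fin (n - 1)) (c : Fin n) : s a (s a c) = c := by
  rw [← Equiv.Perm.mul_apply, s_mul_s, Equiv.Perm.one_apply]

theorem act_mul {X : Type*} (u v : Equiv.Perm (Fin n)) (x : Fin n → X) :
    act (u * v) x = act u (act v x) := by
  funext a; simp [act, mul_inv_rev]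

@[simp] theorem act_one {X : Type*} (x : Fin n → X) : act 1 x = x := rfl

theorem act_s_apply {X : Type*} (a : Fin (n - 1)) (x : Fin n → X) (c : Fin n) :
    act (s a) x c = x (s a c) := by simp [act]

@[simp] theorem act_s_act_s {X : Type*} (a : Fin (n - 1)) (x : Fin n → X) :
    act (s a) (act (s a) x) = x := by rw [← act_mul, s_mul_s, act_one]

theorem act_s_lo {X : Type*} (a : Fin (n - 1)) (x : Fin n → X) :
    act (s a) x (lo a) = x (hi a) := by rw [act_s_apply, s_lo]

theorem act_s_hi {X : Type*} (a : Fin (n - 1)) (x : Fin n → X) :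
    act (s a) x (hi a) = x (lo a) := by rw [act_s_apply, s_hi]

theorem act_s_of_ne {X : Type*} (a : Fin (n - 1)) (x : Fin n → X) {c : Fin n} (h : c ≠ lo a)
    (h' : c ≠ hi a) : act (s a) x c = x c := by rw [act_s_apply, s_of_ne a h h']

theorem act_s_eq_self {X : Type*} {a : Fin (n - 1)} {x : Fin n → X} (h : x (lo a) = x (hi a)) :
    act (s a) x = x := by
  funext c
  by_cases h1 : c = lo a
  · rw [h1, act_s_lo, h]
  by_cases h2 : c = hi a
  · rw [h2, act_s_hi, h]
  exact act_s_of_ne a x h1 h2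

theorem act_injective {X : Type*} (w : Equiv.Perm (Fin n)) :
    Function.Injective (act w : (Fin n → X) → _) := by
  intro x y h
  funext a
  simpa [act] using congrFun h (w a)

theorem wordProd_cons (a : Fin (n - 1)) (u : List (Fin (n - 1))) :
    wordProd (a :: u) = s a * wordProd u := by simp [wordProd]

theorem wordProd_concat (u : List (Fin (n - 1))) (a : Fin (n - 1)) :
    wordProd (u ++ [a]) = wordProd u * s a := by simp [wordProd]

theorem wordProd_reverse (u : List (Fin (n - 1))) : wordProd u.reverse = (wordProd u)⁻¹ := by
  induction u with
  | nil => simp [wordProd]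
  | cons a u ih => rw [List.reverse_cons, wordProd_concat, wordProd_cons, ih]; simp

theorem len_le {u : List (Fin (n - 1))} {w : Equiv.Perm (Fin n)} (h : wordProd u = w) :
    len w ≤ u.length := Nat.sInf_le ⟨u, rfl, h⟩

theorem exists_isReducedExpr (w : Equiv.Perm (Fin n)) : ∃ u, IsReducedExpr u w := by
  have h : {r | ∃ ws : List (Fin (n - 1)), ws.length = r ∧ wordProd ws = w}.Nonempty := by
    obtain ⟨u, hu⟩ := exists_word w
    exact ⟨_, u, rfl, hu⟩
  obtain ⟨u, h1, h2⟩ := Nat.sInf_mem h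
  exact ⟨u, h2, h1⟩

theorem IsReducedExpr.reverse {u : List (Fin (n - 1))} {w : Equiv.Perm (Fin n)}
    (h : IsReducedExpr u w) : IsReducedExpr u.reverse w⁻¹ := by
  have h1 : wordProd u.reverse = w⁻¹ := by rw [wordProd_reverse, h.1]
  refine ⟨h1, le_antisymm ?_ (len_le h1)⟩
  obtain ⟨v, hv1, hv2⟩ := exists_isReducedExpr w⁻¹
  rw [List.length_reverse, h.2, ← hv2, ← List.length_reverse]
  exact len_le (by rw [wordProd_reverse, hv1, inv_inv])

theorem IsReducedExpr.of_concat {u : List (Fin (n - 1))} {a : Fin (n - 1)}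
    {w : Equiv.Perm (Fin n)} (h : IsReducedExpr (u ++ [a]) w) :
    IsReducedExpr u (w * s a) := by
  have h1 : wordProd u = w * s a := by
    rw [← h.1, wordProd_concat, mul_assoc, s_mul_s, mul_one]
  refine ⟨h1, le_antisymm ?_ (len_le h1)⟩
  obtain ⟨v, hv1, hv2⟩ := exists_isReducedExpr (w * s a)
  have h2 : len w ≤ (v ++ [a]).length :=
    len_le (by rw [wordProd_concat, hv1, mul_assoc, s_mul_s, mul_one])
  have h3 := h.2
  simp only [List.length_append, List.length_singleton] at h2 h3
  omega

/-- The deletion property: a word whose product inverts `a < b` can be shortened to a word for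
the product composed with the transposition of `a` and `b`. -/
theorem exists_shorter_word (u : List (Fin (n - 1))) {a b : Fin n} (hab : a < b)
    (h : wordProd u b < wordProd u a) :
    ∃ v : List (Fin (n - 1)), v.length < u.length ∧ wordProd v = wordProd u * Equiv.swap a b := by
  induction u with
  | nil => exact absurd h (by simpa [wordProd] using hab.le)
  | cons c u ih =>
    rw [wordProd_cons] at h
    by_cases h1 : wordProd u b < wordProd u a
    · obtain ⟨v, hv1, hv2⟩ := ih h1
      exact ⟨c :: v, by simpa using hv1, by rw [wordProd_cons, wordProd_cons, hv2, mul_assoc]⟩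
    · have h2 : wordProd u a < wordProd u b :=
        lt_of_le_of_ne (not_lt.1 h1) (fun h => hab.ne ((wordProd u).injective h))
      -- The transposition `s c` reverses the order of a single pair of values, so an inversion it
      -- creates must come from that pair.
      have h3 : wordProd u a = lo c ∧ wordProd u b = hi c := by
        simp only [Equiv.Perm.mul_apply] at h
        generalize wordProd u a = x at *
        generalize wordProd u b = z at *
        unfold s at h
        simp only [Equiv.swap_apply_def, lo, hi, Fin.ext_iff, Fin.lt_def] at *
        split_ifs at h <;> simp at h <;> omega
      refine ⟨u, by simp, ?_⟩
      -- Moved to the left of `wordProd u`, the transposition of `a`, `b` becomes `s c` and cancels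
      -- the first letter.
      rw [wordProd_cons, mul_assoc, Equiv.mul_swap_eq_swap_mul, h3.1, h3.2, ← mul_assoc]
      change _ = s c * s c * _
      simp

end Combinatorics

/-! ### Tuples of a given shape and the permutations sorting them -/

section Shapes

variable {d n : ℕ} (l : Comp d n)

theorem tTriv_blk (j : Fin d) (b : Fin (l.1 j)) : tTriv l (blk l ⟨j, b⟩) = j := by
  simp [tTriv]

theorem monotone_tTriv : Monotone (tTriv l) := by
  intro a b hab
  obtain ⟨⟨j, x⟩, rfl⟩ := (blk l).surjective a
  obtain ⟨⟨j', x'⟩, rfl⟩ := (blk l).surjective b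
  rw [tTriv_blk, tTriv_blk]
  by_contra! h
  have h1 : ((blk l ⟨j', x'⟩ : Fin n) : ℕ) < blk l ⟨j, x⟩ := by
    simp only [blk, Equiv.trans_apply, finCongr_apply, Fin.val_cast, finSigmaFinEquiv_apply]
    -- Block `j'` ends no later than block `j` begins, because its end is a partial sum of the start
    -- of block `j`.
    have h2 : ∑ i : Fin (j' : ℕ), l.1 (Fin.castLE j'.2.le i) + l.1 j' ≤
        ∑ i : Fin (j : ℕ), l.1 (Fin.castLE j.2.le i) := by
      have h3 := Fin.sum_univ_castSucc fun i : Fin (j' + 1) =>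
        l.1 (Fin.castLE (Nat.succ_le_of_lt j'.2) i)
      have h4 : ∑ i : Fin (j' + 1), l.1 (Fin.castLE (Nat.succ_le_of_lt j'.2) i) =
          ∑ i ∈ Finset.univ.map (Fin.castLEEmb (Nat.succ_le_of_lt h)),
            l.1 (Fin.castLE j.2.le i) := by
        rw [Finset.sum_map]; rfl
      have h5 := Finset.sum_le_sum_of_subset (f := fun i : Fin (j : ℕ) => l.1 (Fin.castLE j.2.le i))
        (Finset.subset_univ (Finset.univ.map (Fin.castLEEmb (Nat.succ_le_of_lt h))))
      rw [← h4, h3] at h5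
      exact h5
    have := x'.2
    omega
  exact absurd hab (not_le.2 h1)

theorem card_fiber_act {X : Type*} [DecidableEq X] (w : Equiv.Perm (Fin n)) (t : Fin n → X)
    (j : X) : (Finset.univ.filter fun a => act w t a = j).card =
      (Finset.univ.filter fun a => t a = j).card := by
  refine Finset.card_bij (fun a _ => w⁻¹ a) ?_ (fun a _ b _ h => w⁻¹.injective h) ?_
  · intro a ha
    exact Finset.mem_filter.2 ⟨Finset.mem_univ _, (Finset.mem_filter.1 ha).2⟩
  · intro b hb
    refine ⟨w b, Finset.mem_filter.2 ⟨Finset.mem_univ _, ?_⟩, by simp⟩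
    simpa [act] using (Finset.mem_filter.1 hb).2

/-- The action of the symmetric group on the tuples of a given shape. -/
def shapeAct {l : Comp d n} (w : Equiv.Perm (Fin n)) (t : Shape l) : Shape l :=
  ⟨act w t.1, fun j => (card_fiber_act w t.1 j).trans (t.2 j)⟩

/-- The tuple `t^l` as a tuple of shape `l`. -/
def shapeTriv : Shape l := ⟨tTriv l, fun j => by
  rw [← Fintype.card_subtype, ← Fintype.card_fin (l.1 j)]
  refine Fintype.card_congr ⟨fun a => Fin.cast (congrArg l.1 a.2) ((blk l).symm a.1).2,
    fun b => ⟨blk l ⟨j, b⟩, tTriv_blk l j b⟩, ?_, ?_⟩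
  · rintro ⟨a, rfl⟩
    simp [tTriv]
  · intro b
    have h : ∀ x : Σ j, Fin (l.1 j), x = ⟨j, b⟩ → ∀ h, Fin.cast h x.2 = b := by
      rintro _ rfl _; rfl
    exact h _ ((blk l).symm_apply_apply _) _⟩

variable {l}

theorem IsMinCosetRep.tTriv_apply {t : Shape l} {w : Equiv.Perm (Fin n)}
    (h : act w t.1 = tTriv l) (a : Fin n) : tTriv l (w a) = t.1 a := by
  rw [← h]; simp [act]

theorem mul_inv_mem_young {t : Fin n → Fin d} {v w : Equiv.Perm (Fin n)}
    (hv : act v t = tTriv l) (hw : act w t = tTriv l) : v * w⁻¹ ∈ young l := by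
  intro a
  have h1 := congrFun hw a
  have h2 := congrFun hv (v (w⁻¹ a))
  simp only [act] at h1 h2
  rw [Equiv.Perm.mul_apply, ← h2, ← h1]
  simp

theorem IsMinCosetRep.len_le {t : Shape l} {w v : Equiv.Perm (Fin n)} (h : IsMinCosetRep l t w)
    (hv : act v t.1 = tTriv l) : len w ≤ len v := by
  simpa using h.2 _ (mul_inv_mem_young hv h.1)

theorem act_swap_eq_self {X : Type*} {t : Fin n → X} {a b : Fin n} (h : t a = t b) :
    act (Equiv.swap a b) t = t := by
  funext c
  simp only [act, Equiv.swap_inv, Equiv.swap_apply_def]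
  split_ifs <;> simp_all

/-- An inversion between equal labels could be removed by composing with the transposition of `a`
and `b`. This stays in the coset, and by the deletion property it lowers the length. -/
theorem IsMinCosetRep.lt_of_lt {t : Shape l} {w : Equiv.Perm (Fin n)} (h : IsMinCosetRep l t w)
    {a b : Fin n} (hab : a < b) (ht : t.1 a = t.1 b) : w a < w b := by
  by_contra h1
  have h2 : w b < w a := lt_of_le_of_ne (not_lt.1 h1) fun h => hab.ne' (w.injective h)
  obtain ⟨u, hu1, hu2⟩ := exists_isReducedExpr w
  obtain ⟨v, hv1, hv2⟩ := exists_shorter_word u hab (by rwa [hu1])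
  have h3 : len w ≤ len (w * Equiv.swap a b) :=
    h.len_le (by rw [act_mul, act_swap_eq_self ht, h.1])
  have h4 := QuiverHecke.len_le hv2
  rw [hu1] at h4
  omega

/-- A permutation sorting `t` and increasing on the fibres of `t` is unique. -/
theorem sorting_unique {t : Fin n → Fin d} {v w : Equiv.Perm (Fin n)}
    (hv : act v t = tTriv l) (hw : act w t = tTriv l)
    (hv' : ∀ a b, a < b → t a = t b → v a < v b) (hw' : ∀ a b, a < b → t a = t b → w a < w b) :
    v = w := by
  have hy := mul_inv_mem_young hv hw
  -- Across blocks, order is kept because `v * w⁻¹` preserves every block; inside a block, because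
  -- `w⁻¹` and then `v` are increasing. A strictly increasing permutation of `Fin n` is the
  -- identity.
  have hmono : StrictMono (v * w⁻¹ : Equiv.Perm (Fin n)) := by
    intro a b hab
    rcases (monotone_tTriv l hab.le).lt_or_eq with h | h
    · by_contra h1
      have := monotone_tTriv l (not_lt.1 h1)
      rw [hy a, hy b] at this
      exact absurd h (not_lt.2 this)
    · have h1 := congrFun hw a
      have h2 := congrFun hw b
      simp only [act] at h1 h2
      refine hv' _ _ ?_ (by rw [h1, h2, h])
      by_contra h3
      rcases (not_lt.1 h3).lt_or_eq with h4 | h4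
      · have := hw' _ _ h4 (by rw [h1, h2, h])
        simp at this
        exact absurd this (not_lt.2 hab.le)
      · exact hab.ne' (w⁻¹.injective h4)
  have h1 : (v * w⁻¹ : Equiv.Perm (Fin n)) = 1 := by
    ext a
    have h := (hmono.range_inj strictMono_id).1 (by simp [(Equiv.surjective _).range_eq])
    rw [h]; rfl
  exact mul_inv_eq_one.1 h1

variable (t : Shape l)

theorem isMinCosetRep_minRep : IsMinCosetRep l t (minRep l t) := (exists_minCosetRep l t).choose_spec

theorem act_minRep : act (minRep l t) t.1 = tTriv l := (isMinCosetRep_minRep t).1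

theorem tTriv_minRep (a : Fin n) : tTriv l (minRep l t a) = t.1 a :=
  IsMinCosetRep.tTriv_apply (act_minRep t) a

theorem minRep_lt {a b : Fin n} (hab : a < b) (h : t.1 a = t.1 b) : minRep l t a < minRep l t b :=
  (isMinCosetRep_minRep t).lt_of_lt hab h

/-- This length-free characterisation is how `minRep` is computed below. -/
theorem eq_minRep {w : Equiv.Perm (Fin n)} (hw : act w t.1 = tTriv l)
    (hw' : ∀ a b, a < b → t.1 a = t.1 b → w a < w b) : w = minRep l t :=
  sorting_unique hw (act_minRep t) hw' fun _ _ => minRep_lt t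

theorem existsUnique_minCosetRep : ∃! w, IsMinCosetRep l t w :=
  ⟨minRep l t, isMinCosetRep_minRep t, fun _ hw => eq_minRep t hw.1 fun _ _ => hw.lt_of_lt⟩

theorem minRep_shapeTriv : minRep l (shapeTriv l) = 1 :=
  (eq_minRep _ (act_one _) fun _ _ h _ => h).symm

/-- A position sent strictly between the two images would carry the same label, as t^λ is monotone,
and would therefore lie strictly between `a` and `a + 1`. -/
theorem minRep_hi {a : Fin (n - 1)} (h : t.1 (lo a) = t.1 (hi a)) :
    (minRep l t (hi a) : ℕ) = minRep l t (lo a) + 1 := by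
  have h1 : minRep l t (lo a) < minRep l t (hi a) := minRep_lt t (lo_lt_hi a) h
  by_contra h2
  have h3 : (minRep l t (lo a) : ℕ) + 1 < minRep l t (hi a) := by
    have := Fin.lt_def.1 h1; omega
  obtain ⟨b, hb⟩ := (minRep l t).surjective ⟨minRep l t (lo a) + 1, h3.trans (Fin.is_lt _)⟩
  have h4 : minRep l t (lo a) < minRep l t b := by rw [hb]; simp [Fin.lt_def]
  have h5 : minRep l t b < minRep l t (hi a) := by rw [hb]; simpa [Fin.lt_def] using h3
  have h6 : t.1 b = t.1 (lo a) := by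
    have h7 := monotone_tTriv l h4.le
    have h8 := monotone_tTriv l h5.le
    simp only [tTriv_minRep] at h7 h8
    exact le_antisymm (h8.trans h.ge) h7
  have h7 : lo a < b := by
    by_contra h8
    rcases (not_lt.1 h8).lt_or_eq with h9 | h9
    · exact absurd (minRep_lt t h9 h6) (not_lt.2 h4.le)
    · exact h4.ne' (by rw [h9])
  have h8 : b < hi a := by
    by_contra h8
    rcases (not_lt.1 h8).lt_or_eq with h9 | h9
    · exact absurd (minRep_lt t h9 (h.symm.trans h6.symm)) (not_lt.2 h5.le)
    · exact h5.ne (by rw [h9])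
  simp only [lo, hi, Fin.lt_def] at h7 h8
  omega

/-- Only the pair `a`, `a + 1` has its order changed by `s a`, and its labels differ; so the
right-hand side is still increasing on the fibres. -/
theorem minRep_shapeAct {a : Fin (n - 1)} (h : t.1 (lo a) ≠ t.1 (hi a)) :
    minRep l (shapeAct (s a) t) = minRep l t * s a := by
  refine (eq_minRep _ ?_ ?_).symm
  · rw [act_mul, shapeAct, act_s_act_s, act_minRep]
  · intro b c hbc hbc'
    simp only [shapeAct, act_s_apply] at hbc'
    refine minRep_lt t ?_ hbc'
    have hne : s a b ≠ s a c := fun h => hbc.ne ((s a).injective h)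
    have hbc1 : ¬(b = lo a ∧ c = hi a) := by
      rintro ⟨rfl, rfl⟩
      rw [s_lo, s_hi] at hbc'
      exact h hbc'.symm
    simp only [s, Equiv.swap_apply_def, Fin.ext_iff, Fin.lt_def, lo, hi] at hne hbc hbc1 ⊢
    split_ifs at hne ⊢ <;> simp_all <;> omega

theorem shapeAct_s_eq_self {a : Fin (n - 1)} (h : t.1 (lo a) = t.1 (hi a)) :
    shapeAct (s a) t = t := Subtype.ext (act_s_eq_self h)

@[simp] theorem shapeAct_s_s (a : Fin (n - 1)) : shapeAct (s a) (shapeAct (s a) t) = t :=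
  Subtype.ext (act_s_act_s a t.1)

/-- If the labels agreed, dropping the last letter would give a shorter permutation that still sorts
`t`. -/
theorem ne_of_isReducedExpr_concat {u : List (Fin (n - 1))} {a : Fin (n - 1)}
    (h : IsReducedExpr (u ++ [a]) (minRep l t)) : t.1 (lo a) ≠ t.1 (hi a) := by
  intro h1
  have h2 := (isMinCosetRep_minRep t).len_le (v := minRep l t * s a)
    (by rw [act_mul, act_s_eq_self h1, act_minRep])
  have h3 := h.of_concat.2
  have h4 := h.2
  simp only [List.length_append, List.length_singleton] at h4
  omega

/-- Orbit-stabiliser count: each permutation factors uniquely as `g * minRep l t` with `g` fixing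
t^λ, and the stabiliser has order ∏ λ_j!. -/
theorem card_shape : Fintype.card (Shape l) = mult l := by
  have h1 : Fintype.card (Equiv.Perm (Fin n)) = Fintype.card (Shape l) * ∏ j, (l.1 j)! := by
    have h2 := DomMulAct.stabilizer_card (tTriv l)
    have h3 : ∀ j, Fintype.card {a // tTriv l a = j} = l.1 j := fun j => by
      rw [Fintype.card_subtype]; exact (shapeTriv l).2 j
    simp only [h3] at h2
    rw [← h2, ← Fintype.card_prod]
    have h4 : ∀ (t : Shape l) (g : {g : Equiv.Perm (Fin n) // tTriv l ∘ g = tTriv l}),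
        shapeAct (g.1 * minRep l t)⁻¹ (shapeTriv l) = t := fun t g => by
      refine Subtype.ext (act_injective (g.1 * minRep l t) ?_)
      change act _ (act _ (tTriv l)) = act _ t.1
      rw [← act_mul, mul_inv_cancel, act_one, act_mul, act_minRep]
      funext a
      simpa [act] using congrFun g.2 (g.1⁻¹ a)
    refine Fintype.card_congr
      ⟨fun w => (shapeAct w⁻¹ (shapeTriv l),
          ⟨w * (minRep l (shapeAct w⁻¹ (shapeTriv l)))⁻¹, ?_⟩),
        fun x => x.2.1 * minRep l x.1, fun w => by simp, fun x => ?_⟩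
    · refine funext (mul_inv_mem_young (t := act w⁻¹ (tTriv l)) ?_ (act_minRep _))
      rw [← act_mul, mul_inv_cancel, act_one]
    · obtain ⟨t, g⟩ := x
      refine Prod.ext (h4 t g) (Subtype.ext ?_)
      change g.1 * minRep l t * (minRep l (shapeAct (g.1 * minRep l t)⁻¹ (shapeTriv l)))⁻¹ = g.1
      rw [h4, mul_inv_cancel_right]
  rw [Fintype.card_perm, Fintype.card_fin] at h1
  rw [mult, h1, Nat.mul_div_cancel _ (Finset.prod_pos fun j _ => Nat.factorial_pos _)]

end Shapes

/-! ### Families satisfying the defining relations -/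

section Families

variable {K : Type*} {A : Type*} [CommRing A] {R S : Type*} [Ring R] [Algebra A R]
  [Ring S] [Algebra A S]

theorem map_evalAt (f : R →ₐ[A] S) (P : MvPolynomial (Fin 2) A) (x z : R) :
    f (evalAt P x z) = evalAt P (f x) (f z) := by
  simp [evalAt, map_sum, map_smul]

theorem map_divDiff (f : R →ₐ[A] S) (P : MvPolynomial (Fin 2) A) (x z w : R) :
    f (divDiff P x z w) = divDiff P (f x) (f z) (f w) := by
  simp [divDiff, map_sum, map_smul]

theorem evalAt_one (x z : R) : evalAt (1 : MvPolynomial (Fin 2) A) x z = 1 := by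
  classical
  -- Over the zero ring the polynomial `1` has empty support, so this case is separated.
  rcases subsingleton_or_nontrivial A with h | h
  · have := Module.subsingleton A R
    exact Subsingleton.elim _ _
  · rw [evalAt, ← MvPolynomial.C_1, MvPolynomial.support_C, if_neg one_ne_zero]
    simp

theorem divDiff_one (x z w : R) : divDiff (1 : MvPolynomial (Fin 2) A) x z w = 0 := by
  classical
  rcases subsingleton_or_nontrivial A with h | h
  · have := Module.subsingleton A R
    exact Subsingleton.elim _ _
  · rw [divDiff, ← MvPolynomial.C_1, MvPolynomial.support_C, if_neg one_ne_zero]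
    simp

open scoped Classical in
/-- The families `E`, `Y`, `P` of an algebra satisfy those defining relations of `H_n(Q)` which
involve only the `ψ_a` with `G a`. -/
structure IsKLR [Fintype K] (Q : K → K → MvPolynomial (Fin 2) A) {n : ℕ} (G : Fin (n - 1) → Prop)
    (E : (Fin n → K) → R) (Y : Fin n → R) (P : Fin (n - 1) → R) : Prop where
  sum_e : ∑ k, E k = 1
  e_mul_self (k : Fin n → K) : E k * E k = E k
  e_mul_ne (k k' : Fin n → K) (h : k ≠ k') : E k * E k' = 0
  y_e (a : Fin n) (k : Fin n → K) : Y a * E k = E k * Y a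
  psi_e (a : Fin (n - 1)) (ha : G a) (k : Fin n → K) : P a * E k = E (act (s a) k) * P a
  y_y (a b : Fin n) : Y a * Y b = Y b * Y a
  psi_y (a : Fin (n - 1)) (ha : G a) (b : Fin n) (h : b ≠ lo a) (h' : b ≠ hi a) :
    P a * Y b = Y b * P a
  psi_psi (a b : Fin (n - 1)) (ha : G a) (hb : G b) (h : a.val + 1 < b.val ∨ b.val + 1 < a.val) :
    P a * P b = P b * P a
  psi_y_hi (a : Fin (n - 1)) (ha : G a) (k : Fin n → K) :
    P a * Y (hi a) * E k = (Y (lo a) * P a + if k (lo a) = k (hi a) then 1 else 0) * E k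
  y_hi_psi (a : Fin (n - 1)) (ha : G a) (k : Fin n → K) :
    Y (hi a) * P a * E k = (P a * Y (lo a) + if k (lo a) = k (hi a) then 1 else 0) * E k
  psi_sq (a : Fin (n - 1)) (ha : G a) (k : Fin n → K) :
    P a * P a * E k = evalAt (Q (k (lo a)) (k (hi a))) (Y (lo a)) (Y (hi a)) * E k
  braid (a b : Fin (n - 1)) (ha : G a) (hb : G b) (hab : b.val = a.val + 1) (k : Fin n → K) :
    P b * P a * P b * E k = (P a * P b * P a + if k (lo a) = k (hi b) then
      divDiff (Q (k (lo a)) (k (hi a))) (Y (lo a)) (Y (hi a)) (Y (hi b)) else 0) * E k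

namespace IsKLR

variable [Fintype K] {Q : K → K → MvPolynomial (Fin 2) A} {n : ℕ} {G : Fin (n - 1) → Prop}
  {E : (Fin n → K) → R} {Y : Fin n → R} {P : Fin (n - 1) → R}

theorem mono (h : IsKLR Q G E Y P) {G' : Fin (n - 1) → Prop} (hG : ∀ a, G' a → G a) :
    IsKLR Q G' E Y P where
  sum_e := h.sum_e
  e_mul_self := h.e_mul_self
  e_mul_ne := h.e_mul_ne
  y_e := h.y_e
  psi_e a ha := h.psi_e a (hG a ha)
  y_y := h.y_y
  psi_y a ha := h.psi_y a (hG a ha)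
  psi_psi a b ha hb := h.psi_psi a b (hG a ha) (hG b hb)
  psi_y_hi a ha := h.psi_y_hi a (hG a ha)
  y_hi_psi a ha := h.y_hi_psi a (hG a ha)
  psi_sq a ha := h.psi_sq a (hG a ha)
  braid a b ha hb := h.braid a b (hG a ha) (hG b hb)

theorem map (h : IsKLR Q G E Y P) (f : R →ₐ[A] S) :
    IsKLR Q G (fun k => f (E k)) (fun a => f (Y a)) (fun a => f (P a)) where
  sum_e := by rw [← map_sum, h.sum_e, map_one]
  e_mul_self k := by rw [← map_mul, h.e_mul_self]
  e_mul_ne k k' hk := by rw [← map_mul, h.e_mul_ne k k' hk, map_zero]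
  y_e a k := by rw [← map_mul, h.y_e, map_mul]
  psi_e a ha k := by rw [← map_mul, h.psi_e a ha, map_mul]
  y_y a b := by rw [← map_mul, h.y_y, map_mul]
  psi_y a ha b hb hb' := by rw [← map_mul, h.psi_y a ha b hb hb', map_mul]
  psi_psi a b ha hb hab := by rw [← map_mul, h.psi_psi a b ha hb hab, map_mul]
  psi_y_hi a ha k := by
    rw [← map_mul, ← map_mul, h.psi_y_hi a ha k, map_mul, map_add, map_mul, apply_ite f, map_one,
      map_zero]
  y_hi_psi a ha k := by
    rw [← map_mul, ← map_mul, h.y_hi_psi a ha k, map_mul, map_add, map_mul, apply_ite f, map_one,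
      map_zero]
  psi_sq a ha k := by
    rw [← map_mul, ← map_mul, h.psi_sq a ha k, map_mul, map_evalAt]
  braid a b ha hb hab k := by
    rw [← map_mul, ← map_mul, ← map_mul, h.braid a b ha hb hab k, map_mul, map_add, map_mul,
      map_mul, apply_ite f, map_zero, map_divDiff]

/-- Used to restrict the relations of H_n(Q) to a subalgebra. The values of `P` need to match only
on `G`, so elsewhere they may be placeholders. -/
theorem of_injective {f : R →ₐ[A] S} (hf : Function.Injective f)
    {E' : (Fin n → K) → S} {Y' : Fin n → S} {P' : Fin (n - 1) → S} (h : IsKLR Q G E' Y' P')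
    (hE : ∀ k, f (E k) = E' k) (hY : ∀ a, f (Y a) = Y' a) (hP : ∀ a, G a → f (P a) = P' a) :
    IsKLR Q G E Y P where
  sum_e := hf (by simp only [map_sum, hE, h.sum_e, map_one])
  e_mul_self k := hf (by simp only [map_mul, hE, h.e_mul_self])
  e_mul_ne k k' hk := hf (by simp only [map_mul, hE, h.e_mul_ne k k' hk, map_zero])
  y_e a k := hf (by simp only [map_mul, hE, hY, h.y_e])
  psi_e a ha k := hf (by simp only [map_mul, hE, hP a ha, h.psi_e a ha])
  y_y a b := hf (by simp only [map_mul, hY, h.y_y a b])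
  psi_y a ha b hb hb' := hf (by simp only [map_mul, hY, hP a ha, h.psi_y a ha b hb hb'])
  psi_psi a b ha hb hab := hf (by
    simp only [map_mul, hP a ha, hP b hb, h.psi_psi a b ha hb hab])
  psi_y_hi a ha k := hf (by
    simp only [map_mul, map_add, hE, hY, hP a ha, h.psi_y_hi a ha k, apply_ite f, map_one,
      map_zero])
  y_hi_psi a ha k := hf (by
    simp only [map_mul, map_add, hE, hY, hP a ha, h.y_hi_psi a ha k, apply_ite f, map_one,
      map_zero])
  psi_sq a ha k := hf (by simp only [map_mul, hE, hY, hP a ha, h.psi_sq a ha k, map_evalAt])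
  braid a b ha hb hab k := hf (by
    simp only [map_mul, map_add, hE, hY, hP a ha, hP b hb, h.braid a b ha hb hab k, apply_ite f,
      map_zero, map_divDiff])

/-- The `E k` sum to 1, so an identity may be tested on one tuple at a time, where the defining
relations apply. -/
theorem ext_e (h : IsKLR Q G E Y P) {x z : R} (hxz : ∀ k, x * E k = z * E k) : x = z := by
  rw [← mul_one x, ← mul_one z, ← h.sum_e, Finset.mul_sum, Finset.mul_sum]
  exact Finset.sum_congr rfl fun k _ => hxz k

open scoped Classical in
theorem e_mul_e (h : IsKLR Q G E Y P) (k k' : Fin n → K) :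
    E k * E k' = if k = k' then E k' else 0 := by
  split_ifs with hk
  · rw [hk, h.e_mul_self]
  · exact h.e_mul_ne k k' hk

/-- A sum of idempotents `E k` times one of them. -/
theorem sum_filter_mul_e (h : IsKLR Q G E Y P) (p : (Fin n → K) → Prop) [DecidablePred p]
    (k' : Fin n → K) :
    (∑ k ∈ Finset.univ.filter p, E k) * E k' = if p k' then E k' else 0 := by
  classical
  rw [Finset.sum_mul, Finset.sum_filter]
  simp only [h.e_mul_e]
  rw [Finset.sum_eq_single k']
  · simp
  · intro b _ hb; simp [hb]
  · simp

end IsKLR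

/-! ### Presentation and universal property of H_n(Q) -/

section Universal

variable [Fintype K] {Q : K → K → MvPolynomial (Fin 2) A} {n : ℕ}

theorem mk_eq_of_rel {x z : FreeAlgebra A (Gen K n)} (h : Rel Q n x z) : mk Q n x = mk Q n z :=
  RingQuot.mkAlgHom_rel A h

variable (Q n) in
/-- The generators of `H_n(Q)` satisfy the defining relations. -/
theorem isKLR_hecke : IsKLR Q (fun _ : Fin (n - 1) => True) (e Q) (y Q) (psi Q) where
  sum_e := by simpa [e] using mk_eq_of_rel (Rel.sum_e (Q := Q) (n := n))
  e_mul_self k := by simpa [e] using mk_eq_of_rel (Rel.e_mul_self (Q := Q) k)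
  e_mul_ne k k' h := by simpa [e] using mk_eq_of_rel (Rel.e_mul_ne (Q := Q) k k' h)
  y_e a k := by simpa [e, y] using mk_eq_of_rel (Rel.y_e (Q := Q) a k)
  psi_e a _ k := by simpa [e, psi] using mk_eq_of_rel (Rel.psi_e (Q := Q) a k)
  y_y a b := by simpa [y] using mk_eq_of_rel (Rel.y_y (Q := Q) a b)
  psi_y a _ b h h' := by simpa [y, psi] using mk_eq_of_rel (Rel.psi_y (Q := Q) a b h h')
  psi_psi a b _ _ h := by simpa [psi] using mk_eq_of_rel (Rel.psi_psi (Q := Q) a b h)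
  psi_y_hi a _ k := by
    split_ifs with h
    · simpa [e, y, psi] using mk_eq_of_rel (Rel.psi_y_hi_eq (Q := Q) a k h)
    · simpa [e, y, psi] using mk_eq_of_rel (Rel.psi_y_hi_ne (Q := Q) a k h)
  y_hi_psi a _ k := by
    split_ifs with h
    · simpa [e, y, psi] using mk_eq_of_rel (Rel.y_hi_psi_eq (Q := Q) a k h)
    · simpa [e, y, psi] using mk_eq_of_rel (Rel.y_hi_psi_ne (Q := Q) a k h)
  psi_sq a _ k := by
    simpa [e, y, psi, map_evalAt] using mk_eq_of_rel (Rel.psi_sq (Q := Q) a k)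
  braid a b _ _ hab k := by
    split_ifs with h
    · simpa [e, y, psi, map_divDiff, add_mul] using
        mk_eq_of_rel (Rel.braid_eq (Q := Q) a b hab k h)
    · simpa [e, psi] using mk_eq_of_rel (Rel.braid_ne (Q := Q) a b hab k h)

/-- An induction principle: a property of elements of `H_n(Q)` may be checked on generators. -/
theorem hecke_induction {motive : Hecke Q n → Prop} (x : Hecke Q n)
    (algebraMap : ∀ r, motive (algebraMap A _ r)) (e : ∀ k, motive (e Q k))
    (y : ∀ a, motive (y Q a)) (psi : ∀ a, motive (psi Q a))
    (add : ∀ x z, motive x → motive z → motive (x + z))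
    (mul : ∀ x z, motive x → motive z → motive (x * z)) : motive x := by
  obtain ⟨x, rfl⟩ : ∃ x', mk Q n x' = x := RingQuot.mkAlgHom_surjective A _ x
  induction x using FreeAlgebra.induction with
  | grade0 r => rw [AlgHom.commutes]; exact algebraMap r
  | grade1 x =>
    cases x with
    | e k => exact e k
    | y a => exact y a
    | psi a => exact psi a
  | mul x z hx hz => rw [map_mul]; exact mul _ _ hx hz
  | add x z hx hz => rw [map_add]; exact add _ _ hx hz

theorem hecke_algHom_ext {f g : Hecke Q n →ₐ[A] R} (he : ∀ k, f (e Q k) = g (e Q k))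
    (hy : ∀ a, f (y Q a) = g (y Q a)) (hpsi : ∀ a, f (psi Q a) = g (psi Q a)) : f = g := by
  ext x
  induction x using hecke_induction with
  | algebraMap r => simp
  | e k => exact he k
  | y a => exact hy a
  | psi a => exact hpsi a
  | add x z hx hz => rw [map_add, map_add, hx, hz]
  | mul x z hx hz => rw [map_mul, map_mul, hx, hz]

variable {E : (Fin n → K) → R} {Y : Fin n → R} {P : Fin (n - 1) → R}

namespace IsKLR

/-- The universal property of `H_n(Q)`. -/
noncomputable def lift (h : IsKLR Q (fun _ => True) E Y P) : Hecke Q n →ₐ[A] R :=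
  RingQuot.liftAlgHom A ⟨FreeAlgebra.lift A fun x : Gen K n => Gen.casesOn x E Y P, by
    intro x z hxz
    cases hxz with
    | sum_e => simpa using h.sum_e
    | e_mul_self k => simpa using h.e_mul_self k
    | e_mul_ne k k' hk => simpa using h.e_mul_ne k k' hk
    | y_e a k => simpa using h.y_e a k
    | psi_e a k => simpa using h.psi_e a trivial k
    | y_y a b => simpa using h.y_y a b
    | psi_y a b h1 h2 => simpa using h.psi_y a trivial b h1 h2
    | psi_psi a b h1 => simpa using h.psi_psi a b trivial trivial h1
    | psi_y_hi_eq a k h1 => simpa [h1] using h.psi_y_hi a trivial k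
    | psi_y_hi_ne a k h1 => simpa [h1] using h.psi_y_hi a trivial k
    | y_hi_psi_eq a k h1 => simpa [h1] using h.y_hi_psi a trivial k
    | y_hi_psi_ne a k h1 => simpa [h1] using h.y_hi_psi a trivial k
    | psi_sq a k => simpa [map_evalAt] using h.psi_sq a trivial k
    | braid_eq a b hab k h1 =>
      simpa [h1, map_divDiff, add_mul] using h.braid a b trivial trivial hab k
    | braid_ne a b hab k h1 => simpa [h1] using h.braid a b trivial trivial hab k⟩

variable (h : IsKLR Q (fun _ => True) E Y P)

theorem lift_mk (x : FreeAlgebra A (Gen K n)) :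
    h.lift (QuiverHecke.mk Q n x) = FreeAlgebra.lift A (fun x : Gen K n => Gen.casesOn x E Y P) x :=
  RingQuot.liftAlgHom_mkAlgHom_apply A _ _ _

@[simp] theorem lift_e (k : Fin n → K) : h.lift (e Q k) = E k := by
  rw [e, lift_mk, FreeAlgebra.lift_ι_apply]

@[simp] theorem lift_y (a : Fin n) : h.lift (y Q a) = Y a := by
  rw [y, lift_mk, FreeAlgebra.lift_ι_apply]

@[simp] theorem lift_psi (a : Fin (n - 1)) : h.lift (psi Q a) = P a := by
  rw [psi, lift_mk, FreeAlgebra.lift_ι_apply]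

end IsKLR

/-- Two algebra morphisms with commuting values on generators have commuting values. -/
theorem hecke_commute {K' : Type*} [Fintype K'] {Q' : K' → K' → MvPolynomial (Fin 2) A} {m : ℕ}
    (f : Hecke Q n →ₐ[A] R) (g : Hecke Q' m →ₐ[A] R)
    (ee : ∀ k k', Commute (f (e Q k)) (g (e Q' k')))
    (ey : ∀ k b, Commute (f (e Q k)) (g (y Q' b)))
    (ep : ∀ k b, Commute (f (e Q k)) (g (psi Q' b)))
    (ye : ∀ a k', Commute (f (y Q a)) (g (e Q' k')))
    (yy : ∀ a b, Commute (f (y Q a)) (g (y Q' b)))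
    (yp : ∀ a b, Commute (f (y Q a)) (g (psi Q' b)))
    (pe : ∀ a k', Commute (f (psi Q a)) (g (e Q' k')))
    (py : ∀ a b, Commute (f (psi Q a)) (g (y Q' b)))
    (pp : ∀ a b, Commute (f (psi Q a)) (g (psi Q' b))) (x : Hecke Q n) (z : Hecke Q' m) :
    Commute (f x) (g z) := by
  -- Commuting with a fixed element is stable under sums and products, so the two variables can be
  -- treated by separate inductions.
  have key : ∀ w : R, (∀ k', Commute w (g (e Q' k'))) → (∀ b, Commute w (g (y Q' b))) →
      (∀ b, Commute w (g (psi Q' b))) → Commute w (g z) := by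
    intro w he hy hp
    induction z using hecke_induction with
    | algebraMap r => rw [AlgHom.commutes]; exact Algebra.commute_algebraMap_right r w
    | e k => exact he k
    | y a => exact hy a
    | psi a => exact hp a
    | add x z hx hz => rw [map_add]; exact hx.add_right hz
    | mul x z hx hz => rw [map_mul]; exact hx.mul_right hz
  induction x using hecke_induction with
  | algebraMap r => rw [AlgHom.commutes]; exact Algebra.commute_algebraMap_left r _
  | e k => exact key _ (ee k) (ey k) (ep k)
  | y a => exact key _ (ye a) (yy a) (yp a)
  | psi a => exact key _ (pe a) (py a) (pp a)
  | add x z hx hz => rw [map_add]; exact hx.add_left hz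
  | mul x z hx hz => rw [map_mul]; exact hx.mul_left hz

end Universal

end Families

/-! ### The tensor product as an algebra with `KLR` generators -/

section Lists

variable {R : Type*}

/-- Gives the multiplicativity of `liftTensor`. Commutation is needed only for distinct indices,
since `a i` already stands to the left of `b i`. -/
theorem prod_ofFn_mul [Monoid R] {d : ℕ} (a b : Fin d → R)
    (h : ∀ i j, i ≠ j → Commute (a i) (b j)) :
    (List.ofFn fun i => a i * b i).prod = (List.ofFn a).prod * (List.ofFn b).prod := by
  induction d with
  | zero => simp
  | succ d ih =>
    simp only [List.ofFn_succ, List.prod_cons]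
    rw [ih _ _ fun i j hij => h _ _ fun h' => hij (Fin.succ_injective _ h')]
    have hc : Commute (List.ofFn fun i : Fin d => a i.succ).prod (b 0) := by
      refine Commute.list_prod_left _ _ fun x hx => ?_
      obtain ⟨i, rfl⟩ := (List.mem_ofFn' _ _).1 hx
      exact h _ _ (Fin.succ_ne_zero i)
    simp only [mul_assoc]
    rw [← mul_assoc (b 0), ← hc.eq, mul_assoc]

theorem prod_ofFn_eq_single [Monoid R] {d : ℕ} (a : Fin d → R) (j : Fin d)
    (h : ∀ i, i ≠ j → a i = 1) : (List.ofFn a).prod = a j := by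
  induction d with
  | zero => exact j.elim0
  | succ d ih =>
    rw [List.ofFn_succ, List.prod_cons]
    rcases Fin.eq_zero_or_eq_succ j with rfl | ⟨j, rfl⟩
    · rw [List.prod_eq_one, mul_one]
      intro x hx
      obtain ⟨i, rfl⟩ := (List.mem_ofFn' _ _).1 hx
      exact h _ (Fin.succ_ne_zero i)
    · rw [h 0 (Fin.succ_ne_zero j).symm, one_mul]
      exact ih _ j fun i hi => h _ fun h' => hi (Fin.succ_injective _ h')

theorem prod_ofFn_mul_of_forall_ite [Ring R] {d : ℕ} (a : Fin d → R) (c : Fin d → Prop)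
    [DecidablePred c] (x : R) (h : ∀ j, a j * x = if c j then x else 0) :
    (List.ofFn a).prod * x = if ∀ j, c j then x else 0 := by
  induction d with
  | zero => simp
  | succ d ih =>
    rw [List.ofFn_succ, List.prod_cons, mul_assoc, ih _ (fun j => c j.succ) fun j => h _]
    simp only [Fin.forall_fin_succ, mul_ite, mul_zero, h]
    split_ifs <;> simp_all

end Lists


/-- Carries a condition on labels in a part of `K`, with its own decidability instance, to the
matching condition in `K`. -/
theorem map_ite_of_iff {R S F : Type*} [FunLike F R S] (f : F) {c c' : Prop} {_ : Decidable c}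
    [Decidable c'] (h : c ↔ c') (x z : R) : f (if c then x else z) = if c' then f x else f z := by
  by_cases hc : c
  · rw [if_pos hc, if_pos (h.1 hc)]
  · rw [if_neg hc, if_neg fun h' => hc (h.2 h')]

section Tensor

variable {K : Type*} [Fintype K] {A : Type*} [CommRing A] {d n : ℕ}
  {Q : K → K → MvPolynomial (Fin 2) A} {p : K → Fin d} {l : Comp d n}
  {R : Type*} [Ring R] [Algebra A R]

/-- The product of commuting algebra morphisms out of the tensor factors. -/
noncomputable def liftTensor (f : ∀ j, Hecke (restrict Q p j) (l.1 j) →ₐ[A] R)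
    (hf : ∀ i j, i ≠ j → ∀ x z, Commute (f i x) (f j z)) : HeckeTensor Q p l →ₐ[A] R :=
  PiTensorProduct.liftAlgHom
    ((MultilinearMap.mkPiAlgebraFin A d R).compLinearMap fun j => (f j).toLinearMap)
    (by simp [MultilinearMap.mkPiAlgebraFin_apply])
    (fun x z => by
      simp only [MultilinearMap.compLinearMap_apply, MultilinearMap.mkPiAlgebraFin_apply,
        Pi.mul_apply, AlgHom.toLinearMap_apply, map_mul]
      exact prod_ofFn_mul _ _ fun i j hij => hf i j hij _ _)

variable (f : ∀ j, Hecke (restrict Q p j) (l.1 j) →ₐ[A] R)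
    (hf : ∀ i j, i ≠ j → ∀ x z, Commute (f i x) (f j z))

theorem liftTensor_tprod (x : ∀ j, Hecke (restrict Q p j) (l.1 j)) :
    liftTensor f hf (PiTensorProduct.tprod A x) = (List.ofFn fun j => f j (x j)).prod := by
  simp [liftTensor, MultilinearMap.mkPiAlgebraFin_apply]

variable (Q p l) in
/-- The inclusion of the `j`-th tensor factor. -/
noncomputable def factor (j : Fin d) : Hecke (restrict Q p j) (l.1 j) →ₐ[A] HeckeTensor Q p l :=
  PiTensorProduct.singleAlgHom (R := A) (A := fun j => Hecke (restrict Q p j) (l.1 j)) j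

theorem factor_apply (j : Fin d) (x : Hecke (restrict Q p j) (l.1 j)) :
    factor Q p l j x = PiTensorProduct.tprod A (Pi.mulSingle j x) := rfl

theorem liftTensor_factor (j : Fin d) (x : Hecke (restrict Q p j) (l.1 j)) :
    liftTensor f hf (factor Q p l j x) = f j x := by
  rw [factor_apply, liftTensor_tprod, prod_ofFn_eq_single _ j]
  · simp
  · intro i hi; simp [hi]

theorem heckeTensor_algHom_ext {f g : HeckeTensor Q p l →ₐ[A] R}
    (h : ∀ j x, f (factor Q p l j x) = g (factor Q p l j x)) : f = g :=
  PiTensorProduct.algHom_ext fun j => AlgHom.ext fun x => h j x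

theorem factor_mul_tprod (j : Fin d) (x : Hecke (restrict Q p j) (l.1 j))
    (z : ∀ j, Hecke (restrict Q p j) (l.1 j)) (h : x * z j = z j) :
    factor Q p l j x * PiTensorProduct.tprod A z = PiTensorProduct.tprod A z := by
  rw [factor_apply, PiTensorProduct.tprod_mul_tprod]
  congr 1
  funext i
  by_cases hi : i = j
  · subst hi; simpa using h
  · simp [hi]

theorem factor_commute {i j : Fin d} (hij : i ≠ j) (x : Hecke (restrict Q p i) (l.1 i))
    (z : Hecke (restrict Q p j) (l.1 j)) :
    Commute (factor Q p l i x) (factor Q p l j z) := by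
  rw [factor_apply, factor_apply]
  exact Commute.tprod
    (Pi.mulSingle_commute (f := fun j => Hecke (restrict Q p j) (l.1 j)) hij x z)

/-! ### Simple transpositions inside the blocks -/

variable (l) in
/-- `c` is the index of a simple transposition inside a block. -/
def InBlock (c : Fin (n - 1)) : Prop :=
  ∃ x : Σ j : Fin d, Fin (l.1 j - 1), blkSimple l x.1 x.2 = c

theorem lo_blkSimple (j : Fin d) (b : Fin (l.1 j - 1)) :
    lo (blkSimple l j b) = blk l ⟨j, lo b⟩ := rfl

theorem hi_blkSimple (j : Fin d) (b : Fin (l.1 j - 1)) :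
    hi (blkSimple l j b) = blk l ⟨j, hi b⟩ :=
  Fin.ext (blk_hi l j b).symm

variable (l) in
theorem blkSimple_injective :
    Function.Injective fun x : Σ j : Fin d, Fin (l.1 j - 1) => blkSimple l x.1 x.2 := by
  rintro ⟨j, b⟩ ⟨j', b'⟩ h
  have h1 : blk l ⟨j, lo b⟩ = blk l ⟨j', lo b'⟩ := congrArg lo h
  have h2 := (blk l).injective h1
  obtain ⟨rfl, h3⟩ := Sigma.mk.inj_iff.1 h2
  have h4 := congrArg Fin.val (eq_of_heq h3)
  have : b = b' := Fin.ext h4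
  rw [this]

theorem inBlock_blkSimple (j : Fin d) (b : Fin (l.1 j - 1)) : InBlock l (blkSimple l j b) :=
  ⟨⟨j, b⟩, rfl⟩

/-- Position and local index differ by a constant on each block; the additive form avoids truncated
subtraction. -/
theorem blk_val_eq (j : Fin d) {b b' : Fin (l.1 j)} :
    (blk l ⟨j, b'⟩ : ℕ) + b = blk l ⟨j, b⟩ + b' := by
  simp only [blk, Equiv.trans_apply, finCongr_apply, Fin.val_cast, finSigmaFinEquiv_apply]
  omega

/-- Two consecutive positions with one label have consecutive local indices in one block, so the
first is not the last of its block. -/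
theorem inBlock_iff {c : Fin (n - 1)} : InBlock l c ↔ tTriv l (lo c) = tTriv l (hi c) := by
  constructor
  · rintro ⟨⟨j, b⟩, rfl⟩
    rw [lo_blkSimple, hi_blkSimple, tTriv_blk, tTriv_blk]
  · intro h
    obtain ⟨⟨j, x⟩, hx⟩ := (blk l).surjective (lo c)
    obtain ⟨⟨j', x'⟩, hx'⟩ := (blk l).surjective (hi c)
    rw [← hx, ← hx', tTriv_blk, tTriv_blk] at h
    subst h
    have h1 := blk_val_eq (l := l) j (b := x) (b' := x')
    rw [hx, hx'] at h1
    simp only [lo, hi] at h1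
    refine ⟨⟨j, ⟨x, by have := x'.2; omega⟩⟩, ?_⟩
    have h2 : lo (blkSimple l j ⟨x, by have := x'.2; omega⟩) = lo c := by
      rw [← hx]; rfl
    exact Fin.ext (congrArg Fin.val h2 :)

theorem act_s_blkSimple {X : Type*} (k : Fin n → X) (j : Fin d) (b : Fin (l.1 j - 1))
    (i : Fin d) (x : Fin (l.1 i)) (h : i ≠ j) :
    act (s (blkSimple l j b)) k (blk l ⟨i, x⟩) = k (blk l ⟨i, x⟩) := by
  refine act_s_of_ne _ _ ?_ ?_
  · rw [lo_blkSimple]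
    exact fun h' => h (congrArg Sigma.fst ((blk l).injective h'))
  · rw [hi_blkSimple]
    exact fun h' => h (congrArg Sigma.fst ((blk l).injective h'))

theorem act_s_blkSimple_self {X : Type*} (k : Fin n → X) (j : Fin d) (b : Fin (l.1 j - 1))
    (x : Fin (l.1 j)) : act (s (blkSimple l j b)) k (blk l ⟨j, x⟩) =
      act (s b) (fun x => k (blk l ⟨j, x⟩)) x := by
  have hinj : ∀ {x z : Fin (l.1 j)}, x ≠ z → blk l ⟨j, x⟩ ≠ blk l ⟨j, z⟩ := fun h h' =>
    h (eq_of_heq (Sigma.mk.inj_iff.1 ((blk l).injective h')).2)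
  by_cases h1 : x = lo b
  · subst h1; rw [act_s_lo, ← lo_blkSimple, act_s_lo, hi_blkSimple]
  by_cases h2 : x = hi b
  · subst h2; rw [act_s_hi, ← hi_blkSimple, act_s_hi, lo_blkSimple]
  rw [act_s_of_ne _ _ h1 h2, act_s_of_ne]
  · rw [lo_blkSimple]; exact hinj h1
  · rw [hi_blkSimple]; exact hinj h2

/-! ### The generators of the tensor product -/

/-- The tuple `k` has labels `t^l`. -/
def IsLabelled (p : K → Fin d) (l : Comp d n) (k : Fin n → K) : Prop := ∀ a, p (k a) = tTriv l a

/-- The part of `k` in the `j`-th block. -/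
def part {k : Fin n → K} (hk : IsLabelled p l k) (j : Fin d) (b : Fin (l.1 j)) :
    {x // p x = j} := ⟨k (blk l ⟨j, b⟩), by rw [hk, tTriv_blk]⟩

theorem concat_blk (k : ∀ j, Fin (l.1 j) → {x // p x = j}) (j : Fin d) (b : Fin (l.1 j)) :
    concat p l k (blk l ⟨j, b⟩) = k j b := by
  have h : ∀ x : Σ j, Fin (l.1 j), x = ⟨j, b⟩ → ((k x.1 x.2 : {x // p x = _}) : K) = k j b := by
    rintro _ rfl; rfl
  exact h _ ((blk l).symm_apply_apply _)

theorem eq_of_blk {X : Type*} {k k' : Fin n → X}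
    (h : ∀ j b, k (blk l ⟨j, b⟩) = k' (blk l ⟨j, b⟩)) : k = k' := by
  funext a
  obtain ⟨⟨j, b⟩, rfl⟩ := (blk l).surjective a
  exact h j b

theorem isLabelled_concat (k : ∀ j, Fin (l.1 j) → {x // p x = j}) :
    IsLabelled p l (concat p l k) := by
  intro a
  obtain ⟨⟨j, b⟩, rfl⟩ := (blk l).surjective a
  rw [concat_blk, tTriv_blk, (k j b).2]

theorem part_concat (k : ∀ j, Fin (l.1 j) → {x // p x = j}) (h : IsLabelled p l (concat p l k)) :
    part h = k := by
  funext j b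
  exact Subtype.ext (concat_blk k j b)

theorem concat_part {k : Fin n → K} (hk : IsLabelled p l k) : concat p l (part hk) = k :=
  eq_of_blk fun j b => concat_blk _ j b

theorem isLabelled_act_s {k : Fin n → K} {c : Fin (n - 1)} (hc : InBlock l c) :
    IsLabelled p l (act (s c) k) ↔ IsLabelled p l k := by
  have key : ∀ {k : Fin n → K}, IsLabelled p l k → IsLabelled p l (act (s c) k) := by
    intro k hk a
    have h1 : (fun a => p (k a)) = tTriv l := funext hk
    have h2 := act_s_eq_self (inBlock_iff.1 hc)
    rw [← h1] at h2
    rw [← hk]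
    exact congrFun h2 a
  exact ⟨fun h => by simpa using key h, key⟩

variable (Q p l)

open scoped Classical in
/-- The idempotents of the tensor product, indexed by all tuples. -/
noncomputable def tE (k : Fin n → K) : HeckeTensor Q p l :=
  -- The value 0 on all other tuples matters: it makes the sum over all of K^n equal to 1.
  if hk : IsLabelled p l k then PiTensorProduct.tprod A fun j => e (restrict Q p j) (part hk j)
  else 0

/-- The polynomial generators of the tensor product. -/
noncomputable def tY (c : Fin n) : HeckeTensor Q p l :=
  factor Q p l ((blk l).symm c).1 (y _ ((blk l).symm c).2)

/-- The braid-like generators of the tensor product. -/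
noncomputable def tP : Fin (n - 1) → HeckeTensor Q p l :=
  Function.extend (fun x : Σ j : Fin d, Fin (l.1 j - 1) => blkSimple l x.1 x.2)
    (fun x => factor Q p l x.1 (psi _ x.2)) 0

variable {Q p l}

theorem tY_blk (j : Fin d) (b : Fin (l.1 j)) :
    tY Q p l (blk l ⟨j, b⟩) = factor Q p l j (y _ b) := by
  have h : ∀ x : Σ j, Fin (l.1 j), x = ⟨j, b⟩ →
      factor Q p l x.1 (y _ x.2) = factor Q p l j (y _ b) := by
    rintro _ rfl; rfl
  exact h _ ((blk l).symm_apply_apply _)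

theorem tP_blkSimple (j : Fin d) (b : Fin (l.1 j - 1)) :
    tP Q p l (blkSimple l j b) = factor Q p l j (psi _ b) :=
  (blkSimple_injective l).extend_apply (fun x => factor Q p l x.1 (psi _ x.2)) 0 ⟨j, b⟩

theorem tE_of_not {k : Fin n → K} (hk : ¬ IsLabelled p l k) : tE Q p l k = 0 := dif_neg hk

theorem tE_of {k : Fin n → K} (hk : IsLabelled p l k) :
    tE Q p l k = PiTensorProduct.tprod A fun j => e (restrict Q p j) (part hk j) := dif_pos hk

theorem tE_concat (k : ∀ j, Fin (l.1 j) → {x // p x = j}) :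
    tE Q p l (concat p l k) = PiTensorProduct.tprod A fun j => e (restrict Q p j) (k j) := by
  rw [tE_of (isLabelled_concat k), part_concat]

open scoped Classical in
theorem factor_e_mul_tE (j : Fin d) (k' : Fin (l.1 j) → {x // p x = j}) (k : Fin n → K) :
    factor Q p l j (e _ k') * tE Q p l k =
      if ∀ b, k (blk l ⟨j, b⟩) = k' b then tE Q p l k else 0 := by
  by_cases hk : IsLabelled p l k
  swap
  · simp [tE_of_not hk]
  rw [tE_of hk]
  split_ifs with h
  · refine factor_mul_tprod j _ _ ?_
    have : part hk j = k' := funext fun b => Subtype.ext (h b)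
    rw [this, (isKLR_hecke _ _).e_mul_self]
  · rw [factor_apply, PiTensorProduct.tprod_mul_tprod]
    refine MultilinearMap.map_coord_zero _ j ?_
    rw [Pi.mul_apply, Pi.mulSingle_eq_same]
    refine (isKLR_hecke _ _).e_mul_ne _ _ fun h' => h fun b => ?_
    rw [h']; rfl

/-- The idempotent of the `j`-th factor is absorbed by `tE Q p l k`, so relations of a single factor
transfer to the tensor product. -/
theorem factor_mul_tE_eq {k : Fin n → K} (hk : IsLabelled p l k) {j : Fin d}
    {x z : Hecke (restrict Q p j) (l.1 j)}
    (h : x * e _ (part hk j) = z * e _ (part hk j)) :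
    factor Q p l j x * tE Q p l k = factor Q p l j z * tE Q p l k := by
  have h1 := (factor_e_mul_tE (Q := Q) j (part hk j) k).trans (if_pos fun _ => rfl)
  rw [← h1, ← mul_assoc, ← mul_assoc, ← map_mul, ← map_mul, h]

/-- Expand the tensor product of the identities ∑ e(k^j) = 1 by multilinearity; concatenation
matches the terms with the tuples labelled t^λ. -/
theorem sum_tE : ∑ k, tE Q p l k = 1 := by
  classical
  have h : ∀ j, ∑ k', e (restrict Q p j) (n := l.1 j) k' = 1 := fun j => (isKLR_hecke _ _).sum_e
  have h1 : PiTensorProduct.tprod A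
      (fun j => ∑ k', e (restrict Q p j) (n := l.1 j) k') = 1 :=
    congrArg (PiTensorProduct.tprod A) (funext h)
  rw [← h1, MultilinearMap.map_sum]
  have h2 : ∀ k : ∀ j, Fin (l.1 j) → {x // p x = j},
      (PiTensorProduct.tprod A fun j => e (restrict Q p j) (k j)) = tE Q p l (concat p l k) :=
    fun k => (tE_concat k).symm
  rw [Finset.sum_congr rfl fun k _ => h2 k]
  refine (Finset.sum_of_injOn (concat p l) ?_ (fun _ _ => Finset.mem_coe.2 (Finset.mem_univ _)) ?_
    fun _ _ => rfl).symm
  · intro k _ k' _ h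
    funext j b
    refine Subtype.ext ?_
    rw [← concat_blk, ← concat_blk, h]
  · intro k _ hk
    refine tE_of_not fun hk' => hk ⟨part hk', by simp, concat_part hk'⟩

open scoped Classical in
variable (Q p l) in
/-- The tensor product satisfies those relations of `H_n(Q)` that stay within the blocks. -/
theorem isKLR_tensor : IsKLR Q (InBlock l) (tE Q p l) (tY Q p l) (tP Q p l) where
  sum_e := sum_tE
  e_mul_self k := by
    by_cases hk : IsLabelled p l k
    · rw [tE_of hk, PiTensorProduct.tprod_mul_tprod]
      congr 1
      funext j
      exact (isKLR_hecke _ _).e_mul_self _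
    · rw [tE_of_not hk, mul_zero]
  e_mul_ne k k' h := by
    by_cases hk : IsLabelled p l k
    swap
    · rw [tE_of_not hk, zero_mul]
    by_cases hk' : IsLabelled p l k'
    swap
    · rw [tE_of_not hk', mul_zero]
    rw [tE_of hk, tE_of hk', PiTensorProduct.tprod_mul_tprod]
    obtain ⟨j, hj⟩ : ∃ j, part hk j ≠ part hk' j := by
      by_contra! h1
      refine h ?_
      rw [← concat_part hk, ← concat_part hk', funext h1]
    exact MultilinearMap.map_coord_zero _ j ((isKLR_hecke _ _).e_mul_ne _ _ hj)
  y_e a k := by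
    by_cases hk : IsLabelled p l k
    swap
    · rw [tE_of_not hk, zero_mul, mul_zero]
    obtain ⟨⟨j, b⟩, rfl⟩ := (blk l).surjective a
    rw [tY_blk, factor_apply, tE_of hk]
    refine Commute.tprod (funext fun i => ?_)
    by_cases hi : i = j
    · subst hi; simpa using (isKLR_hecke _ _).y_e b _
    · simp [hi]
  psi_e c hc k := by
    by_cases hk : IsLabelled p l k
    swap
    · rw [tE_of_not hk, tE_of_not (by rwa [isLabelled_act_s hc]), zero_mul, mul_zero]
    have hk' := (isLabelled_act_s hc).2 hk
    obtain ⟨⟨j, b⟩, rfl⟩ := hc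
    rw [tP_blkSimple, factor_apply, tE_of hk, tE_of hk']
    refine SemiconjBy.tprod (funext fun i => ?_)
    by_cases hi : i = j
    · subst hi
      have h1 : part hk' i = act (s b) (part hk i) := by
        funext x
        refine Subtype.ext ?_
        exact act_s_blkSimple_self k i b x
      simpa [h1] using (isKLR_hecke _ _).psi_e b trivial _
    · have h1 : part hk' i = part hk i := by
        funext x
        exact Subtype.ext (act_s_blkSimple k j b i x hi)
      simp [hi, h1]
  y_y a b := by
    obtain ⟨⟨i, a⟩, rfl⟩ := (blk l).surjective a
    obtain ⟨⟨j, b⟩, rfl⟩ := (blk l).surjective b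
    rw [tY_blk, tY_blk]
    by_cases hi : i = j
    · subst hi; rw [← map_mul, (isKLR_hecke _ _).y_y, map_mul]
    · exact factor_commute hi _ _
  psi_y c hc a h h' := by
    obtain ⟨⟨i, c⟩, rfl⟩ := hc
    obtain ⟨⟨j, b⟩, rfl⟩ := (blk l).surjective a
    rw [lo_blkSimple] at h
    rw [hi_blkSimple] at h'
    rw [tP_blkSimple, tY_blk]
    by_cases hi : i = j
    · subst hi
      rw [← map_mul, (isKLR_hecke _ _).psi_y c trivial b (fun h1 => h (by rw [h1]))
        (fun h1 => h' (by rw [h1])), map_mul]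
    · exact factor_commute hi _ _
  psi_psi a b ha hb h := by
    obtain ⟨⟨i, a⟩, rfl⟩ := ha
    obtain ⟨⟨j, b⟩, rfl⟩ := hb
    rw [tP_blkSimple, tP_blkSimple]
    by_cases hi : i = j
    · subst hi
      rw [← map_mul, (isKLR_hecke _ _).psi_psi a b trivial trivial, map_mul]
      have h1 := blk_val_eq (l := l) i (b := lo a) (b' := lo b)
      simp only [blkSimple] at h
      simp only [lo] at h h1
      omega
    · exact factor_commute hi _ _
  psi_y_hi a ha k := by
    by_cases hk : IsLabelled p l k
    swap
    · simp [tE_of_not hk]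
    obtain ⟨⟨j, a⟩, rfl⟩ := ha
    have hiff : ∀ b c, part hk j b = part hk j c ↔ k (blk l ⟨j, b⟩) = k (blk l ⟨j, c⟩) :=
      fun _ _ => Subtype.ext_iff
    have h1 := factor_mul_tE_eq hk ((isKLR_hecke (restrict Q p j) (l.1 j)).psi_y_hi a trivial (part hk j))
    simp only [map_mul, map_add] at h1
    rw [map_ite_of_iff (factor Q p l j) (hiff (lo a) (hi a)), map_one, map_zero] at h1
    rw [lo_blkSimple, hi_blkSimple, tP_blkSimple, tY_blk, tY_blk]
    exact h1
  y_hi_psi a ha k := by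
    by_cases hk : IsLabelled p l k
    swap
    · simp [tE_of_not hk]
    obtain ⟨⟨j, a⟩, rfl⟩ := ha
    have hiff : ∀ b c, part hk j b = part hk j c ↔ k (blk l ⟨j, b⟩) = k (blk l ⟨j, c⟩) :=
      fun _ _ => Subtype.ext_iff
    have h1 := factor_mul_tE_eq hk ((isKLR_hecke (restrict Q p j) (l.1 j)).y_hi_psi a trivial (part hk j))
    simp only [map_mul, map_add] at h1
    rw [map_ite_of_iff (factor Q p l j) (hiff (lo a) (hi a)), map_one, map_zero] at h1
    rw [lo_blkSimple, hi_blkSimple, tP_blkSimple, tY_blk, tY_blk]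
    exact h1
  psi_sq a ha k := by
    by_cases hk : IsLabelled p l k
    swap
    · simp [tE_of_not hk]
    obtain ⟨⟨j, a⟩, rfl⟩ := ha
    have hiff : ∀ b c, part hk j b = part hk j c ↔ k (blk l ⟨j, b⟩) = k (blk l ⟨j, c⟩) :=
      fun _ _ => Subtype.ext_iff
    have h1 := factor_mul_tE_eq hk ((isKLR_hecke (restrict Q p j) (l.1 j)).psi_sq a trivial (part hk j))
    simp only [part, map_mul, map_evalAt, restrict] at h1
    rw [lo_blkSimple, hi_blkSimple, tP_blkSimple, tY_blk, tY_blk]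
    exact h1
  braid a b ha hb hab k := by
    by_cases hk : IsLabelled p l k
    swap
    · simp [tE_of_not hk]
    have hlh : hi a = lo b := Fin.ext hab.symm
    -- The two transpositions share a position, hence lie in the same block.
    have hij := (inBlock_iff.1 ha).trans ((congrArg _ hlh).trans (inBlock_iff.1 hb))
    obtain ⟨⟨i, a⟩, rfl⟩ := ha
    obtain ⟨⟨j, b⟩, rfl⟩ := hb
    rw [lo_blkSimple, hi_blkSimple, tTriv_blk, tTriv_blk] at hij
    dsimp only at hij
    subst hij
    have h2 : b.val = a.val + 1 := by
      have h3 := blk_val_eq (l := l) i (b := lo a) (b' := lo b)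
      simp only [blkSimple] at hab
      simp only [lo] at hab h3
      omega
    have hiff : ∀ b c, part hk i b = part hk i c ↔ k (blk l ⟨i, b⟩) = k (blk l ⟨i, c⟩) :=
      fun _ _ => Subtype.ext_iff
    have h1 := factor_mul_tE_eq hk ((isKLR_hecke (restrict Q p i) (l.1 i)).braid a b trivial trivial h2 (part hk i))
    simp only [map_mul, map_add] at h1
    rw [map_ite_of_iff (factor Q p l i) (hiff (lo a) (hi b)), map_divDiff, map_zero] at h1
    rw [lo_blkSimple, hi_blkSimple, hi_blkSimple, tP_blkSimple, tP_blkSimple, tY_blk, tY_blk,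
      tY_blk]
    exact h1

end Tensor

/-! ### The universal property of the tensor product -/

section TensorLift

variable {K : Type*} [Fintype K] {A : Type*} [CommRing A] {d n : ℕ}
  {Q : K → K → MvPolynomial (Fin 2) A} {p : K → Fin d} {l : Comp d n}
  {R : Type*} [Ring R] [Algebra A R]
  {E : (Fin n → K) → R} {Y : Fin n → R} {P : Fin (n - 1) → R}

open scoped Classical in
variable (p l E) in
/-- The idempotent attached to a tuple in the `j`-th block. -/
noncomputable def blockE (j : Fin d) (k' : Fin (l.1 j) → {x // p x = j}) : R :=
  ∑ k ∈ Finset.univ.filter fun k : Fin n → K => ∀ b, k (blk l ⟨j, b⟩) = k' b, E k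

namespace IsKLR

open scoped Classical in
theorem blockE_mul {G : Fin (n - 1) → Prop} (h : IsKLR Q G E Y P) (j : Fin d)
    (k' : Fin (l.1 j) → {x // p x = j}) (k : Fin n → K) :
    blockE p l E j k' * E k = if ∀ b, k (blk l ⟨j, b⟩) = k' b then E k else 0 :=
  h.sum_filter_mul_e _ k

theorem act_s_eq_iff (j : Fin d) (c : Fin (l.1 j - 1)) (k' : Fin (l.1 j) → {x // p x = j})
    (k : Fin n → K) : (∀ b, act (s (blkSimple l j c)) k (blk l ⟨j, b⟩) = act (s c) k' b) ↔
      ∀ b, k (blk l ⟨j, b⟩) = k' b := by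
  have h1 : ∀ b, act (s (blkSimple l j c)) k (blk l ⟨j, b⟩) = k (blk l ⟨j, s c b⟩) :=
    fun b => (act_s_blkSimple_self k j c b).trans (act_s_apply ..)
  simp only [h1, act_s_apply c k']
  exact ⟨fun h b => by simpa using h (s c b), fun h b => h _⟩

theorem act_s_eq_iff_of_ne {i j : Fin d} (hij : i ≠ j) (c : Fin (l.1 j - 1))
    (k' : Fin (l.1 i) → {x // p x = i}) (k : Fin n → K) :
    (∀ b, act (s (blkSimple l j c)) k (blk l ⟨i, b⟩) = k' b) ↔
      ∀ b, k (blk l ⟨i, b⟩) = k' b := by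
  simp only [act_s_blkSimple k j c i _ hij]

/-- Positions of distinct blocks never coincide, so the two indices are neither equal nor
consecutive. -/
theorem blkSimple_far {i j : Fin d} (a : Fin (l.1 i - 1)) (b : Fin (l.1 j - 1)) (hij : i ≠ j) :
    (blkSimple l i a).val + 1 < (blkSimple l j b).val ∨
      (blkSimple l j b).val + 1 < (blkSimple l i a).val := by
  have h : ∀ (x : Fin (l.1 i)) (z : Fin (l.1 j)), (blk l ⟨i, x⟩ : ℕ) ≠ blk l ⟨j, z⟩ :=
    fun x z h' => hij (congrArg Sigma.fst ((blk l).injective (Fin.ext h')))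
  have h1 := h (lo a) (lo b)
  have h2 := h (lo a) (hi b)
  have h3 := h (hi a) (lo b)
  rw [blk_hi] at h2 h3
  simp only [blkSimple]
  omega

variable (h : IsKLR Q (InBlock l) E Y P) (hE : ∀ k, ¬ IsLabelled p l k → E k = 0)
include h hE

/-- Each block idempotent keeps or kills a given `E k`, so by `ext_e` every relation reduces to the
one already known on `E k`. The vanishing `hE` is needed for the idempotents to sum to 1, since they
only see tuples with labels in the `j`-th part. -/
theorem block (j : Fin d) : IsKLR (restrict Q p j) (fun _ => True) (blockE p l E j)
    (fun b => Y (blk l ⟨j, b⟩)) (fun b => P (blkSimple l j b)) := by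
  classical
  have hP := fun b => inBlock_blkSimple (l := l) j b
  have key : ∀ {x z : R} {k' : Fin (l.1 j) → {x // p x = j}},
      (∀ k, (∀ b, k (blk l ⟨j, b⟩) = (k' b).1) → x * E k = z * E k) →
        x * blockE p l E j k' = z * blockE p l E j k' := by
    intro x z k' hxz
    refine h.ext_e fun k => ?_
    rw [mul_assoc, mul_assoc, h.blockE_mul]
    split_ifs with hk
    · exact hxz k hk
    · simp
  have hkk : ∀ {k' : Fin (l.1 j) → {x // p x = j}} {k : Fin n → K} (b c : Fin (l.1 j)),
      (∀ b, k (blk l ⟨j, b⟩) = (k' b).1) → (k' b = k' c ↔ k (blk l ⟨j, b⟩) = k (blk l ⟨j, c⟩)) :=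
    fun b c hk => by rw [hk, hk, Subtype.ext_iff]
  constructor
  · refine h.ext_e fun k => ?_
    rw [Finset.sum_mul, one_mul]
    simp only [h.blockE_mul]
    by_cases hk : IsLabelled p l k
    · rw [Finset.sum_eq_single (part hk j)]
      · exact if_pos fun _ => rfl
      · intro k' _ hk'
        exact if_neg fun h1 => hk' (funext fun b => Subtype.ext (h1 b).symm)
      · simp
    · simp [hE k hk]
  · intro k'
    refine h.ext_e fun k => ?_
    rw [mul_assoc, h.blockE_mul, mul_ite, h.blockE_mul, mul_zero]
    split_ifs <;> rfl
  · intro k' k'' hk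
    refine h.ext_e fun k => ?_
    rw [mul_assoc, h.blockE_mul, mul_ite, h.blockE_mul, mul_zero, zero_mul]
    split_ifs with h1 h2
    · exact absurd (funext fun b => Subtype.ext ((h2 b).symm.trans (h1 b))) hk
    · rfl
    · rfl
  · intro a k'
    refine h.ext_e fun k => ?_
    rw [mul_assoc, h.blockE_mul, mul_assoc, h.y_e, ← mul_assoc, h.blockE_mul, mul_ite, ite_mul,
      mul_zero, zero_mul, h.y_e]
  · intro a _ k'
    refine h.ext_e fun k => ?_
    rw [mul_assoc, h.blockE_mul, mul_assoc, h.psi_e _ (hP a), ← mul_assoc, h.blockE_mul, mul_ite,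
      ite_mul, mul_zero, zero_mul, h.psi_e _ (hP a)]
    simp only [act_s_eq_iff]
  · exact fun a b => h.y_y _ _
  · intro a _ b hb hb'
    refine h.psi_y _ (hP a) _ ?_ ?_
    · rw [lo_blkSimple]
      exact fun h1 => hb (eq_of_heq (Sigma.mk.inj_iff.1 ((blk l).injective h1)).2)
    · rw [hi_blkSimple]
      exact fun h1 => hb' (eq_of_heq (Sigma.mk.inj_iff.1 ((blk l).injective h1)).2)
  · intro a b _ _ hab
    refine h.psi_psi _ _ (hP a) (hP b) ?_
    have h1 := blk_val_eq (l := l) j (b := lo a) (b' := lo b)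
    simp only [blkSimple]
    simp only [lo] at h1 ⊢
    omega
  · intro a _ k'
    refine key fun k hk => ?_
    have h1 := h.psi_y_hi _ (hP a) k
    rw [lo_blkSimple, hi_blkSimple] at h1
    simp only [hkk _ _ hk]
    exact h1
  · intro a _ k'
    refine key fun k hk => ?_
    have h1 := h.y_hi_psi _ (hP a) k
    rw [lo_blkSimple, hi_blkSimple] at h1
    simp only [hkk _ _ hk]
    exact h1
  · intro a _ k'
    refine key fun k hk => ?_
    have h1 := h.psi_sq _ (hP a) k
    rw [lo_blkSimple, hi_blkSimple, hk, hk] at h1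
    exact h1
  · intro a b _ _ hab k'
    refine key fun k hk => ?_
    have h1 := h.braid _ _ (hP a) (hP b) (by
      have h1 := blk_val_eq (l := l) j (b := lo a) (b' := lo b)
      simp only [blkSimple]
      simp only [lo] at h1 ⊢
      omega) k
    rw [lo_blkSimple, hi_blkSimple, hi_blkSimple] at h1
    simp only [hkk _ _ hk, restrict]
    rw [← hk, ← hk]
    exact h1

/-- Transpositions of distinct blocks are far apart, and the idempotents of one block do not see a
permutation inside another. -/
theorem block_commute {i j : Fin d} (hij : i ≠ j) (x : Hecke (restrict Q p i) (l.1 i))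
    (z : Hecke (restrict Q p j) (l.1 j)) :
    Commute ((h.block hE i).lift x) ((h.block hE j).lift z) := by
  classical
  have eP : ∀ {i j : Fin d} (_ : i ≠ j) (k' : Fin (l.1 i) → {x // p x = i}) (b : Fin (l.1 j - 1)),
      Commute (blockE p l E i k') (P (blkSimple l j b)) := by
    intro i j hij k' b
    refine h.ext_e fun k => ?_
    rw [mul_assoc, h.psi_e _ (inBlock_blkSimple j b), ← mul_assoc, h.blockE_mul, mul_assoc,
      h.blockE_mul, mul_ite, ite_mul, mul_zero, zero_mul, h.psi_e _ (inBlock_blkSimple j b)]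
    simp only [act_s_eq_iff_of_ne hij]
  have eY : ∀ {i : Fin d} (k' : Fin (l.1 i) → {x // p x = i}) (c : Fin n),
      Commute (blockE p l E i k') (Y c) := by
    intro i k' c
    refine h.ext_e fun k => ?_
    rw [mul_assoc, h.y_e, ← mul_assoc, h.blockE_mul, mul_assoc,
      h.blockE_mul, mul_ite, ite_mul, mul_zero, zero_mul, h.y_e]
  have pY : ∀ {i j : Fin d} (_ : i ≠ j) (a : Fin (l.1 i - 1)) (b : Fin (l.1 j)),
      Commute (P (blkSimple l i a)) (Y (blk l ⟨j, b⟩)) := by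
    intro i j hij a b
    refine h.psi_y _ (inBlock_blkSimple i a) _ ?_ ?_
    · rw [lo_blkSimple]
      exact fun h1 => hij (congrArg Sigma.fst ((blk l).injective h1)).symm
    · rw [hi_blkSimple]
      exact fun h1 => hij (congrArg Sigma.fst ((blk l).injective h1)).symm
  refine hecke_commute _ _ ?_ ?_ ?_ ?_ ?_ ?_ ?_ ?_ ?_ x z <;> intro a b <;>
    simp only [lift_e, lift_y, lift_psi]
  · refine h.ext_e fun k => ?_
    rw [mul_assoc, h.blockE_mul, mul_assoc, h.blockE_mul, mul_ite, mul_ite, h.blockE_mul,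
      h.blockE_mul, mul_zero, mul_zero]
    split_ifs <;> rfl
  · exact eY _ _
  · exact eP hij _ _
  · exact (eY _ _).symm
  · exact h.y_y _ _
  · exact (pY hij.symm _ _).symm
  · exact (eP hij.symm _ _).symm
  · exact pY hij _ _
  · exact h.psi_psi _ _ (inBlock_blkSimple i a) (inBlock_blkSimple j b) (blkSimple_far a b hij)

omit hE in
/-- The universal property of the tensor product. -/
noncomputable def tensorLift (hE : ∀ k, ¬ IsLabelled p l k → E k = 0) :
    HeckeTensor Q p l →ₐ[A] R :=
  liftTensor (fun j => (h.block hE j).lift) fun _ _ hij x z => h.block_commute hE hij x z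

theorem tensorLift_tY (c : Fin n) : h.tensorLift hE (tY Q p l c) = Y c := by
  obtain ⟨⟨j, b⟩, rfl⟩ := (blk l).surjective c
  rw [tY_blk, tensorLift, liftTensor_factor, lift_y]

theorem tensorLift_tP {c : Fin (n - 1)} (hc : InBlock l c) :
    h.tensorLift hE (tP Q p l c) = P c := by
  obtain ⟨⟨j, b⟩, rfl⟩ := hc
  rw [tP_blkSimple, tensorLift, liftTensor_factor, lift_psi]

/-- The product of the block idempotents keeps `E k'` exactly when `k'` agrees with `k` on every
block, that is, when `k' = k`. -/
theorem tensorLift_tE (k : Fin n → K) : h.tensorLift hE (tE Q p l k) = E k := by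
  classical
  by_cases hk : IsLabelled p l k
  swap
  · rw [tE_of_not hk, hE k hk, map_zero]
  refine h.ext_e fun k' => ?_
  rw [tE_of hk, tensorLift, liftTensor_tprod,
    prod_ofFn_mul_of_forall_ite _ (fun j => ∀ b, k' (blk l ⟨j, b⟩) = part hk j b), h.e_mul_e]
  · congr 1
    refine propext ⟨fun h1 => (eq_of_blk h1).symm, fun h1 j b => by rw [← h1]; rfl⟩
  · intro j
    rw [lift_e, h.blockE_mul]

end IsKLR

/-- Algebra morphisms out of the tensor product are determined by their values on generators. -/
theorem heckeTensor_algHom_ext' {f g : HeckeTensor Q p l →ₐ[A] R}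
    (hE : ∀ k, f (tE Q p l k) = g (tE Q p l k)) (hY : ∀ c, f (tY Q p l c) = g (tY Q p l c))
    (hP : ∀ c, InBlock l c → f (tP Q p l c) = g (tP Q p l c)) : f = g := by
  classical
  refine heckeTensor_algHom_ext fun j x => ?_
  have h1 : f.comp (factor Q p l j) = g.comp (factor Q p l j) := by
    refine hecke_algHom_ext (fun k' => ?_) (fun b => ?_) (fun b => ?_)
    · have h2 : factor Q p l j (e _ k') =
          ∑ k, if ∀ b, k (blk l ⟨j, b⟩) = (k' b).1 then tE Q p l k else 0 := by
        rw [← mul_one (factor Q p l j _), ← sum_tE, Finset.mul_sum]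
        exact Finset.sum_congr rfl fun k _ => factor_e_mul_tE j k' k
      simp only [AlgHom.comp_apply, h2, map_sum, apply_ite f, apply_ite g, map_zero, hE]
    · simpa [tY_blk] using hY (blk l ⟨j, b⟩)
    · simpa [tP_blkSimple] using hP _ (inBlock_blkSimple j b)
  exact DFunLike.congr_fun h1 x

end TensorLift

/-! ### Monomial matrices -/

section Monomial

variable {J R : Type*} [Fintype J] [DecidableEq J] [Ring R]

/-- The matrix whose column `t` has the entry `c t` in the row `σ t` and zeros elsewhere. -/
def monomialMatrix (σ : J → J) (c : J → R) : Matrix J J R :=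
  Matrix.of fun i t => if i = σ t then c t else 0

theorem monomialMatrix_mul (σ τ : J → J) (c c' : J → R) :
    monomialMatrix σ c * monomialMatrix τ c' =
      monomialMatrix (fun t => σ (τ t)) fun t => c (τ t) * c' t := by
  ext i t
  simp [monomialMatrix, Matrix.mul_apply]

theorem monomialMatrix_id (c : J → R) : monomialMatrix (fun t => t) c = Matrix.diagonal c := by
  ext i t
  by_cases h : i = t
  · subst h; simp [monomialMatrix]
  · simp [monomialMatrix, h]

theorem monomialMatrix_add (σ : J → J) (c c' : J → R) :
    monomialMatrix σ c + monomialMatrix σ c' = monomialMatrix σ fun t => c t + c' t := by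
  ext i t
  by_cases h : i = σ t <;> simp [monomialMatrix, h]

/-- The row maps need to agree only where the coefficient is nonzero. This compares correction
terms, which are diagonal, with products of ψ's, which move columns. -/
theorem monomialMatrix_congr {σ τ : J → J} {c c' : J → R} (h : ∀ t, c t = c' t)
    (h' : ∀ t, c t ≠ 0 → σ t = τ t) : monomialMatrix σ c = monomialMatrix τ c' := by
  ext i t
  simp only [monomialMatrix, Matrix.of_apply, ← h t]
  by_cases h0 : c t = 0
  · simp [h0]
  · rw [h' t h0]

theorem monomialMatrix_mul_single (σ : J → J) (c : J → R) (t t' : J) (x : R) :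
    monomialMatrix σ c * Matrix.single t t' x = Matrix.single (σ t) t' (c t * x) := by
  ext i j
  simp only [monomialMatrix, Matrix.mul_apply, Matrix.of_apply, Matrix.single_apply]
  rw [Finset.sum_eq_single t]
  · by_cases h1 : i = σ t <;> by_cases h2 : t' = j <;> simp [h1, h2, eq_comm]
  · intro b _ hb; simp [hb.symm]
  · simp

theorem single_mul_monomialMatrix (σ : J → J) (hσ : Function.Injective σ) (c : J → R) (t t' : J)
    (x : R) : Matrix.single t' (σ t) x * monomialMatrix σ c = Matrix.single t' t (x * c t) := by
  ext i j
  simp only [monomialMatrix, Matrix.mul_apply, Matrix.of_apply, Matrix.single_apply]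
  rw [Finset.sum_eq_single (σ t)]
  · by_cases h1 : t' = i <;> by_cases h2 : t = j <;> simp [h1, h2, hσ.eq_iff]
  · intro b _ hb; simp [hb.symm]
  · simp

variable {A : Type*} [CommRing A] [Algebra A R]

/-- Evaluation commutes with algebra morphisms; apply this to the diagonal embedding of `J → R` and
to its coordinate maps. -/
theorem evalAt_diagonal (P : MvPolynomial (Fin 2) A) (f g : J → R) :
    evalAt P (Matrix.diagonal f) (Matrix.diagonal g) =
      Matrix.diagonal fun t => evalAt P (f t) (g t) := by
  have h := map_evalAt (Matrix.diagonalAlgHom (n := J) (α := R) A) P f g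
  have h2 : evalAt P f g = fun t => evalAt P (f t) (g t) :=
    funext fun t => map_evalAt (Pi.evalAlgHom A (fun _ : J => R) t) P f g
  rw [h2] at h
  exact h.symm

theorem divDiff_diagonal (P : MvPolynomial (Fin 2) A) (f g k : J → R) :
    divDiff P (Matrix.diagonal f) (Matrix.diagonal g) (Matrix.diagonal k) =
      Matrix.diagonal fun t => divDiff P (f t) (g t) (k t) := by
  have h := map_divDiff (Matrix.diagonalAlgHom (n := J) (α := R) A) P f g k
  have h2 : divDiff P f g k = fun t => divDiff P (f t) (g t) (k t) :=
    funext fun t => map_divDiff (Pi.evalAlgHom A (fun _ : J => R) t) P f g k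
  rw [h2] at h
  exact h.symm

end Monomial

/-! ### The matrix representation -/

section MatrixRep

variable {K : Type*} [Fintype K] {A : Type*} [CommRing A] {d n : ℕ}
  {Q : K → K → MvPolynomial (Fin 2) A} {p : K → Fin d} {l : Comp d n}
  {R : Type*} [Ring R] [Algebra A R]
  {E : (Fin n → K) → R} {Y : Fin n → R} {P : Fin (n - 1) → R}

theorem shapeAct_mul (u v : Equiv.Perm (Fin n)) (t : Shape l) :
    shapeAct (u * v) t = shapeAct u (shapeAct v t) := Subtype.ext (act_mul u v t.1)

theorem shapeAct_injective (u : Equiv.Perm (Fin n)) :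
    Function.Injective (shapeAct u : Shape l → Shape l) := fun _ _ h =>
  Subtype.ext (act_injective u (congrArg Subtype.val h))

/-- If `t` takes the same value at the places `a`, `a + 1`, then `π_t` sends them to successive
places of a block. -/
theorem exists_minRep_index (t : Shape l) {a : Fin (n - 1)} (h : t.1 (lo a) = t.1 (hi a)) :
    ∃ c : Fin (n - 1), lo c = minRep l t (lo a) ∧ hi c = minRep l t (hi a) ∧ InBlock l c := by
  have h1 := minRep_hi t h
  have h2 := (minRep l t (hi a)).2
  let c : Fin (n - 1) := ⟨minRep l t (lo a), by omega⟩
  have h3 : lo c = minRep l t (lo a) := rfl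
  have h4 : hi c = minRep l t (hi a) := Fin.ext h1.symm
  refine ⟨c, h3, h4, inBlock_iff.2 ?_⟩
  rw [h3, h4, tTriv_minRep, tTriv_minRep, h]

theorem lo_injective : Function.Injective (lo : Fin (n - 1) → Fin n) := fun _ _ h =>
  Fin.ext (congrArg Fin.val h :)

theorem minRep_mul_s {t : Shape l} {a c : Fin (n - 1)} (h : lo c = minRep l t (lo a))
    (h' : hi c = minRep l t (hi a)) : minRep l t * s a = s c * minRep l t := by
  rw [s, s, h, h', Equiv.mul_swap_eq_swap_mul]

open scoped Classical in
variable (P) in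
/-- The nonzero entry in the column `t` of the matrix of `ψ_a`. -/
noncomputable def psiCoeff (a : Fin (n - 1)) (t : Shape l) : R :=
  if h : t.1 (lo a) = t.1 (hi a) then P (exists_minRep_index t h).choose else 1

theorem psiCoeff_of_ne {a : Fin (n - 1)} {t : Shape l} (h : t.1 (lo a) ≠ t.1 (hi a)) :
    psiCoeff P a t = 1 := dif_neg h

/-- An index is determined by its lower position, so the choice in `psiCoeff` is immaterial. -/
theorem psiCoeff_of_eq {a c : Fin (n - 1)} {t : Shape l} (h : t.1 (lo a) = t.1 (hi a))
    (hc : lo c = minRep l t (lo a)) : psiCoeff P a t = P c := by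
  rw [psiCoeff, dif_pos h]
  congr 1
  exact lo_injective ((exists_minRep_index t h).choose_spec.1.trans hc.symm)

variable (E Y P l)

/-- The matrix of `e(k)`. -/
noncomputable def matE (k : Fin n → K) : Matrix (Shape l) (Shape l) R :=
  monomialMatrix (fun t => t) fun t => E (act (minRep l t) k)

/-- The matrix of `y_a`. -/
noncomputable def matY (a : Fin n) : Matrix (Shape l) (Shape l) R :=
  monomialMatrix (fun t => t) fun t => Y (minRep l t a)

/-- The matrix of `ψ_a`. -/
noncomputable def matP (a : Fin (n - 1)) : Matrix (Shape l) (Shape l) R :=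
  monomialMatrix (shapeAct (s a)) (psiCoeff P a)

variable {E Y P l}

theorem isLabelled_act_minRep {t : Shape l} {k : Fin n → K}
    (h : IsLabelled p l (act (minRep l t) k)) (a : Fin n) : p (k a) = t.1 a := by
  have := h (minRep l t a)
  rw [tTriv_minRep] at this
  simpa [act] using this

theorem act_minRep_apply {X : Type*} {t : Shape l} {k : Fin n → X} {a b : Fin n}
    (h : b = minRep l t a) : act (minRep l t) k b = k a := by
  subst h; simp [act]

variable (h : IsKLR Q (InBlock l) E Y P) (hE : ∀ k, ¬ IsLabelled p l k → E k = 0)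
  (hp : ∀ k k', p k ≠ p k' → Q k k' = 1)

include hE in
theorem label_of_ne_zero {t : Shape l} {k : Fin n → K} {x : R}
    (h : x * E (act (minRep l t) k) ≠ 0) (a : Fin n) : p (k a) = t.1 a := by
  refine isLabelled_act_minRep ?_ a
  by_contra h1
  exact h (by rw [hE _ h1, mul_zero])

include hE in
-- Unless `t` is the tuple of labels of `k`, the idempotent in column `t` vanishes. Hence relations
-- need checking only when the labels of `k` are those of `t`.
theorem mul_eq_of_label {t : Shape l} {k : Fin n → K} {x z : R}
    (h : (∀ a, p (k a) = t.1 a) → x * E (act (minRep l t) k) = z * E (act (minRep l t) k)) :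
    x * E (act (minRep l t) k) = z * E (act (minRep l t) k) := by
  by_cases h1 : IsLabelled p l (act (minRep l t) k)
  · exact h (isLabelled_act_minRep h1)
  · rw [hE _ h1, mul_zero, mul_zero]

theorem s_comm {a b : Fin (n - 1)} (h : a.val + 1 < b.val ∨ b.val + 1 < a.val) :
    s a * s b = s b * s a := by
  refine (Equiv.Perm.Disjoint.commute ?_)
  intro x
  by_cases hx : x = lo a ∨ x = hi a
  · right
    refine s_of_ne b ?_ ?_ <;> rcases hx with rfl | rfl <;>
      simp only [lo, hi, ne_eq, Fin.ext_iff] <;> omega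
  · push Not at hx
    exact Or.inl (s_of_ne a hx.1 hx.2)

theorem s_apply_far {a b : Fin (n - 1)} (h : a.val + 1 < b.val ∨ b.val + 1 < a.val) :
    s a (lo b) = lo b ∧ s a (hi b) = hi b := by
  constructor <;> refine s_of_ne a ?_ ?_ <;> simp only [lo, hi, ne_eq, Fin.ext_iff] <;> omega

theorem braid_positions {a b : Fin (n - 1)} (h : b.val = a.val + 1) :
    lo b = hi a ∧ s a (hi b) = hi b ∧ s b (lo a) = lo a := by
  refine ⟨Fin.ext h, s_of_ne a ?_ ?_, s_of_ne b ?_ ?_⟩ <;>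
    simp only [lo, hi, ne_eq, Fin.ext_iff] <;> omega

theorem s_braid {a b : Fin (n - 1)} (h : b.val = a.val + 1) :
    s b * s a * s b = s a * s b * s a := by
  obtain ⟨h1, h2, h3⟩ := braid_positions h
  have h4 : s b * s a * (s b)⁻¹ = Equiv.swap (lo a) (hi b) := by
    have := Equiv.swap_apply_apply (s b) (lo a) (hi a)
    rw [h3, ← h1, s_lo] at this
    rw [this, h1]; rfl
  have h5 : s a * s b * (s a)⁻¹ = Equiv.swap (lo a) (hi b) := by
    have := Equiv.swap_apply_apply (s a) (lo b) (hi b)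
    rw [h2, h1, s_hi] at this
    rw [this, ← h1]; rfl
  rw [s_inv] at h4 h5
  rw [h4, h5]

include h in
-- A distant exchange changes neither the labels at `a`, `a + 1` nor their images under π, so the
-- coefficients do not move. If both are block generators, injectivity of π_t keeps their positions
-- disjoint and they commute.
theorem psiCoeff_comm {a b : Fin (n - 1)} (hab : a.val + 1 < b.val ∨ b.val + 1 < a.val)
    (t : Shape l) : psiCoeff P a (shapeAct (s b) t) * psiCoeff P b t =
      psiCoeff P b (shapeAct (s a) t) * psiCoeff P a t := by
  have key : ∀ {a b : Fin (n - 1)}, (a.val + 1 < b.val ∨ b.val + 1 < a.val) →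
      psiCoeff P a (shapeAct (s b) t) = psiCoeff P a t := by
    intro a b hab
    obtain ⟨h1, h2⟩ := s_apply_far hab.symm
    have h3 : (shapeAct (s b) t).1 (lo a) = t.1 (lo a) := by
      rw [show (shapeAct (s b) t).1 = act (s b) t.1 from rfl, act_s_apply, h1]
    have h4 : (shapeAct (s b) t).1 (hi a) = t.1 (hi a) := by
      rw [show (shapeAct (s b) t).1 = act (s b) t.1 from rfl, act_s_apply, h2]
    by_cases hb : t.1 (lo b) = t.1 (hi b)
    · rw [shapeAct_s_eq_self t hb]
    by_cases ha : t.1 (lo a) = t.1 (hi a)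
    · obtain ⟨c, hc, -, -⟩ := exists_minRep_index t ha
      rw [psiCoeff_of_eq ha hc, psiCoeff_of_eq (by rw [h3, h4, ha])]
      rw [minRep_shapeAct t hb, Equiv.Perm.mul_apply, h1, hc]
    · rw [psiCoeff_of_ne ha, psiCoeff_of_ne (by rwa [h3, h4])]
  rw [key hab, key hab.symm]
  by_cases ha : t.1 (lo a) = t.1 (hi a)
  swap
  · rw [psiCoeff_of_ne ha, one_mul, mul_one]
  by_cases hb : t.1 (lo b) = t.1 (hi b)
  swap
  · rw [psiCoeff_of_ne hb, one_mul, mul_one]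
  obtain ⟨c, hc, hc', hcB⟩ := exists_minRep_index t ha
  obtain ⟨c', hd, hd', hdB⟩ := exists_minRep_index t hb
  rw [psiCoeff_of_eq ha hc, psiCoeff_of_eq hb hd]
  refine h.psi_psi c c' hcB hdB ?_
  have inj : ∀ {x z : Fin n}, x ≠ z → minRep l t x ≠ minRep l t z := fun h1 h2 =>
    h1 ((minRep l t).injective h2)
  have h1 : lo c ≠ lo c' := by
    rw [hc, hd]; apply inj; simp only [lo, ne_eq, Fin.ext_iff]; omega
  have h2 : lo c ≠ hi c' := by
    rw [hc, hd']; apply inj; simp only [lo, hi, ne_eq, Fin.ext_iff]; omega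
  have h3 : hi c ≠ lo c' := by
    rw [hc', hd]; apply inj; simp only [lo, hi, ne_eq, Fin.ext_iff]; omega
  simp only [lo, hi, ne_eq, Fin.ext_iff] at h1 h2 h3
  omega

include h hE hp in
-- Cases on coincidences among the three labels. If all agree, this is the braid relation of a
-- block. If exactly two agree, each side has one factor other than 1, and both are the same block
-- generator. If none agree, all factors are 1. The correction term vanishes outside the first case:
-- Q = 1 if the first two labels differ, and k_a ≠ k_{a+2} if the outer ones do.
theorem psiCoeff_braid {a b : Fin (n - 1)} (hab : b.val = a.val + 1) (t : Shape l)
    (k : Fin n → K) (hk : ∀ a, p (k a) = t.1 a) [Decidable (k (lo a) = k (hi b))] :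
    psiCoeff P b (shapeAct (s a) (shapeAct (s b) t)) * psiCoeff P a (shapeAct (s b) t) *
        psiCoeff P b t * E (act (minRep l t) k) =
      (psiCoeff P a (shapeAct (s b) (shapeAct (s a) t)) * psiCoeff P b (shapeAct (s a) t) *
        psiCoeff P a t + if k (lo a) = k (hi b) then
          divDiff (Q (k (lo a)) (k (hi a))) (Y (minRep l t (lo a))) (Y (minRep l t (hi a)))
            (Y (minRep l t (hi b))) else 0) * E (act (minRep l t) k) := by
  classical
  obtain ⟨h1, h2, h3⟩ := braid_positions hab
  have ht : ∀ (c : Fin (n - 1)) (t : Shape l) (x : Fin n), (shapeAct (s c) t).1 x = t.1 (s c x) :=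
    fun c t x => act_s_apply c t.1 x
  have e1 : s a (lo a) = hi a := s_lo a
  have e2 : s a (hi a) = lo a := s_hi a
  have e3 : s b (hi a) = hi b := by rw [← h1]; exact s_lo b
  have e4 : s b (hi b) = hi a := by rw [← h1]; exact s_hi b
  have hdd : t.1 (lo a) ≠ t.1 (hi a) → divDiff (Q (k (lo a)) (k (hi a))) (Y (minRep l t (lo a)))
      (Y (minRep l t (hi a))) (Y (minRep l t (hi b))) = 0 := fun h4 => by
    rw [hp _ _ (by rwa [hk, hk]), divDiff_one]
  have hkk : t.1 (lo a) ≠ t.1 (hi b) → k (lo a) ≠ k (hi b) := fun h4 h5 => h4 (by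
    rw [← hk, ← hk, h5])
  by_cases hxy : t.1 (lo a) = t.1 (hi a)
  · by_cases hyz : t.1 (hi a) = t.1 (hi b)
    · -- all three labels agree
      have sb : shapeAct (s b) t = t := shapeAct_s_eq_self t (by rw [h1, hyz])
      have sa : shapeAct (s a) t = t := shapeAct_s_eq_self t hxy
      obtain ⟨c, hc, hc', hcB⟩ := exists_minRep_index t hxy
      obtain ⟨c', hd, hd', hdB⟩ := exists_minRep_index t (a := b) (by rw [h1, hyz])
      simp only [sa, sb]
      rw [psiCoeff_of_eq hxy hc, psiCoeff_of_eq (by rw [h1, hyz]) hd]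
      have h5 : lo c' = hi c := by rw [hd, hc', h1]
      have h4 := h.braid c c' hcB hdB (congrArg Fin.val h5 :) (act (minRep l t) k)
      have h6 : ∀ x, act (minRep l t) k (minRep l t x) = k x := fun x => act_minRep_apply rfl
      simp only [hc, hc', hd', h6] at h4
      convert h4
    · -- the first two agree
      have hxz : t.1 (lo a) ≠ t.1 (hi b) := fun h4 => hyz (hxy.symm.trans h4)
      obtain ⟨c, hc, hc', hcB⟩ := exists_minRep_index t hxy
      have sa : shapeAct (s a) t = t := shapeAct_s_eq_self t hxy
      have nb : t.1 (lo b) ≠ t.1 (hi b) := by rwa [h1]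
      have na : (shapeAct (s b) t).1 (lo a) ≠ (shapeAct (s b) t).1 (hi a) := by
        rw [ht, ht, h3, e3]; exact hxz
      rw [if_neg (hkk hxz), add_zero, sa, psiCoeff_of_ne nb, psiCoeff_of_ne na,
        psiCoeff_of_eq hxy hc, psiCoeff_of_eq (c := c)]
      · simp
      · simp only [ht, h1, h2, e2, e4, h3, hxy]
      · rw [minRep_shapeAct _ na, minRep_shapeAct _ nb, Equiv.Perm.mul_apply,
          Equiv.Perm.mul_apply, h1, e2, h3, hc]
  · rw [hdd hxy, ite_self, add_zero]
    have na : t.1 (lo a) ≠ t.1 (hi a) := hxy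
    by_cases hyz : t.1 (hi a) = t.1 (hi b)
    · -- the last two agree
      have hxz : t.1 (lo a) ≠ t.1 (hi b) := fun h4 => hxy (h4.trans hyz.symm)
      have hb : t.1 (lo b) = t.1 (hi b) := by rwa [h1]
      obtain ⟨c, hc, hc', hcB⟩ := exists_minRep_index t hb
      have sb : shapeAct (s b) t = t := shapeAct_s_eq_self t hb
      have nb : (shapeAct (s a) t).1 (lo b) ≠ (shapeAct (s a) t).1 (hi b) := by
        rw [ht, ht, h1, h2, e2]; exact hxz
      rw [sb, psiCoeff_of_ne na, psiCoeff_of_ne nb,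
        psiCoeff_of_eq hb hc, psiCoeff_of_eq (c := c)]
      · simp
      · simp only [ht, h2, e1, e3, h3, hyz]
      · rw [minRep_shapeAct _ nb, minRep_shapeAct _ na, Equiv.Perm.mul_apply,
          Equiv.Perm.mul_apply, h3, e1, hc, h1]
    · have nb : t.1 (lo b) ≠ t.1 (hi b) := by rwa [h1]
      rw [psiCoeff_of_ne na, psiCoeff_of_ne nb]
      by_cases hxz : t.1 (lo a) = t.1 (hi b)
      · -- the outer two agree
        have ha : (shapeAct (s b) t).1 (lo a) = (shapeAct (s b) t).1 (hi a) := by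
          rw [ht, ht, h3, e3]; exact hxz
        have hb : (shapeAct (s a) t).1 (lo b) = (shapeAct (s a) t).1 (hi b) := by
          rw [ht, ht, h1, h2, e2]; exact hxz
        have hb' : (shapeAct (s b) t).1 (lo b) ≠ (shapeAct (s b) t).1 (hi b) := by
          rw [ht, ht, h1, e3, e4]; exact Ne.symm hyz
        have ha' : (shapeAct (s a) t).1 (lo a) ≠ (shapeAct (s a) t).1 (hi a) := by
          rw [ht, ht, e1, e2]; exact Ne.symm hxy
        obtain ⟨c, hc, -, -⟩ := exists_minRep_index _ ha
        rw [shapeAct_s_eq_self _ ha, shapeAct_s_eq_self _ hb, psiCoeff_of_ne hb',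
          psiCoeff_of_ne ha', psiCoeff_of_eq ha hc, psiCoeff_of_eq (c := c) hb]
        rw [hc, minRep_shapeAct _ nb, minRep_shapeAct _ na, Equiv.Perm.mul_apply,
          Equiv.Perm.mul_apply, h1, e2, h3]
      · have ha : (shapeAct (s b) t).1 (lo a) ≠ (shapeAct (s b) t).1 (hi a) := by
          rw [ht, ht, h3, e3]; exact hxz
        have hb : (shapeAct (s a) t).1 (lo b) ≠ (shapeAct (s a) t).1 (hi b) := by
          rw [ht, ht, h1, h2, e2]; exact hxz
        rw [psiCoeff_of_ne ha, psiCoeff_of_ne hb, psiCoeff_of_ne, psiCoeff_of_ne]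
        · rw [ht, ht, ht, ht, h3, e1, e3, h2]; exact hyz
        · rw [ht, ht, ht, ht, h1, e2, h3, h2, e4]; exact hxy

include h hE hp in
/-- The matrices satisfy all the relations of `H_n(Q)`. -/
theorem isKLR_matrix :
    IsKLR Q (fun _ => True) (matE l E) (matY l Y) (matP l P) := by
  classical
  have hzero : ∀ σ : Shape l → Shape l,
      (0 : Matrix (Shape l) (Shape l) R) = monomialMatrix σ fun _ => 0 := by
    intro σ; ext i t; simp [monomialMatrix]
  have hy : ∀ (a : Fin (n - 1)) (t : Shape l) (b : Fin n), t.1 (lo a) ≠ t.1 (hi a) →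
      minRep l (shapeAct (s a) t) b = minRep l t (s a b) := fun a t b hne => by
    rw [minRep_shapeAct t hne, Equiv.Perm.mul_apply]
  have hlab : ∀ (t : Shape l) (a : Fin (n - 1)) (k : Fin n → K), (∀ a, p (k a) = t.1 a) →
      k (lo a) = k (hi a) → t.1 (lo a) = t.1 (hi a) := fun t a k hk hka => by
    rw [← hk, ← hk, hka]
  constructor
  · have h1 : ∀ k, matE l E k = Matrix.diagonal fun t => E (act (minRep l t) k) :=
      fun k => monomialMatrix_id _
    simp only [h1]
    have h2 : ∀ t : Shape l, ∑ k, E (act (minRep l t) k) = 1 := fun t => by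
      rw [← h.sum_e]
      refine Function.Bijective.sum_comp ⟨act_injective _, fun k => ⟨act (minRep l t)⁻¹ k, ?_⟩⟩ E
      rw [← act_mul, mul_inv_cancel, act_one]
    ext i t
    rw [Matrix.sum_apply]
    by_cases hit : i = t
    · subst hit; simp [h2]
    · simp [hit]
  · intro k
    simp only [matE, monomialMatrix_mul, h.e_mul_self]
  · intro k k' hk
    rw [hzero fun t => t]
    simp only [matE, monomialMatrix_mul]
    exact monomialMatrix_congr
      (fun t => h.e_mul_ne _ _ fun h1 => hk (act_injective _ h1)) fun _ _ => rfl
  · intro a k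
    simp only [matE, matY, monomialMatrix_mul, h.y_e]
  · intro a _ k
    simp only [matE, matP, monomialMatrix_mul]
    refine monomialMatrix_congr (fun t => ?_) fun _ _ => rfl
    by_cases ht : t.1 (lo a) = t.1 (hi a)
    · obtain ⟨c, hc, hc', hcB⟩ := exists_minRep_index t ht
      rw [psiCoeff_of_eq ht hc, h.psi_e c hcB, shapeAct_s_eq_self t ht, ← act_mul, ← act_mul,
        minRep_mul_s hc hc']
    · rw [psiCoeff_of_ne ht, one_mul, mul_one, minRep_shapeAct t ht, act_mul, act_s_act_s]
  · intro a b
    simp only [matY, monomialMatrix_mul]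
    exact monomialMatrix_congr (fun t => h.y_y _ _) fun _ _ => rfl
  · intro a _ b hb hb'
    simp only [matY, matP, monomialMatrix_mul]
    refine monomialMatrix_congr (fun t => ?_) fun _ _ => rfl
    by_cases ht : t.1 (lo a) = t.1 (hi a)
    · obtain ⟨c, hc, hc', hcB⟩ := exists_minRep_index t ht
      rw [psiCoeff_of_eq ht hc, shapeAct_s_eq_self t ht]
      refine h.psi_y c hcB _ ?_ ?_
      · rw [hc]; exact fun h1 => hb ((minRep l t).injective h1)
      · rw [hc']; exact fun h1 => hb' ((minRep l t).injective h1)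
    · rw [psiCoeff_of_ne ht, one_mul, mul_one, hy a t b ht, s_of_ne a hb hb']
  · intro a b _ _ hab
    simp only [matP, monomialMatrix_mul]
    refine monomialMatrix_congr (fun t => psiCoeff_comm h hab t) fun t _ => ?_
    rw [← shapeAct_mul, ← shapeAct_mul, s_comm hab]
  · intro a _ k
    -- The delta term is diagonal, but a column where it is nonzero is fixed by `s a`, so it can be
    -- written with the row map of ψ_a.
    have key : (if k (lo a) = k (hi a) then 1 else 0) * matE l E k =
        monomialMatrix (shapeAct (s a)) fun t =>
          (if k (lo a) = k (hi a) then 1 else 0) * E (act (minRep l t) k) := by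
      split_ifs with hk
      · rw [one_mul]
        refine monomialMatrix_congr (fun t => (one_mul _).symm) fun t ht => ?_
        rw [shapeAct_s_eq_self t]
        have ht' := label_of_ne_zero hE (x := 1) (by rwa [one_mul])
        exact hlab t a k ht' hk
      · rw [zero_mul, hzero (shapeAct (s a))]; simp
    rw [add_mul, key]
    simp only [matE, matY, matP, monomialMatrix_mul, monomialMatrix_add, ← add_mul]
    refine monomialMatrix_congr (fun t => mul_eq_of_label hE fun hk => ?_) fun _ _ => rfl
    by_cases ht : t.1 (lo a) = t.1 (hi a)
    · obtain ⟨c, hc, hc', hcB⟩ := exists_minRep_index t ht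
      have h1 := h.psi_y_hi c hcB (act (minRep l t) k)
      rw [act_minRep_apply hc, act_minRep_apply hc', hc, hc'] at h1
      rw [psiCoeff_of_eq ht hc, shapeAct_s_eq_self t ht, h1]
    · rw [psiCoeff_of_ne ht, hy a t _ ht, s_lo, if_neg fun h1 => ht (hlab t a k hk h1)]
      simp
  · intro a _ k
    have key : (if k (lo a) = k (hi a) then 1 else 0) * matE l E k =
        monomialMatrix (shapeAct (s a)) fun t =>
          (if k (lo a) = k (hi a) then 1 else 0) * E (act (minRep l t) k) := by
      split_ifs with hk
      · rw [one_mul]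
        refine monomialMatrix_congr (fun t => (one_mul _).symm) fun t ht => ?_
        rw [shapeAct_s_eq_self t]
        have ht' := label_of_ne_zero hE (x := 1) (by rwa [one_mul])
        exact hlab t a k ht' hk
      · rw [zero_mul, hzero (shapeAct (s a))]; simp
    rw [add_mul, key]
    simp only [matE, matY, matP, monomialMatrix_mul, monomialMatrix_add, ← add_mul]
    refine monomialMatrix_congr (fun t => mul_eq_of_label hE fun hk => ?_) fun _ _ => rfl
    by_cases ht : t.1 (lo a) = t.1 (hi a)
    · obtain ⟨c, hc, hc', hcB⟩ := exists_minRep_index t ht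
      have h1 := h.y_hi_psi c hcB (act (minRep l t) k)
      rw [act_minRep_apply hc, act_minRep_apply hc', hc, hc'] at h1
      rw [psiCoeff_of_eq ht hc, shapeAct_s_eq_self t ht, h1]
    · rw [psiCoeff_of_ne ht, hy a t _ ht, s_hi, if_neg fun h1 => ht (hlab t a k hk h1)]
      simp
  · intro a _ k
    simp only [matE, matY, matP]
    rw [monomialMatrix_id fun t => Y (minRep l t (lo a)),
      monomialMatrix_id fun t => Y (minRep l t (hi a)), evalAt_diagonal, ← monomialMatrix_id]
    simp only [monomialMatrix_mul]
    refine monomialMatrix_congr (fun t => mul_eq_of_label hE fun hk => ?_)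
      fun t _ => shapeAct_s_s t a
    by_cases ht : t.1 (lo a) = t.1 (hi a)
    · obtain ⟨c, hc, hc', hcB⟩ := exists_minRep_index t ht
      have h1 := h.psi_sq c hcB (act (minRep l t) k)
      rw [act_minRep_apply hc, act_minRep_apply hc', hc, hc'] at h1
      rw [shapeAct_s_eq_self t ht, psiCoeff_of_eq ht hc, h1]
    · rw [psiCoeff_of_ne ht, psiCoeff_of_ne, hp _ _ (by rwa [hk, hk]), evalAt_one, one_mul]
      simp only [shapeAct, act_s_lo, act_s_hi]
      exact Ne.symm ht
  · intro a b _ _ hab k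
    -- Likewise, the divided difference survives only in columns with three equal labels, which all
    -- the exchanges fix.
    have key : (if k (lo a) = k (hi b) then divDiff (Q (k (lo a)) (k (hi a)))
          (matY l Y (lo a)) (matY l Y (hi a)) (matY l Y (hi b)) else 0) * matE l E k =
        monomialMatrix (fun t => shapeAct (s a) (shapeAct (s b) (shapeAct (s a) t))) fun t =>
          (if k (lo a) = k (hi b) then divDiff (Q (k (lo a)) (k (hi a)))
            (Y (minRep l t (lo a))) (Y (minRep l t (hi a))) (Y (minRep l t (hi b))) else 0) *
              E (act (minRep l t) k) := by
      split_ifs with hk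
      · simp only [matE, matY]
        rw [monomialMatrix_id fun t => Y (minRep l t (lo a)),
          monomialMatrix_id fun t => Y (minRep l t (hi a)),
          monomialMatrix_id fun t => Y (minRep l t (hi b)), divDiff_diagonal,
          ← monomialMatrix_id, monomialMatrix_mul]
        refine monomialMatrix_congr (fun t => rfl) fun t ht => ?_
        have ht' := label_of_ne_zero hE ht
        have hxz : t.1 (lo a) = t.1 (hi b) := by rw [← ht', ← ht', hk]
        have hxy : t.1 (lo a) = t.1 (hi a) := by
          by_contra h1
          refine ht ?_
          rw [hp _ _ (by rwa [ht', ht']), divDiff_one, zero_mul]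
        rw [shapeAct_s_eq_self t hxy, shapeAct_s_eq_self t, shapeAct_s_eq_self t hxy]
        rw [(braid_positions hab).1, ← hxy, hxz]
      · rw [zero_mul, hzero fun t => shapeAct (s a) (shapeAct (s b) (shapeAct (s a) t))]
        exact monomialMatrix_congr (fun _ => (zero_mul _).symm) fun _ h1 => absurd rfl h1
    rw [add_mul, key]
    simp only [matE, matP, monomialMatrix_mul, monomialMatrix_add, ← add_mul]
    refine monomialMatrix_congr (fun t => mul_eq_of_label hE fun hk => ?_) fun t _ => ?_
    · exact psiCoeff_braid h hE hp hab t k hk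
    · simp only [← shapeAct_mul]
      rw [← mul_assoc, ← mul_assoc, s_braid hab]

end MatrixRep

/-! ### Corners -/

section Corner

variable {A R : Type*} [CommRing A] [Ring R] [Algebra A R] {u : R} (hu : IsIdempotentElem u)

noncomputable instance cornerAlgebra : Algebra A hu.Corner where
  smul r x := ⟨r • x.1, by
    have h := (Subsemigroup.mem_corner_iff hu).1 x.2
    exact (Subsemigroup.mem_corner_iff hu).2
      ⟨by rw [mul_smul_comm, h.1], by rw [smul_mul_assoc, h.2]⟩⟩
  algebraMap :=
    { toFun := fun r => ⟨r • u, (Subsemigroup.mem_corner_iff hu).2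
        ⟨by rw [mul_smul_comm, hu.eq], by rw [smul_mul_assoc, hu.eq]⟩⟩
      map_one' := Subtype.ext (one_smul A u)
      map_mul' := fun r r' => Subtype.ext (by
        change (r * r') • u = (r • u) * (r' • u)
        rw [smul_mul_smul_comm, hu.eq])
      map_zero' := Subtype.ext (zero_smul A u)
      map_add' := fun r r' => Subtype.ext (add_smul r r' u) }
  commutes' r x := Subtype.ext (by
    have h := (Subsemigroup.mem_corner_iff hu).1 x.2
    change (r • u) * x.1 = x.1 * (r • u)
    rw [smul_mul_assoc, mul_smul_comm, h.1, h.2])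
  smul_def' r x := Subtype.ext (by
    have h := (Subsemigroup.mem_corner_iff hu).1 x.2
    change r • x.1 = (r • u) * x.1
    rw [smul_mul_assoc, h.1])

/-- The projection of the centralizer of an idempotent onto the corner. -/
noncomputable def cornerProj : Subalgebra.centralizer A {u} →ₐ[A] hu.Corner where
  toFun x := ⟨x.1 * u, by
    have h : u * x.1 = x.1 * u := (Subalgebra.mem_centralizer_iff A).1 x.2 u rfl
    exact (Subsemigroup.mem_corner_iff hu).2
      ⟨by rw [← mul_assoc, h, mul_assoc, hu.eq], by rw [mul_assoc, hu.eq]⟩⟩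
  map_one' := Subtype.ext (one_mul u)
  map_mul' x z := Subtype.ext (by
    have h : u * z.1 = z.1 * u := (Subalgebra.mem_centralizer_iff A).1 z.2 u rfl
    change x.1 * z.1 * u = (x.1 * u) * (z.1 * u)
    rw [mul_assoc x.1 u, ← mul_assoc u, h, mul_assoc z.1, hu.eq, mul_assoc])
  map_zero' := Subtype.ext (zero_mul u)
  map_add' x z := Subtype.ext (add_mul x.1 z.1 u)
  commutes' r := Subtype.ext (by
    change algebraMap A R r * u = r • u
    rw [Algebra.smul_def])

/-- The inclusion of the corner. -/
noncomputable def cornerIncl : hu.Corner →ₙₐ[A] R where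
  toFun x := x.1
  map_smul' _ _ := rfl
  map_zero' := rfl
  map_add' _ _ := rfl
  map_mul' _ _ := rfl

end Corner

/-! ### The embedding of H_λ(Q) as a corner -/

section Embedding

variable {K : Type*} [Fintype K] {A : Type*} [CommRing A] {d n : ℕ}
  (Q : K → K → MvPolynomial (Fin 2) A) (p : K → Fin d) (l : Comp d n)

variable {Q p l} in
open scoped Classical in
theorem eLabel_mul_e (t : Fin n → Fin d) (k : Fin n → K) :
    eLabel Q p t * e Q k = if ∀ a, p (k a) = t a then e Q k else 0 := by
  have h := (isKLR_hecke Q n).sum_filter_mul_e (fun k => ∀ a, p (k a) = t a) k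
  rw [eLabel]
  convert h

theorem eLabel_mul_self (t : Fin n → Fin d) :
    eLabel Q p t * eLabel Q p t = eLabel Q p t := by
  classical
  refine (isKLR_hecke Q n).ext_e fun k => ?_
  rw [mul_assoc, eLabel_mul_e]
  split_ifs with h
  · rw [eLabel_mul_e, if_pos h]
  · rw [mul_zero]

theorem sum_eLabel : ∑ t : Fin n → Fin d, eLabel Q p t = 1 := by
  classical
  refine (isKLR_hecke Q n).ext_e fun k => ?_
  rw [Finset.sum_mul, one_mul]
  simp only [eLabel_mul_e]
  rw [Finset.sum_eq_single fun a => p (k a)]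
  · exact if_pos fun _ => rfl
  · exact fun t _ ht => if_neg fun h => ht (funext fun a => (h a).symm)
  · simp

theorem eLabel_commute_e (t : Fin n → Fin d) (k : Fin n → K) :
    Commute (eLabel Q p t) (e Q k) := by
  refine Commute.sum_left _ _ _ fun k' _ => ?_
  by_cases h : k' = k
  · rw [h]
  · exact ((isKLR_hecke Q n).e_mul_ne _ _ h).trans
      ((isKLR_hecke Q n).e_mul_ne _ _ (Ne.symm h)).symm

theorem eLabel_commute_y (t : Fin n → Fin d) (a : Fin n) : Commute (eLabel Q p t) (y Q a) :=
  Commute.sum_left _ _ _ fun k' _ => ((isKLR_hecke Q n).y_e a k').symm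

theorem psi_mul_eLabel (t : Fin n → Fin d) (a : Fin (n - 1)) :
    psi Q a * eLabel Q p t = eLabel Q p (act (s a) t) * psi Q a := by
  classical
  refine (isKLR_hecke Q n).ext_e fun k => ?_
  rw [mul_assoc, mul_assoc, eLabel_mul_e, (isKLR_hecke Q n).psi_e a trivial, ← mul_assoc,
    eLabel_mul_e]
  have h : (∀ b, p (act (s a) k b) = act (s a) t b) ↔ ∀ b, p (k b) = t b := by
    simp only [act_s_apply]
    exact ⟨fun h b => by simpa using h (s a b), fun h b => h _⟩
  simp only [h]
  split_ifs
  · rw [(isKLR_hecke Q n).psi_e a trivial]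
  · simp

theorem act_s_tTriv {c : Fin (n - 1)} (hc : InBlock l c) : act (s c) (tTriv l) = tTriv l :=
  act_s_eq_self (inBlock_iff.1 hc)

theorem isIdempotentElem_eLabel (t : Fin n → Fin d) : IsIdempotentElem (eLabel Q p t) :=
  eLabel_mul_self Q p t

/-- The corner of `H_n(Q)` at `e(t^l)` satisfies those relations of `H_n(Q)` that stay within the
blocks. -/
theorem exists_isKLR_corner :
    ∃ (E : (Fin n → K) → (isIdempotentElem_eLabel Q p (tTriv l)).Corner)
      (Y : Fin n → (isIdempotentElem_eLabel Q p (tTriv l)).Corner)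
      (P : Fin (n - 1) → (isIdempotentElem_eLabel Q p (tTriv l)).Corner),
      IsKLR Q (InBlock l) E Y P ∧ (∀ k, (E k).1 = e Q k * eLabel Q p (tTriv l)) ∧
      (∀ c, (Y c).1 = y Q c * eLabel Q p (tTriv l)) ∧
      ∀ c, InBlock l c → (P c).1 = psi Q c * eLabel Q p (tTriv l) := by
  classical
  set u := eLabel Q p (tTriv l) with hu
  have hmem : ∀ x : Hecke Q n, Commute u x → x ∈ Subalgebra.centralizer A {u} := by
    intro x hx
    rw [Subalgebra.mem_centralizer_iff]
    rintro _ rfl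
    exact hx.eq
  have hP : ∀ c, InBlock l c → Commute u (psi Q c) := fun c hc => by
    have := psi_mul_eLabel Q p (tTriv l) c
    rw [act_s_tTriv l hc] at this
    exact this.symm
  -- For `c` inside a block, `s c` fixes t^λ and ψ_c commutes with `u`. The relations therefore hold
  -- in the centralizer of `u`, from which multiplication by `u` is a morphism to the corner.
  have h : IsKLR Q (InBlock l) (R := Subalgebra.centralizer A {u})
      (fun k => ⟨e Q k, hmem _ (eLabel_commute_e Q p _ k)⟩)
      (fun c => ⟨y Q c, hmem _ (eLabel_commute_y Q p _ c)⟩)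
      (fun c => if hc : InBlock l c then ⟨psi Q c, hmem _ (hP c hc)⟩ else 0) := by
    refine IsKLR.of_injective (f := (Subalgebra.centralizer A {u}).val) Subtype.val_injective
      ((isKLR_hecke Q n).mono fun _ _ => trivial) (fun _ => rfl) (fun _ => rfl) fun c hc => ?_
    rw [dif_pos hc]; rfl
  refine ⟨_, _, _, h.map (cornerProj (isIdempotentElem_eLabel Q p (tTriv l))), fun _ => rfl,
    fun _ => rfl, fun c hc => ?_⟩
  rw [dif_pos hc]; rfl

/-- The embedding of the tensor product as the corner at `e(t^l)`, on generators. -/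
theorem exists_blockHom : ∃ i : HeckeTensor Q p l →ₙₐ[A] Hecke Q n,
    i 1 = eLabel Q p (tTriv l) ∧ (∀ k, i (tE Q p l k) = e Q k * eLabel Q p (tTriv l)) ∧
    (∀ c, i (tY Q p l c) = y Q c * eLabel Q p (tTriv l)) ∧
    ∀ c, InBlock l c → i (tP Q p l c) = psi Q c * eLabel Q p (tTriv l) := by
  classical
  obtain ⟨E, Y, P, h, hE, hY, hP⟩ := exists_isKLR_corner Q p l
  have hE0 : ∀ k, ¬ IsLabelled p l k → E k = 0 := fun k hk => Subtype.ext <|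
    ((hE k).trans (eLabel_commute_e Q p _ k).eq.symm).trans
      ((eLabel_mul_e (tTriv l) k).trans (if_neg hk))
  refine ⟨(cornerIncl (A := A) (isIdempotentElem_eLabel Q p (tTriv l))).comp
    (h.tensorLift hE0 : HeckeTensor Q p l →ₙₐ[A] _), ?_, fun k => ?_, fun c => ?_, fun c hc => ?_⟩
  · change (h.tensorLift hE0 1).1 = _
    rw [map_one]; rfl
  · change (h.tensorLift hE0 _).1 = _
    rw [h.tensorLift_tE hE0, hE]
  · change (h.tensorLift hE0 _).1 = _
    rw [h.tensorLift_tY hE0, hY]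
  · change (h.tensorLift hE0 _).1 = _
    rw [h.tensorLift_tP hE0 hc, hP c hc]

/-- The embedding of the tensor product as the corner at `e(t^l)`. -/
noncomputable def blockHom : HeckeTensor Q p l →ₙₐ[A] Hecke Q n := (exists_blockHom Q p l).choose

theorem blockHom_one : blockHom Q p l 1 = eLabel Q p (tTriv l) :=
  (exists_blockHom Q p l).choose_spec.1

theorem blockHom_tE (k : Fin n → K) :
    blockHom Q p l (tE Q p l k) = e Q k * eLabel Q p (tTriv l) :=
  (exists_blockHom Q p l).choose_spec.2.1 k

theorem blockHom_tY (c : Fin n) : blockHom Q p l (tY Q p l c) = y Q c * eLabel Q p (tTriv l) :=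
  (exists_blockHom Q p l).choose_spec.2.2.1 c

theorem blockHom_tP {c : Fin (n - 1)} (hc : InBlock l c) :
    blockHom Q p l (tP Q p l c) = psi Q c * eLabel Q p (tTriv l) :=
  (exists_blockHom Q p l).choose_spec.2.2.2 c hc

theorem eLabel_mul_blockHom (x : HeckeTensor Q p l) :
    eLabel Q p (tTriv l) * blockHom Q p l x = blockHom Q p l x := by
  rw [← blockHom_one, ← map_mul, one_mul]

theorem blockHom_mul_eLabel (x : HeckeTensor Q p l) :
    blockHom Q p l x * eLabel Q p (tTriv l) = blockHom Q p l x := by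
  rw [← blockHom_one, ← map_mul, mul_one]

end Embedding

/-! ### The components of Ψ and their values on the corners -/

section ToMatrix

variable {K : Type*} [Fintype K] {A : Type*} [CommRing A] {d n : ℕ}
  {Q : K → K → MvPolynomial (Fin 2) A} {p : K → Fin d}
  (hp : ∀ k k', p k ≠ p k' → Q k k' = 1) (l l' : Comp d n)

/-- The component of `Ψ` at `l`. -/
noncomputable def toMatrix :
    Hecke Q n →ₐ[A] Matrix (Shape l) (Shape l) (HeckeTensor Q p l) :=
  (isKLR_matrix (isKLR_tensor Q p l) (fun _ hk => tE_of_not hk) hp).lift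

theorem toMatrix_e (k : Fin n → K) : toMatrix hp l (e Q k) = matE l (tE Q p l) k :=
  IsKLR.lift_e _ k

theorem toMatrix_y (a : Fin n) : toMatrix hp l (y Q a) = matY l (tY Q p l) a :=
  IsKLR.lift_y _ a

theorem toMatrix_psi (a : Fin (n - 1)) : toMatrix hp l (psi Q a) = matP l (tP Q p l) a :=
  IsKLR.lift_psi _ a

/-- In column `t'` only tuples labelled `t'` contribute: none of them occurs if `t' ≠ t`, and all of
them occur, with sum 1, if `t' = t`. -/
theorem toMatrix_eLabel (t : Fin n → Fin d) :
    toMatrix hp l (eLabel Q p t) = Matrix.diagonal fun t' => if t'.1 = t then 1 else 0 := by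
  classical
  have key : ∀ t' : Shape l, (∑ k ∈ Finset.univ.filter (fun k : Fin n → K => ∀ a, p (k a) = t a),
      tE Q p l (act (minRep l t') k)) = if t'.1 = t then 1 else 0 := by
    intro t'
    split_ifs with h
    · subst h
      have h2 : ∑ k, tE Q p l (act (minRep l t') k) = 1 := by
        rw [← sum_tE]
        refine Function.Bijective.sum_comp
          ⟨act_injective _, fun k => ⟨act (minRep l t')⁻¹ k, ?_⟩⟩ (tE Q p l)
        rw [← act_mul, mul_inv_cancel, act_one]
      rw [← h2]
      refine Finset.sum_subset (Finset.filter_subset _ _) fun k _ hk => tE_of_not fun h => hk ?_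
      exact Finset.mem_filter.2 ⟨Finset.mem_univ _, isLabelled_act_minRep h⟩
    · refine Finset.sum_eq_zero fun k hk => tE_of_not fun h1 => h (funext fun a => ?_)
      rw [← isLabelled_act_minRep h1 a, (Finset.mem_filter.1 hk).2 a]
  rw [eLabel, map_sum]
  simp only [toMatrix_e, matE, monomialMatrix_id]
  ext i j
  rw [Matrix.sum_apply]
  by_cases hij : i = j
  · subst hij; simp only [Matrix.diagonal_apply_eq]; exact key i
  · simp [hij]

theorem diagonal_eq_single (t : Shape l) {R : Type*} [Ring R] :
    (Matrix.diagonal fun t' : Shape l => if t'.1 = t.1 then (1 : R) else 0) =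
      Matrix.single t t 1 := by
  ext i j
  by_cases hij : i = j
  · subst hij
    by_cases h : i = t
    · subst h; simp
    · have h1 : i.1 ≠ t.1 := fun h' => h (Subtype.ext h')
      simp [h1, Ne.symm h]
  · rw [Matrix.diagonal_apply_ne _ hij, Matrix.single_apply, if_neg]
    rintro ⟨rfl, rfl⟩; exact hij rfl

theorem toMatrix_eLabel_shape (t : Shape l) :
    toMatrix hp l (eLabel Q p t.1) = Matrix.single t t 1 := by
  rw [toMatrix_eLabel, diagonal_eq_single]

theorem shape_ne {l l' : Comp d n} (h : l ≠ l') (t : Shape l) (t' : Shape l') : t.1 ≠ t'.1 := by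
  intro h1
  refine h (Subtype.ext (funext fun j => ?_))
  rw [← t.2 j, ← t'.2 j, h1]

theorem toMatrix_eLabel_of_ne {l l' : Comp d n} (h : l ≠ l') (t : Shape l) :
    toMatrix hp l' (eLabel Q p t.1) = 0 := by
  rw [toMatrix_eLabel]
  have : (fun t' : Shape l' => if t'.1 = t.1 then (1 : HeckeTensor Q p l') else 0) = 0 :=
    funext fun t' => if_neg fun h1 => shape_ne h t t' h1.symm
  rw [this, Matrix.diagonal_zero']

theorem toMatrix_blockHom_of_ne {l l' : Comp d n} (h : l ≠ l') (x : HeckeTensor Q p l) :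
    toMatrix hp l' (blockHom Q p l x) = 0 := by
  rw [← eLabel_mul_blockHom, map_mul, show tTriv l = (shapeTriv l).1 from rfl,
    toMatrix_eLabel_of_ne hp h, zero_mul]

/-- Since ι_λ(x) is fixed by e(t^λ) on both sides, its matrix is concentrated at one place. The
entry there is an algebra endomorphism of H_λ(Q) which fixes the generators, because π_{t^λ} = 1. -/
theorem toMatrix_blockHom (x : HeckeTensor Q p l) :
    toMatrix hp l (blockHom Q p l x) = Matrix.single (shapeTriv l) (shapeTriv l) x := by
  have hu := toMatrix_eLabel_shape hp l (shapeTriv l)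
  have h1 : ∀ x, toMatrix hp l (blockHom Q p l x) = Matrix.single (shapeTriv l) (shapeTriv l)
      (toMatrix hp l (blockHom Q p l x) (shapeTriv l) (shapeTriv l)) := by
    intro x
    conv_lhs => rw [← eLabel_mul_blockHom, ← blockHom_mul_eLabel, map_mul, map_mul,
      show tTriv l = (shapeTriv l).1 from rfl, hu, ← mul_assoc, Matrix.single_mul_mul_single]
    simp
  let f : HeckeTensor Q p l →ₐ[A] HeckeTensor Q p l := AlgHom.ofLinearMap
    { toFun := fun x => toMatrix hp l (blockHom Q p l x) (shapeTriv l) (shapeTriv l)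
      map_add' := fun x z => by rw [map_add, map_add]; rfl
      map_smul' := fun r x => by rw [map_smul, map_smul]; rfl }
    (by
      change toMatrix hp l (blockHom Q p l 1) (shapeTriv l) (shapeTriv l) = 1
      rw [blockHom_one, show tTriv l = (shapeTriv l).1 from rfl, hu, Matrix.single_apply_same])
    (fun x z => by
      change toMatrix hp l (blockHom Q p l (x * z)) (shapeTriv l) (shapeTriv l) = _
      rw [map_mul, map_mul, h1 x, h1 z, Matrix.single_mul_single_same, Matrix.single_apply_same]
      rfl)
  have hf : f = AlgHom.id A _ := by
    have hff : ∀ x, f x = toMatrix hp l (blockHom Q p l x) (shapeTriv l) (shapeTriv l) :=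
      fun _ => rfl
    refine heckeTensor_algHom_ext' (fun k => ?_) (fun c => ?_) fun c hc => ?_
    · rw [hff, blockHom_tE, map_mul, toMatrix_e, show tTriv l = (shapeTriv l).1 from rfl, hu, matE,
        monomialMatrix_mul_single, minRep_shapeTriv, Matrix.single_apply_same]
      simp
    · rw [hff, blockHom_tY, map_mul, toMatrix_y, show tTriv l = (shapeTriv l).1 from rfl, hu, matY,
        monomialMatrix_mul_single, minRep_shapeTriv, Matrix.single_apply_same]
      simp
    · have h2 := inBlock_iff.1 hc
      rw [hff, blockHom_tP _ _ _ hc, map_mul, toMatrix_psi,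
        show tTriv l = (shapeTriv l).1 from rfl, hu, matP, monomialMatrix_mul_single,
        shapeAct_s_eq_self (shapeTriv l) h2, Matrix.single_apply_same,
        psiCoeff_of_eq (c := c) h2 (by rw [minRep_shapeTriv]; rfl)]
      simp
  rw [h1]
  congr 1
  exact DFunLike.congr_fun hf x

end ToMatrix

/-! ### Sorting words -/

section SortPath

variable {d n : ℕ} {l : Comp d n}

/-- `v` is a word that sorts the tuple `t` by exchanging, one after the other, neighbouring
entries that are in the wrong order. -/
inductive SortPath (l : Comp d n) : List (Fin (n - 1)) → Shape l → Prop
  | nil : SortPath l [] (shapeTriv l)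
  | cons {a : Fin (n - 1)} {v : List (Fin (n - 1))} {t : Shape l} (h : t.1 (hi a) < t.1 (lo a))
      (hv : SortPath l v (shapeAct (s a) t)) : SortPath l (a :: v) t

theorem shapeAct_s_apply (a : Fin (n - 1)) (t : Shape l) (c : Fin n) :
    (shapeAct (s a) t).1 c = t.1 (s a c) := act_s_apply a t.1 c

/-- A quantity that decreases when two neighbouring entries in the wrong order are exchanged. -/
def disorder (t : Shape l) : ℕ := ∑ c : Fin n, (n - c.val) * (t.1 c).val

/-- The exchange moves the larger label to the position whose weight is smaller by one. -/
theorem disorder_lt {t : Shape l} {a : Fin (n - 1)} (h : t.1 (hi a) < t.1 (lo a)) :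
    disorder (shapeAct (s a) t) < disorder t := by
  have key : ∀ f : Fin n → ℕ, ∑ c, f c =
      f (lo a) + (f (hi a) + ∑ c ∈ (Finset.univ.erase (lo a)).erase (hi a), f c) := fun f => by
    rw [Finset.add_sum_erase _ _ (Finset.mem_erase.2 ⟨(lo_ne_hi a).symm, Finset.mem_univ _⟩),
      Finset.add_sum_erase _ _ (Finset.mem_univ _)]
  rw [disorder, disorder, key, key]
  have h1 : ∑ c ∈ (Finset.univ.erase (lo a)).erase (hi a),
      (n - c.val) * ((shapeAct (s a) t).1 c).val =
      ∑ c ∈ (Finset.univ.erase (lo a)).erase (hi a), (n - c.val) * (t.1 c).val := by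
    refine Finset.sum_congr rfl fun c hc => ?_
    rw [shapeAct_s_apply, s_of_ne a]
    · exact fun h => by simp [h] at hc
    · exact fun h => by simp [h] at hc
  rw [h1, shapeAct_s_apply, shapeAct_s_apply, s_lo, s_hi]
  have h2 : n - (lo a).val = (n - (hi a).val) + 1 := by
    have := (hi a).2
    simp only [lo, hi] at this ⊢
    omega
  rw [h2]
  have h3 : (t.1 (hi a)).val < (t.1 (lo a)).val := h
  nlinarith

/-- Both tuples are monotone rearrangements of t^λ, and such a rearrangement is unique. -/
theorem eq_shapeTriv {t : Shape l} (h : ∀ a : Fin (n - 1), t.1 (lo a) ≤ t.1 (hi a)) :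
    t = shapeTriv l := by
  have h1 : Monotone t.1 := by
    cases n with
    | zero => exact fun a => a.elim0
    | succ m => exact Fin.monotone_iff_le_succ.2 fun i => h i
  have h2 : t.1 = tTriv l ∘ minRep l t := funext fun a => (tTriv_minRep t a).symm
  refine Subtype.ext ?_
  rw [h2] at h1 ⊢
  exact Tuple.unique_monotone (τ := 1) h1 (monotone_tTriv l)

theorem exists_descent {t : Shape l} (h : t ≠ shapeTriv l) :
    ∃ a : Fin (n - 1), t.1 (hi a) < t.1 (lo a) := by
  by_contra! h1
  exact h (eq_shapeTriv h1)

/-- Induction on the number of exchanges needed to sort a tuple. -/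
theorem shape_induction {motive : Shape l → Prop} (triv : motive (shapeTriv l))
    (step : ∀ t a, t.1 (hi a) < t.1 (lo a) →
      (∀ t', disorder t' < disorder t → motive t') → motive t) (t : Shape l) : motive t := by
  induction ht : disorder t using Nat.strong_induction_on generalizing t with
  | _ N ih =>
    by_cases h : t = shapeTriv l
    · rw [h]; exact triv
    · obtain ⟨a, ha⟩ := exists_descent h
      exact step t a ha fun t' ht' => ih _ (ht ▸ ht') t' rfl

theorem exists_sortPath (t : Shape l) : ∃ v, SortPath l v t := by
  induction t using shape_induction with
  | triv => exact ⟨[], .nil⟩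
  | step t a ha ih =>
    obtain ⟨v, hv⟩ := ih _ (disorder_lt ha)
    exact ⟨a :: v, .cons ha hv⟩

end SortPath

/-! ### Intertwining elements -/

section Intertwiners

variable {K : Type*} [Fintype K] {A : Type*} [CommRing A] {d n : ℕ}
  {Q : K → K → MvPolynomial (Fin 2) A} {p : K → Fin d}

theorem mul_eLabel_eq {x z : Hecke Q n} {t : Fin n → Fin d}
    (h : ∀ k, (∀ a, p (k a) = t a) → x * e Q k = z * e Q k) :
    x * eLabel Q p t = z * eLabel Q p t := by
  classical
  refine (isKLR_hecke Q n).ext_e fun k => ?_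
  rw [mul_assoc, mul_assoc, eLabel_mul_e]
  split_ifs with hk
  · exact h k hk
  · rw [mul_zero, mul_zero]

theorem braid_mul_eLabel {t : Fin n → Fin d} {a b : Fin (n - 1)} (hab : b.val = a.val + 1)
    (h : t (lo a) ≠ t (hi b)) : psi Q b * psi Q a * psi Q b * eLabel Q p t =
      psi Q a * psi Q b * psi Q a * eLabel Q p t := by
  classical
  refine mul_eLabel_eq fun k hk => ?_
  rw [(isKLR_hecke Q n).braid a b trivial trivial hab, if_neg, add_zero]
  exact fun h1 => h (by rw [← hk, ← hk, h1])

theorem y_mul_psi_mul_eLabel {t : Fin n → Fin d} {a : Fin (n - 1)} (h : t (lo a) ≠ t (hi a))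
    (c : Fin n) : y Q c * psi Q a * eLabel Q p t = psi Q a * y Q (s a c) * eLabel Q p t := by
  classical
  have hne : ∀ k : Fin n → K, (∀ a, p (k a) = t a) → k (lo a) ≠ k (hi a) := fun k hk h1 =>
    h (by rw [← hk, ← hk, h1])
  by_cases h1 : c = lo a
  · subst h1
    rw [s_lo]
    refine mul_eLabel_eq fun k hk => ?_
    rw [(isKLR_hecke Q n).psi_y_hi a trivial, if_neg (hne k hk), add_zero]
  by_cases h2 : c = hi a
  · subst h2
    rw [s_hi]
    refine mul_eLabel_eq fun k hk => ?_
    rw [(isKLR_hecke Q n).y_hi_psi a trivial, if_neg (hne k hk), add_zero]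
  rw [s_of_ne a h1 h2, (isKLR_hecke Q n).psi_y a trivial c h1 h2]

variable (hp : ∀ k k', p k ≠ p k' → Q k k' = 1)

include hp in
theorem psi_sq_mul_eLabel {t : Fin n → Fin d} {a : Fin (n - 1)} (h : t (lo a) ≠ t (hi a)) :
    psi Q a * psi Q a * eLabel Q p t = eLabel Q p t := by
  rw [← one_mul (eLabel Q p t), ← mul_assoc, mul_one]
  refine mul_eLabel_eq fun k hk => ?_
  rw [(isKLR_hecke Q n).psi_sq a trivial, hp _ _ (by rwa [hk, hk]), evalAt_one]

theorem psiWord_cons (a : Fin (n - 1)) (v : List (Fin (n - 1))) :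
    psiWord Q (a :: v) = psi Q a * psiWord Q v := by simp [psiWord]

theorem psiWord_concat (v : List (Fin (n - 1))) (a : Fin (n - 1)) :
    psiWord Q (v ++ [a]) = psiWord Q v * psi Q a := by simp [psiWord]

theorem psiWord_nil : psiWord Q ([] : List (Fin (n - 1))) = 1 := by simp [psiWord]

theorem psiWord_mul_eLabel (v : List (Fin (n - 1))) (t : Fin n → Fin d) :
    psiWord Q v * eLabel Q p t = eLabel Q p (act (wordProd v) t) * psiWord Q v := by
  induction v with
  | nil => simp [psiWord, wordProd]
  | cons a v ih =>
    rw [psiWord_cons, wordProd_cons, mul_assoc, ih, ← mul_assoc, psi_mul_eLabel, act_mul,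
      mul_assoc]

variable {l : Comp d n}

theorem SortPath.eLabel_mul {v : List (Fin (n - 1))} {t : Shape l} (h : SortPath l v t) :
    eLabel Q p t.1 * (psiWord Q v * eLabel Q p (tTriv l)) =
      psiWord Q v * eLabel Q p (tTriv l) := by
  induction h with
  | nil => rw [psiWord_nil, one_mul]; exact eLabel_mul_self Q p _
  | @cons a v t h hv ih =>
    have h2 := psi_mul_eLabel Q p (act (s a) t.1) a
    rw [act_s_act_s] at h2
    rw [psiWord_cons, mul_assoc, ← ih]
    change _ * (psi Q a * (eLabel Q p (act (s a) t.1) * _)) =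
      psi Q a * (eLabel Q p (act (s a) t.1) * _)
    rw [← mul_assoc (psi Q a), h2, mul_assoc, ← mul_assoc (eLabel Q p t.1), eLabel_mul_self]

/-- Local confluence at two adjacent descents: both orders of exchange reverse the three strictly
decreasing labels. As the outer labels differ, the braid relation is exact. -/
theorem braid_descents {t : Shape l} {a b : Fin (n - 1)} (hab : b.val = a.val + 1)
    (ha : t.1 (hi a) < t.1 (lo a)) (hb : t.1 (hi b) < t.1 (lo b)) {w : List (Fin (n - 1))}
    (hw : SortPath l w (shapeAct (s a) (shapeAct (s b) (shapeAct (s a) t)))) :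
    SortPath l (b :: a :: w) (shapeAct (s a) t) ∧ SortPath l (a :: b :: w) (shapeAct (s b) t) ∧
      psiWord Q (a :: b :: a :: w) * eLabel Q p (tTriv l) =
        psiWord Q (b :: a :: b :: w) * eLabel Q p (tTriv l) := by
  obtain ⟨h1, h2, h3⟩ := braid_positions hab
  have e1 : s a (lo a) = hi a := s_lo a
  have e2 : s a (hi a) = lo a := s_hi a
  have e3 : s b (hi a) = hi b := by rw [← h1]; exact s_lo b
  have e4 : s b (hi b) = hi a := by rw [← h1]; exact s_hi b
  have hw' : shapeAct (s a) (shapeAct (s b) (shapeAct (s a) t)) =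
      shapeAct (s b) (shapeAct (s a) (shapeAct (s b) t)) := by
    simp only [← shapeAct_mul]
    rw [← mul_assoc, ← mul_assoc, s_braid hab]
  rw [h1] at hb
  refine ⟨.cons ?_ (.cons ?_ hw), .cons ?_ (.cons ?_ (hw' ▸ hw)), ?_⟩
  · rw [shapeAct_s_apply, shapeAct_s_apply, h2, h1, e2]; exact hb.trans ha
  · rw [shapeAct_s_apply, shapeAct_s_apply, shapeAct_s_apply, shapeAct_s_apply, e3, h3, h2, e1]
    exact hb
  · rw [shapeAct_s_apply, shapeAct_s_apply, e3, h3]; exact hb.trans ha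
  · rw [shapeAct_s_apply, shapeAct_s_apply, shapeAct_s_apply, shapeAct_s_apply, h2, h1, e2, h3, e4]
    exact ha
  · have h4 := hw.eLabel_mul (Q := Q) (p := p)
    simp only [psiWord_cons, mul_assoc]
    rw [← h4]
    simp only [← mul_assoc]
    rw [← braid_mul_eLabel hab]
    · simp only [shapeAct_s_apply, e1, e3, h2, e4, e2]
      exact (hb.trans ha).ne

/-- The element of `H_n(Q)` attached to a sorting word depends only on the sorted tuple. -/
theorem SortPath.psiWord_eq (t : Shape l) : ∀ {v v' : List (Fin (n - 1))}, SortPath l v t →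
    SortPath l v' t →
      psiWord Q v * eLabel Q p (tTriv l) = psiWord Q v' * eLabel Q p (tTriv l) := by
  have hnot : ∀ a : Fin (n - 1), ¬ (shapeTriv l).1 (hi a) < (shapeTriv l).1 (lo a) := fun a =>
    not_lt.2 (monotone_tTriv l (lo_lt_hi a).le)
  induction t using shape_induction with
  | triv =>
    intro v v' hv hv'
    have key : ∀ {t v}, SortPath l v t → t = shapeTriv l → v = [] := by
      intro t v h ht
      cases h with
      | nil => rfl
      | cons h _ => exact absurd (ht ▸ h) (hnot _)
    rw [key hv rfl, key hv' rfl]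
  | step t a' ha' ih =>
    intro v v' hv hv'
    cases hv with
    | nil => exact absurd ha' (hnot a')
    | @cons a v _ ha hv =>
    cases hv' with
    | nil => exact absurd ha' (hnot a')
    | @cons b v' _ hb hv' =>
    have iha := @ih _ (disorder_lt ha)
    have ihb := @ih _ (disorder_lt hb)
    rw [psiWord_cons, psiWord_cons]
    -- Compare first letters as in the diamond lemma: both words are replaced by ones with a common
    -- tail, and the beginnings agree by a braid or commutation relation.
    rcases lt_trichotomy a.val b.val with h | h | h
    · by_cases hab : b.val = a.val + 1
      · obtain ⟨w, hw⟩ := exists_sortPath (shapeAct (s a) (shapeAct (s b) (shapeAct (s a) t)))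
        obtain ⟨h1, h2, h3⟩ := braid_descents (Q := Q) (p := p) hab ha hb hw
        rw [mul_assoc, mul_assoc, iha hv h1, ihb hv' h2]
        simp only [psiWord_cons, mul_assoc] at h3 ⊢
        exact h3
      · obtain ⟨h1, h2⟩ := s_apply_far (a := a) (b := b) (by omega)
        obtain ⟨h1', h2'⟩ := s_apply_far (a := b) (b := a) (by omega)
        obtain ⟨w, hw⟩ := exists_sortPath (shapeAct (s b) (shapeAct (s a) t))
        have hw' := hw
        rw [← shapeAct_mul, s_comm (by omega), shapeAct_mul] at hw'
        have p1 : SortPath l (b :: w) (shapeAct (s a) t) := .cons (by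
          rw [shapeAct_s_apply, shapeAct_s_apply, h1, h2]; exact hb) hw
        have p2 : SortPath l (a :: w) (shapeAct (s b) t) := .cons (by
          rw [shapeAct_s_apply, shapeAct_s_apply, h1', h2']; exact ha) hw'
        rw [mul_assoc, mul_assoc, iha hv p1, ihb hv' p2, psiWord_cons, psiWord_cons]
        simp only [← mul_assoc]
        rw [(isKLR_hecke Q n).psi_psi a b trivial trivial (by omega)]
    · obtain rfl : a = b := Fin.ext h
      rw [mul_assoc, mul_assoc, iha hv hv']
    · by_cases hab : a.val = b.val + 1
      · obtain ⟨w, hw⟩ := exists_sortPath (shapeAct (s b) (shapeAct (s a) (shapeAct (s b) t)))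
        obtain ⟨h1, h2, h3⟩ := braid_descents (Q := Q) (p := p) hab hb ha hw
        rw [mul_assoc, mul_assoc, iha hv h2, ihb hv' h1]
        simp only [psiWord_cons, mul_assoc] at h3 ⊢
        exact h3.symm
      · obtain ⟨h1, h2⟩ := s_apply_far (a := a) (b := b) (by omega)
        obtain ⟨h1', h2'⟩ := s_apply_far (a := b) (b := a) (by omega)
        obtain ⟨w, hw⟩ := exists_sortPath (shapeAct (s b) (shapeAct (s a) t))
        have hw' := hw
        rw [← shapeAct_mul, s_comm (by omega), shapeAct_mul] at hw'
        have p1 : SortPath l (b :: w) (shapeAct (s a) t) := .cons (by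
          rw [shapeAct_s_apply, shapeAct_s_apply, h1, h2]; exact hb) hw
        have p2 : SortPath l (a :: w) (shapeAct (s b) t) := .cons (by
          rw [shapeAct_s_apply, shapeAct_s_apply, h1', h2']; exact ha) hw'
        rw [mul_assoc, mul_assoc, iha hv p1, ihb hv' p2, psiWord_cons, psiWord_cons]
        simp only [← mul_assoc]
        rw [(isKLR_hecke Q n).psi_psi a b trivial trivial (by omega)]

variable (Q p) in
/-- The element `ψ_{π_t⁻¹} e(t^l)`. -/
noncomputable def intertwiner (t : Shape l) : Hecke Q n :=
  psiWord Q (exists_sortPath t).choose * eLabel Q p (tTriv l)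

theorem intertwiner_eq {v : List (Fin (n - 1))} {t : Shape l} (h : SortPath l v t) :
    intertwiner Q p t = psiWord Q v * eLabel Q p (tTriv l) :=
  SortPath.psiWord_eq t (exists_sortPath t).choose_spec h

theorem intertwiner_triv : intertwiner Q p (shapeTriv l) = eLabel Q p (tTriv l) := by
  rw [intertwiner_eq .nil, psiWord_nil, one_mul]

theorem intertwiner_of_descent {t : Shape l} {a : Fin (n - 1)} (h : t.1 (hi a) < t.1 (lo a)) :
    intertwiner Q p t = psi Q a * intertwiner Q p (shapeAct (s a) t) := by
  obtain ⟨v, hv⟩ := exists_sortPath (shapeAct (s a) t)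
  rw [intertwiner_eq (.cons h hv), intertwiner_eq hv, psiWord_cons, mul_assoc]

theorem eLabel_mul_intertwiner (t : Shape l) :
    eLabel Q p t.1 * intertwiner Q p t = intertwiner Q p t :=
  (exists_sortPath t).choose_spec.eLabel_mul

theorem intertwiner_mul_eLabel (t : Shape l) :
    intertwiner Q p t * eLabel Q p (tTriv l) = intertwiner Q p t := by
  rw [intertwiner, mul_assoc, eLabel_mul_self]

include hp in
-- At an ascent of `t` this extends the sorting word by one letter; at a descent it cancels the
-- first letter, as ψ_a² = 1 there.
theorem psi_mul_intertwiner_of_ne {t : Shape l} {a : Fin (n - 1)} (h : t.1 (lo a) ≠ t.1 (hi a)) :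
    psi Q a * intertwiner Q p t = intertwiner Q p (shapeAct (s a) t) := by
  have h1 : (shapeAct (s a) t).1 (hi a) = t.1 (lo a) := by rw [shapeAct_s_apply, s_hi]
  have h2 : (shapeAct (s a) t).1 (lo a) = t.1 (hi a) := by rw [shapeAct_s_apply, s_lo]
  rcases lt_or_gt_of_ne h with h' | h'
  · rw [intertwiner_of_descent (t := shapeAct (s a) t) (a := a) (by rwa [h1, h2]), shapeAct_s_s]
  · rw [intertwiner_of_descent h', ← eLabel_mul_intertwiner, ← mul_assoc, ← mul_assoc,
      psi_sq_mul_eLabel hp (by rw [h1, h2]; exact h.symm)]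

theorem y_mul_intertwiner (t : Shape l) : ∀ c : Fin n,
    y Q c * intertwiner Q p t = intertwiner Q p t * y Q (minRep l t c) := by
  induction t using shape_induction with
  | triv =>
    intro c
    rw [intertwiner_triv, minRep_shapeTriv, ← (eLabel_commute_y Q p _ c).eq]; rfl
  | step t a ha ih =>
    intro c
    have h1 : (shapeAct (s a) t).1 (lo a) ≠ (shapeAct (s a) t).1 (hi a) := by
      rw [shapeAct_s_apply, shapeAct_s_apply, s_lo, s_hi]; exact ha.ne
    have h2 := ih _ (disorder_lt ha) (s a c)
    rw [minRep_shapeAct t ha.ne', Equiv.Perm.mul_apply, s_s] at h2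
    have h3 := eLabel_mul_intertwiner (Q := Q) (p := p) (shapeAct (s a) t)
    rw [intertwiner_of_descent ha, mul_assoc (psi Q a), ← h2]
    conv_lhs => rw [← h3]
    conv_rhs => rw [← h3]
    simp only [← mul_assoc]
    rw [y_mul_psi_mul_eLabel h1]

theorem e_mul_intertwiner (t : Shape l) : ∀ k : Fin n → K,
    e Q k * intertwiner Q p t = intertwiner Q p t * e Q (act (minRep l t) k) := by
  induction t using shape_induction with
  | triv =>
    intro k
    rw [intertwiner_triv, minRep_shapeTriv, (eLabel_commute_e Q p _ _).eq]; rfl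
  | step t a ha ih =>
    intro k
    have h2 := ih _ (disorder_lt ha) (act (s a) k)
    rw [minRep_shapeAct t ha.ne', act_mul, act_s_act_s] at h2
    have h3 := (isKLR_hecke Q n).psi_e a trivial (act (s a) k)
    rw [act_s_act_s] at h3
    rw [intertwiner_of_descent ha, mul_assoc (psi Q a), ← h2, ← mul_assoc, ← mul_assoc, h3]

/-- Peel off a descent `b`. If `b` is far from `a`, the two ψ's commute. If it is adjacent,
exchanging at `b` creates a descent at `a`; the exact braid relation turns ψ_a ψ_b ψ_a into ψ_b ψ_a
ψ_b, and induction applies to ψ_b two exchanges further down. -/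
theorem psi_mul_intertwiner_of_eq (t : Shape l) : ∀ {a c : Fin (n - 1)},
    t.1 (lo a) = t.1 (hi a) → lo c = minRep l t (lo a) →
      psi Q a * intertwiner Q p t = intertwiner Q p t * psi Q c := by
  induction t using shape_induction with
  | triv =>
    intro a c h hc
    rw [minRep_shapeTriv] at hc
    obtain rfl : c = a := lo_injective hc
    rw [intertwiner_triv, psi_mul_eLabel, act_s_tTriv l (inBlock_iff.2 h)]
  | step t b hb ih =>
    intro a c h hc
    have hbm := minRep_shapeAct t hb.ne'
    rcases lt_trichotomy a.val b.val with hab | hab | hab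
    · by_cases hab' : b.val = a.val + 1
      · obtain ⟨h1, h2, h3⟩ := braid_positions hab'
        have e2 : s a (hi a) = lo a := s_hi a
        have e1 : s a (lo a) = hi a := s_lo a
        have e3 : s b (hi a) = hi b := by rw [← h1]; exact s_lo b
        have e4 : s b (hi b) = hi a := by rw [← h1]; exact s_hi b
        have hb' := hb
        rw [h1, ← h] at hb'
        have ha : (shapeAct (s b) t).1 (hi a) < (shapeAct (s b) t).1 (lo a) := by
          rw [shapeAct_s_apply, shapeAct_s_apply, e3, h3]; exact hb'
        have h4 := ih _ ((disorder_lt ha).trans (disorder_lt hb)) (a := b) (c := c)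
          (by simp only [shapeAct_s_apply, h1, h2, e2, e4, h3, h])
          (by rw [minRep_shapeAct _ ha.ne', hbm, Equiv.Perm.mul_apply, Equiv.Perm.mul_apply, h1,
            e2, h3, hc])
        have h5 := eLabel_mul_intertwiner (Q := Q) (p := p) (shapeAct (s a) (shapeAct (s b) t))
        rw [intertwiner_of_descent hb, intertwiner_of_descent ha, mul_assoc, mul_assoc, ← h4,
          ← h5]
        simp only [← mul_assoc]
        rw [braid_mul_eLabel hab']
        simp only [shapeAct_s_apply, e1, e3, h2, e4]
        rw [← h]
        exact hb'.ne
      · obtain ⟨h1, h2⟩ := s_apply_far (a := b) (b := a) (by omega)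
        have h4 := ih _ (disorder_lt hb) (a := a) (c := c)
          (by rw [shapeAct_s_apply, shapeAct_s_apply, h1, h2, h])
          (by rw [hbm, Equiv.Perm.mul_apply, h1, hc])
        rw [intertwiner_of_descent hb, mul_assoc, ← h4, ← mul_assoc, ← mul_assoc,
          (isKLR_hecke Q n).psi_psi a b trivial trivial (by omega)]
    · obtain rfl : a = b := Fin.ext hab
      exact absurd h hb.ne'
    · by_cases hab' : a.val = b.val + 1
      · obtain ⟨h1, h2, h3⟩ := braid_positions hab'
        have e2 : s b (hi b) = lo b := s_hi b
        have e1 : s b (lo b) = hi b := s_lo b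
        have e3 : s a (hi b) = hi a := by rw [← h1]; exact s_lo a
        have e4 : s a (hi a) = hi b := by rw [← h1]; exact s_hi a
        have hb' := hb
        rw [h1] at h
        rw [h] at hb'
        have ha : (shapeAct (s b) t).1 (hi a) < (shapeAct (s b) t).1 (lo a) := by
          rw [shapeAct_s_apply, shapeAct_s_apply, h2, h1, e2]; exact hb'
        have h4 := ih _ ((disorder_lt ha).trans (disorder_lt hb)) (a := b) (c := c)
          (by simp only [shapeAct_s_apply, h3, e1, e3, h2, h])
          (by rw [minRep_shapeAct _ ha.ne', hbm, Equiv.Perm.mul_apply, Equiv.Perm.mul_apply, h3,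
            e1, hc, h1])
        have h5 := eLabel_mul_intertwiner (Q := Q) (p := p) (shapeAct (s a) (shapeAct (s b) t))
        rw [intertwiner_of_descent hb, intertwiner_of_descent ha, mul_assoc, mul_assoc, ← h4,
          ← h5]
        simp only [← mul_assoc]
        rw [braid_mul_eLabel hab']
        simp only [shapeAct_s_apply, e1, h3, e4, e2]
        rw [h]
        exact hb'.ne
      · obtain ⟨h1, h2⟩ := s_apply_far (a := b) (b := a) (by omega)
        have h4 := ih _ (disorder_lt hb) (a := a) (c := c)
          (by rw [shapeAct_s_apply, shapeAct_s_apply, h1, h2, h])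
          (by rw [hbm, Equiv.Perm.mul_apply, h1, hc])
        rw [intertwiner_of_descent hb, mul_assoc, ← h4, ← mul_assoc, ← mul_assoc,
          (isKLR_hecke Q n).psi_psi a b trivial trivial (by omega)]

include hp in
-- The letters of a sorting word are undone in reverse order, each by ψ_a² = 1 at differing labels.
theorem exists_intertwiner_inverse (t : Shape l) :
    ∃ x, intertwiner Q p t * x = eLabel Q p t.1 := by
  induction t using shape_induction with
  | triv => exact ⟨1, by rw [intertwiner_triv, mul_one]; rfl⟩
  | step t a ha ih =>
    obtain ⟨x, hx⟩ := ih _ (disorder_lt ha)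
    refine ⟨x * psi Q a, ?_⟩
    rw [intertwiner_of_descent ha, mul_assoc, ← mul_assoc _ x, hx]
    change psi Q a * (eLabel Q p (act (s a) t.1) * psi Q a) = _
    rw [← psi_mul_eLabel, ← mul_assoc, psi_sq_mul_eLabel hp ha.ne']

/-! ### Injectivity -/

include hp in
-- The coefficients are those of the matrix of ψ_a: this links the intertwiners to Ψ.
theorem psi_mul_intertwiner (a : Fin (n - 1)) (t : Shape l) :
    psi Q a * intertwiner Q p t =
      intertwiner Q p (shapeAct (s a) t) * blockHom Q p l (psiCoeff (tP Q p l) a t) := by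
  by_cases h : t.1 (lo a) = t.1 (hi a)
  · obtain ⟨c, hc, -, hcB⟩ := exists_minRep_index t h
    rw [psiCoeff_of_eq h hc, psi_mul_intertwiner_of_eq t h hc, shapeAct_s_eq_self t h,
      blockHom_tP _ _ _ hcB, psi_mul_eLabel, act_s_tTriv l hcB, ← mul_assoc,
      intertwiner_mul_eLabel]
  · rw [psiCoeff_of_ne h, blockHom_one, intertwiner_mul_eLabel]
    exact psi_mul_intertwiner_of_ne hp h

end Intertwiners

/-! ### Bijectivity of Ψ and its explicit formulas -/

section Isomorphism

variable {K : Type*} [Fintype K] {A : Type*} [CommRing A] {d n : ℕ}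
  {Q : K → K → MvPolynomial (Fin 2) A} {p : K → Fin d}
  (hp : ∀ k k', p k ≠ p k' → Q k k' = 1) {l l' : Comp d n}

/-! ### Injectivity -/

theorem sum_intertwiner_mul_monomialMatrix (σ : Shape l → Shape l)
    (c : Shape l → HeckeTensor Q p l) (t : Shape l) :
    ∑ t', intertwiner Q p t' * blockHom Q p l (monomialMatrix σ c t' t) =
      intertwiner Q p (σ t) * blockHom Q p l (c t) := by
  rw [Finset.sum_eq_single (σ t)]
  · simp [monomialMatrix]
  · intro t' _ ht'
    simp [monomialMatrix, ht']
  · simp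

/-- The left ideal generated by the intertwiners is described by the matrices. -/
theorem mul_intertwiner (h : Hecke Q n) : ∀ t : Shape l, h * intertwiner Q p t =
    ∑ t', intertwiner Q p t' * blockHom Q p l (toMatrix hp l h t' t) := by
  induction h using hecke_induction with
  | algebraMap r =>
    intro t
    rw [AlgHom.commutes, ← Algebra.smul_def, Finset.sum_eq_single t]
    · rw [Matrix.algebraMap_matrix_apply, if_pos rfl, Algebra.algebraMap_eq_smul_one, map_smul,
        blockHom_one, mul_smul_comm, intertwiner_mul_eLabel]
    · intro t' _ ht'
      rw [Matrix.algebraMap_matrix_apply, if_neg ht', map_zero, mul_zero]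
    · simp
  | e k =>
    intro t
    rw [toMatrix_e, matE, sum_intertwiner_mul_monomialMatrix, blockHom_tE, e_mul_intertwiner,
      ← (eLabel_commute_e Q p _ _).eq, ← mul_assoc, intertwiner_mul_eLabel]
  | y a =>
    intro t
    rw [toMatrix_y, matY, sum_intertwiner_mul_monomialMatrix, blockHom_tY, y_mul_intertwiner,
      ← (eLabel_commute_y Q p _ _).eq, ← mul_assoc, intertwiner_mul_eLabel]
  | psi a =>
    intro t
    rw [toMatrix_psi, matP, sum_intertwiner_mul_monomialMatrix, psi_mul_intertwiner hp]
  | add x z hx hz =>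
    intro t
    rw [add_mul, hx, hz, ← Finset.sum_add_distrib, map_add]
    refine Finset.sum_congr rfl fun t' _ => ?_
    rw [Matrix.add_apply, map_add, mul_add]
  | mul x z hx hz =>
    intro t
    rw [mul_assoc, hz, Finset.mul_sum, map_mul]
    simp only [← mul_assoc, hx, Matrix.mul_apply, map_sum, map_mul, Finset.mul_sum, Finset.sum_mul]
    exact Finset.sum_comm

/-- The composition of `n` recording the multiplicities of a tuple. -/
def compOf (t : Fin n → Fin d) : Comp d n :=
  ⟨fun j => (Finset.univ.filter fun a => t a = j).card, by
    rw [← Finset.card_eq_sum_card_fiberwise fun _ _ => Finset.mem_coe.2 (Finset.mem_univ _),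
      Finset.card_univ, Fintype.card_fin]⟩

/-- All components of the isomorphism together. -/
noncomputable def toMatrices : Hecke Q n →ₐ[A]
    ((l : Comp d n) → Matrix (Shape l) (Shape l) (HeckeTensor Q p l)) :=
  AlgHom.pi fun l => toMatrix hp l

theorem toMatrices_apply (h : Hecke Q n) (l : Comp d n) :
    toMatrices hp h l = toMatrix hp l h := rfl

/-- If all matrices of `h` vanish, `h` kills every intertwiner; multiplying by its right factor
shows that `h` kills every e(t), and these sum to 1. -/
theorem toMatrices_injective : Function.Injective (toMatrices (Q := Q) (n := n) hp) := by
  refine (injective_iff_map_eq_zero _).2 fun h hh => ?_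
  rw [← mul_one h, ← sum_eLabel Q p, Finset.mul_sum]
  refine Finset.sum_eq_zero fun t _ => ?_
  obtain ⟨x, hx⟩ := exists_intertwiner_inverse hp (l := compOf t) ⟨t, fun _ => rfl⟩
  have h1 : toMatrix hp (compOf t) h = 0 := congrFun hh _
  change intertwiner Q p _ * x = eLabel Q p t at hx
  rw [← hx, ← mul_assoc, mul_intertwiner hp, h1]
  simp

/-! ### Reduced words -/

theorem eq_shapeTriv_of_isReducedExpr_nil {t : Shape l} (h : IsReducedExpr [] (minRep l t)) :
    t = shapeTriv l := by
  have h1 := act_minRep t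
  rw [← h.1] at h1
  exact Subtype.ext h1

/-- Matrix of `e(t^l) ψ_{π_t}`. -/
theorem toMatrix_eLabel_mul_psiWord {u : List (Fin (n - 1))} : ∀ {t : Shape l},
    IsReducedExpr u (minRep l t) →
      toMatrix hp l (eLabel Q p (tTriv l) * psiWord Q u) = Matrix.single (shapeTriv l) t 1 := by
  induction u using List.reverseRecOn with
  | nil =>
    intro t h
    rw [eq_shapeTriv_of_isReducedExpr_nil h, psiWord_nil, mul_one]
    exact toMatrix_eLabel_shape hp l (shapeTriv l)
  | append_singleton u a ih =>
    intro t h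
    -- The last letter of a reduced word of π_t exchanges different labels, so it contributes the
    -- coefficient 1 and leaves a reduced word for the exchanged tuple.
    have hne := ne_of_isReducedExpr_concat t h
    have h1 := h.of_concat
    rw [← minRep_shapeAct t hne] at h1
    rw [psiWord_concat, ← mul_assoc, map_mul, ih h1, toMatrix_psi, matP,
      single_mul_monomialMatrix _ (shapeAct_injective _), psiCoeff_of_ne hne, mul_one]

/-- Matrix of `ψ_{π_t⁻¹} e(t^l)`. -/
theorem toMatrix_psiWord_mul_eLabel {v : List (Fin (n - 1))} : ∀ {t : Shape l},
    IsReducedExpr v (minRep l t)⁻¹ →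
      toMatrix hp l (psiWord Q v * eLabel Q p (tTriv l)) = Matrix.single t (shapeTriv l) 1 := by
  induction v with
  | nil =>
    intro t h
    have h' := h.reverse
    rw [inv_inv] at h'
    rw [eq_shapeTriv_of_isReducedExpr_nil h', psiWord_nil, one_mul]
    exact toMatrix_eLabel_shape hp l (shapeTriv l)
  | cons a v ih =>
    intro t h
    have h' := h.reverse
    rw [inv_inv, List.reverse_cons] at h'
    have hne := ne_of_isReducedExpr_concat t h'
    have h1 := h'.of_concat
    rw [← minRep_shapeAct t hne] at h1
    have h2 := h1.reverse
    rw [List.reverse_reverse] at h2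
    rw [psiWord_cons, mul_assoc, map_mul, ih h2, toMatrix_psi, matP, monomialMatrix_mul_single,
      shapeAct_s_s, psiCoeff_of_ne, mul_one]
    rw [shapeAct_s_apply, shapeAct_s_apply, s_lo, s_hi]
    exact hne.symm

theorem toMatrices_eq_single {x : Hecke Q n} {m : Matrix (Shape l) (Shape l) (HeckeTensor Q p l)}
    [DecidableEq (Comp d n)] (h : toMatrix hp l x = m)
    (h' : ∀ l', l ≠ l' → toMatrix hp l' x = 0) : toMatrices hp x = Pi.single l m := by
  funext l'
  rw [toMatrices_apply]
  by_cases hl : l = l'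
  · subst hl; rw [h, Pi.single_eq_same]
  · rw [h' l' hl, Pi.single_eq_of_ne (Ne.symm hl)]

theorem toMatrices_blockHom [DecidableEq (Comp d n)] (x : HeckeTensor Q p l) :
    toMatrices hp (blockHom Q p l x) =
      Pi.single l (Matrix.single (shapeTriv l) (shapeTriv l) x) :=
  toMatrices_eq_single hp (toMatrix_blockHom hp l x) fun _ h => toMatrix_blockHom_of_ne hp h x

theorem toMatrices_word [DecidableEq (Comp d n)] {t' t : Shape l} {v u : List (Fin (n - 1))}
    (hv : IsReducedExpr v (minRep l t')⁻¹) (hu : IsReducedExpr u (minRep l t))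
    (x : HeckeTensor Q p l) :
    toMatrices hp (psiWord Q v * blockHom Q p l x * psiWord Q u) =
      Pi.single l (Matrix.single t' t x) := by
  refine toMatrices_eq_single hp ?_ fun l' h => ?_
  · have h1 : psiWord Q v * blockHom Q p l x * psiWord Q u =
        (psiWord Q v * eLabel Q p (tTriv l)) * blockHom Q p l x *
          (eLabel Q p (tTriv l) * psiWord Q u) := by
      rw [← mul_assoc, mul_assoc _ _ (eLabel Q p (tTriv l)), blockHom_mul_eLabel, mul_assoc _ _
        (blockHom Q p l x), eLabel_mul_blockHom]
    rw [h1, map_mul, map_mul, toMatrix_psiWord_mul_eLabel hp hv, toMatrix_eLabel_mul_psiWord hp hu,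
      toMatrix_blockHom, Matrix.single_mul_single_same, Matrix.single_mul_single_same, one_mul,
      mul_one]
  · rw [map_mul, map_mul, toMatrix_blockHom_of_ne hp h, mul_zero, zero_mul]

theorem toMatrices_surjective : Function.Surjective (toMatrices (Q := Q) (n := n) hp) := by
  classical
  have := Fintype.ofFinite (Comp d n)
  intro m
  rw [← AlgHom.mem_range, ← Finset.univ_sum_single m]
  refine sum_mem fun l _ => ?_
  induction m l using Matrix.induction_on' with
  | h_zero => rw [Pi.single_zero]; exact zero_mem _
  | h_add m m' h h' => rw [Pi.single_add]; exact add_mem h h'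
  | h_std_basis t' t x =>
    obtain ⟨v, hv⟩ := exists_isReducedExpr (minRep l t')⁻¹
    obtain ⟨u, hu⟩ := exists_isReducedExpr (minRep l t)
    exact ⟨_, toMatrices_word hp hv hu x⟩

/-- The decomposition of `H_n(Q)` into matrix algebras. -/
noncomputable def decomposition : Hecke Q n ≃ₐ[A]
    ((l : Comp d n) → Matrix (Shape l) (Shape l) (HeckeTensor Q p l)) :=
  AlgEquiv.ofBijective (toMatrices hp) ⟨toMatrices_injective hp, toMatrices_surjective hp⟩

include hp in
theorem isBlockEmbedding_blockHom (l : Comp d n) : IsBlockEmbedding Q p l (blockHom Q p l) where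
  injective x z h := by
    have h1 := toMatrix_blockHom hp l x
    rw [h, toMatrix_blockHom hp l z] at h1
    have h2 := congrFun (congrFun h1 (shapeTriv l)) (shapeTriv l)
    rwa [Matrix.single_apply_same, Matrix.single_apply_same, eq_comm] at h2
  range_eq := by
    classical
    ext x
    constructor
    · rintro ⟨z, rfl⟩
      exact ⟨blockHom Q p l z, by rw [eLabel_mul_blockHom, blockHom_mul_eLabel]⟩
    · rintro ⟨h, rfl⟩
      -- The preimage is the entry of Ψ(h) at (t^λ, t^λ): its image under ι_λ has the same matrices
      -- as the corner element.
      refine ⟨toMatrix hp l h (shapeTriv l) (shapeTriv l), toMatrices_injective hp ?_⟩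
      rw [toMatrices_blockHom, show tTriv l = (shapeTriv l).1 from rfl]
      refine (toMatrices_eq_single hp ?_ fun l' hl => ?_).symm
      · rw [map_mul, map_mul, toMatrix_eLabel_shape, Matrix.single_mul_mul_single, one_mul, mul_one]
      · rw [map_mul, toMatrix_eLabel_of_ne hp hl, mul_zero]
  map_one := blockHom_one Q p l
  map_e k := by
    classical
    rw [← tE_concat, blockHom_tE, ← (eLabel_commute_e Q p _ _).eq, eLabel_mul_e,
      if_pos (show ∀ a, _ from isLabelled_concat k)]
  map_y j b := by
    rw [← blockHom_tY, tY_blk]; rfl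
  map_psi j b := by
    rw [← blockHom_tP _ _ _ (inBlock_blkSimple j b), tP_blkSimple]; rfl

/-- The entries of the matrices of an element of `H_n(Q)`. -/
theorem blockHom_toMatrix {t' t : Shape l} {u v : List (Fin (n - 1))}
    (hu : IsReducedExpr u (minRep l t')) (hv : IsReducedExpr v (minRep l t)⁻¹) (h : Hecke Q n) :
    blockHom Q p l (toMatrix hp l h t' t) =
      psiWord Q u * (eLabel Q p t'.1 * h * eLabel Q p t.1) * psiWord Q v := by
  classical
  have h1 : psiWord Q u * eLabel Q p t'.1 = eLabel Q p (tTriv l) * psiWord Q u := by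
    rw [psiWord_mul_eLabel, hu.1, act_minRep]
  have h2 : eLabel Q p t.1 * psiWord Q v = psiWord Q v * eLabel Q p (tTriv l) := by
    rw [psiWord_mul_eLabel, hv.1, ← act_minRep t, ← act_mul, inv_mul_cancel, act_one]
  have h3 : psiWord Q u * (eLabel Q p t'.1 * h * eLabel Q p t.1) * psiWord Q v =
      eLabel Q p (tTriv l) * psiWord Q u * h * (psiWord Q v * eLabel Q p (tTriv l)) := by
    rw [← h1, ← h2]; simp only [mul_assoc]
  -- With e(t^λ) moved to the outside, both sides have as their only nonzero component the matrix
  -- carrying the (t', t) entry at (t^λ, t^λ).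
  refine toMatrices_injective hp ?_
  rw [toMatrices_blockHom, h3]
  refine (toMatrices_eq_single hp ?_ fun l' hl => ?_).symm
  · rw [map_mul, map_mul, toMatrix_eLabel_mul_psiWord hp hu, toMatrix_psiWord_mul_eLabel hp hv,
      Matrix.single_mul_mul_single, one_mul, mul_one]
  · rw [map_mul, map_mul (toMatrix hp l') (psiWord Q v), show tTriv l = (shapeTriv l).1 from rfl,
      toMatrix_eLabel_of_ne hp hl, mul_zero, mul_zero]

end Isomorphism

end QuiverHecke

theorem mainTheorem3 {K : Type*} [Fintype K] {A : Type*} [CommRing A] {d n : ℕ}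
    (Q : K → K → MvPolynomial (Fin 2) A) (hQ : QuiverHecke.IsRouquierMatrix Q)
    (p : K → Fin d) (hp : ∀ k k', p k ≠ p k' → Q k k' = 1) :
    Nonempty (QuiverHecke.Hecke Q n ≃ₐ[A]
      ((l : QuiverHecke.Comp d n) →
        Matrix (Fin (QuiverHecke.mult l)) (Fin (QuiverHecke.mult l))
          (QuiverHecke.HeckeTensor Q p l))) ∧
    (∀ l : QuiverHecke.Comp d n, Fintype.card (QuiverHecke.Shape l) = QuiverHecke.mult l) ∧
    (∀ (l : QuiverHecke.Comp d n) (t : QuiverHecke.Shape l),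
      ∃! w, QuiverHecke.IsMinCosetRep l t w) ∧
    ∃ (i : ∀ l : QuiverHecke.Comp d n,
        QuiverHecke.HeckeTensor Q p l →ₙₐ[A] QuiverHecke.Hecke Q n)
      (Ψ : QuiverHecke.Hecke Q n ≃ₐ[A]
        ((l : QuiverHecke.Comp d n) →
          Matrix (QuiverHecke.Shape l) (QuiverHecke.Shape l) (QuiverHecke.HeckeTensor Q p l))),
      (∀ l, QuiverHecke.IsBlockEmbedding Q p l (i l)) ∧
      ∀ (l : QuiverHecke.Comp d n) (t' t : QuiverHecke.Shape l)
        (u' v' u v : List (Fin (n - 1))),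
        QuiverHecke.IsReducedExpr u' (QuiverHecke.minRep l t') →
        QuiverHecke.IsReducedExpr v' (QuiverHecke.minRep l t')⁻¹ →
        QuiverHecke.IsReducedExpr u (QuiverHecke.minRep l t) →
        QuiverHecke.IsReducedExpr v (QuiverHecke.minRep l t)⁻¹ →
        (∀ x : QuiverHecke.HeckeTensor Q p l,
          Ψ.symm (Pi.single l (Matrix.single t' t x)) =
            QuiverHecke.psiWord Q v' * i l x * QuiverHecke.psiWord Q u) ∧
        (∀ h : QuiverHecke.Hecke Q n,
          i l (Ψ h l t' t) =
            QuiverHecke.psiWord Q u' *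
              (QuiverHecke.eLabel Q p t'.1 * h * QuiverHecke.eLabel Q p t.1) *
              QuiverHecke.psiWord Q v) := by
  classical
  refine ⟨⟨(QuiverHecke.decomposition hp).trans (AlgEquiv.piCongrRight fun l =>
      Matrix.reindexAlgEquiv A _ (Fintype.equivFinOfCardEq (QuiverHecke.card_shape (l := l))))⟩,
    fun l => QuiverHecke.card_shape, fun l t => QuiverHecke.existsUnique_minCosetRep t,
    QuiverHecke.blockHom Q p, QuiverHecke.decomposition hp,
    QuiverHecke.isBlockEmbedding_blockHom hp, fun l t' t u' v' u v hu' hv' hu hv =>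
      ⟨fun x => ?_, fun h => QuiverHecke.blockHom_toMatrix hp hu' hv h⟩⟩
  rw [AlgEquiv.symm_apply_eq]
  exact Eq.trans (by congr!) (QuiverHecke.toMatrices_word hp hv' hu x).symm
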